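/- Let $R,\mu>0$ be fixed. For $\delta>0$ let $D_1$ and $D_2$ be the open disks in $\mathbb{R}^2$ of radius $R$ centred at $(-R-\delta/2,0)$ and $(R+\delta/2,0)$, so that $\delta$ is the distance between them, and let $D^e=\mathbb{R}^2\setminus\overline{D_1\cup D_2}$. Let $\mathbf{U}_{\rm sh}(x,y)=(y,x)^T$. Consider pairs $(\mathbf v_2,q_2)$ with $\mathbf v_2\in C^2(D^e)\cap C(\overline{D^e})$ and $q_2\in C^1(D^e)$ such that $$ \mu\Delta\mathbf v_2=\nabla q_2,\qquad \nabla\cdot\mathbf v_2=0\quad\text{in } D^e,\qquad \mathbf v_2=0\quad\text{on }\partial D_1\cup\partial D_2, $$ and such that, as $|\mathbf x|\to\infty$, $$ \mathbf v_2-\mathbf U_{\rm sh}=\mathbf C+O(|\mathbf x|^{-1}),\qquad \nabla(\mathbf v_2-\mathbf U_{\rm sh})=O(|\mathbf x|^{-2}),\qquad q_2=O(|\mathbf x|^{-2}) $$ for some constant vector $\mathbf C\in\mathbb{R}^2$. Put $\mathcal E[\mathbf v]=\frac12(\nabla\mathbf v+\nabla\mathbf v^T)$ and $\sigma[\mathbf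 v,q]=-qI+2\mu\,\mathcal E[\mathbf v]$. For every $\delta>0$ such a pair $(\mathbf v_2,q_2)$ exists. Moreover, for every $\delta_0>0$ there is a constant $C$, depending only on $R$, $\mu$ and $\delta_0$, such that for all $0<\delta\le\delta_0$ every such pair satisfies $$ \|\mathcal E[\mathbf v_2]\|_\infty\le C,\qquad \|q_2\|_\infty\le C,\qquad \|\sigma[\mathbf v_2,q_2]\|_\infty\le C, $$ where $\|\cdot\|_\infty$ is the supremum over $D^e$ (of the absolute values of the entries, for matrix-valued functions). -/

import Mathlib

noncomputable section

namespace StokesTwoDisks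

/-- The Euclidean plane. -/
abbrev Plane : Type := EuclideanSpace ℝ (Fin 2)

/-- The left open disk of radius `R`, centred at `(-R - δ/2, 0)`. -/
def leftDisk (R δ : ℝ) : Set Plane := Metric.ball !₂[-R - δ / 2, 0] R

/-- The right open disk of radius `R`, centred at `(R + δ/2, 0)`. -/
def rightDisk (R δ : ℝ) : Set Plane := Metric.ball !₂[R + δ / 2, 0] R

/-- The fluid domain: the complement of the closure of the two disks. -/
def fluidDomain (R δ : ℝ) : Set Plane := (closure (leftDisk R δ ∪ rightDisk R δ))ᶜ

/-- The partial derivative `∂ u_i / ∂ x_j` at `x`. -/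
def partialDeriv (u : Plane → Plane) (j i : Fin 2) (x : Plane) : ℝ :=
  (fderiv ℝ u x (EuclideanSpace.single j 1)) i

/-- The divergence of a vector field. -/
def divergence (u : Plane → Plane) (x : Plane) : ℝ := ∑ i, partialDeriv u i i x

/-- The Jacobian matrix of a vector field. -/
def jacobian (u : Plane → Plane) (x : Plane) : Matrix (Fin 2) (Fin 2) ℝ :=
  Matrix.of fun i j => partialDeriv u j i x

/-- The strain tensor, the symmetric part of the Jacobian matrix. -/
def strain (u : Plane → Plane) (x : Plane) : Matrix (Fin 2) (Fin 2) ℝ :=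
  (1 / 2 : ℝ) • (jacobian u x + (jacobian u x).transpose)

/-- The stress tensor `-p I + 2 μ ℰ[u]`. -/
def stress (μ : ℝ) (u : Plane → Plane) (p : Plane → ℝ) (x : Plane) :
    Matrix (Fin 2) (Fin 2) ℝ :=
  -(p x) • (1 : Matrix (Fin 2) (Fin 2) ℝ) + (2 * μ) • strain u x

/-- `(u, p)` is a classical solution of the homogeneous Stokes system of viscosity `μ` in the
open set `Ω`: `μ Δu = ∇p` and `∇ · u = 0`. -/
structure IsStokesFlow (μ : ℝ) (Ω : Set Plane) (u : Plane → Plane) (p : Plane → ℝ) : Prop where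
  contDiffOn_velocity : ContDiffOn ℝ 2 u Ω
  contDiffOn_pressure : ContDiffOn ℝ 1 p Ω
  momentum : ∀ x ∈ Ω, μ • Laplacian.laplacian u x = gradient p x
  incompressible : ∀ x ∈ Ω, divergence u x = 0

/-- The decay class: for some constant vector `c`, `w = c + O(|x|⁻¹)`, `∇w = O(|x|⁻²)` and
`p = O(|x|⁻²)` as `|x| → ∞`. -/
def DecayClass (w : Plane → Plane) (p : Plane → ℝ) : Prop :=
  (∃ c : Plane, (fun x => w x - c) =O[Bornology.cobounded Plane] fun x => ‖x‖⁻¹) ∧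
  (fderiv ℝ w =O[Bornology.cobounded Plane] fun x => (‖x‖ ^ 2)⁻¹) ∧
  (p =O[Bornology.cobounded Plane] fun x => (‖x‖ ^ 2)⁻¹)

/-- The background shear flow `(x, y) ↦ (y, x)`. -/
def shearFlow (x : Plane) : Plane := !₂[x 1, x 0]

/-- `(v, q)` is a classical solution (with `v` continuous up to the boundary) of the Stokes system
around the two disks with the no-slip condition on both boundaries and with the background
shear flow at infinity. -/
structure IsNoSlipShearSolution (μ R δ : ℝ) (v : Plane → Plane) (q : Plane → ℝ) : Prop where
  stokes : IsStokesFlow μ (fluidDomain R δ) v q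
  continuousOn_closure : ContinuousOn v (closure (fluidDomain R δ))
  noSlip : ∀ x ∈ frontier (leftDisk R δ) ∪ frontier (rightDisk R δ), v x = 0
  decay : DecayClass (fun x => v x - shearFlow x) q

end StokesTwoDisks

end

noncomputable section

namespace StokesTwoDisks

/-! ### Second differences on the integers, the maximum principle, and the weights sinh(2ns)/n. -/

section
open Filter Topology Real

/-! With a = R sinh s and R cosh s = R + δ/2, the Möbius map t = (z + a)/(z - a) carries the fluid
domain onto the annulus exp(-s) < |t| < exp(s) punctured at 1, the image of infinity. A narrow gap
means small s, so the task is to bound everything uniformly for s bounded above. In complex notation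
a planar Stokes flow U satisfies ∂U/∂z = P - conj P and ∂U/∂(conj z) = conj K - z conj P' with P, K
holomorphic; the pressure is -4μ Re P, and the strain is read off from ∂U/∂(conj z) alone.

Existence. Take P = iΦ with Φ(t) = -((t - 1)²/(2t)) Σ G_n tⁿ, G real and even. Write m_n =
sinh(2ns)/n, κ = 2 cosh 2s - 2 and w_n = m_n + sinh 2s. Once the second Goursat function is
eliminated, no slip on |t| = exp(s) is the difference equation Δ²(wG) = κ(mG + 1); the other circle
follows from the symmetry t ↦ 1/t, that is z ↦ -z. The equation is coercive for y = wG + 1, so a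
contraction and the discrete maximum principle give a solution with exponential decay
(`exists_isShearSeq`, `IsShearSeq.annulusVelocity_eq_zero`).

Uniform bounds. Since Φ = -½ Σ (Δ²G)_n tⁿ, second differences of G are what matters. The equation
makes Δ²(wG) of order s², a Landau inequality makes the first difference of order s, and the
discrete product rule gives |w_n (Δ²G)_n| ≤ C s² (`IsShearSeq.abs_wallWeight_mul_secondDiff_le`). As
w_n ≥ (s/2) exp(3s|n|/2), the terms of the series for Φ are at most C s exp(-s|n|/2) on the closed
annulus, with sum O(1). This bounds the pressure, and likewise s|Φ'| is bounded.

For the strain, the velocity vanishes on the boundary circles, so its two Wirtinger derivatives have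
equal modulus there, and the first is controlled by Φ (`norm_conjStrain_le_of_boundary`). Inside,
∂U/∂(conj z) is not holomorphic up to conjugation, because of the factor conj z; replacing that
factor by its analytic expression on the outer circle costs only O(s|Φ'|)
(`norm_conjStrain_sub_le`), and the maximum modulus principle applies to the rest.

Uniqueness. Any solution has such a P and K (`exists_goursat`). For the difference of two solutions,
decay at infinity lets P dz and K dz extend across t = 1. Fourier coefficients on circles, passed to
the limit at both boundaries, yield a homogeneous version of the recurrence coupling G_n with conj
G_{-n}. Its parts of definite parity and reality decouple into equations with weights m ± sinh 2s,
and the maximum principle kills both, the minus sign needing extra care at n = 0, ±1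
(`eq_zero_of_secondDiff_symm`). Hence P and K agree, so strain and pressure agree, and the bounds
for the constructed flow hold for every solution. -/

/-- The second difference of a sequence indexed by the integers. -/
def secondDiff {A : Type*} [Ring A] (u : ℤ → A) (n : ℤ) : A := u (n + 1) - 2 * u n + u (n - 1)

/-- The discrete maximum principle on the integers. -/
theorem nonpos_of_mul_le_secondDiff {u : ℤ → ℝ} {k : ℝ} (hk : 0 < k)
    (hb : BddAbove (Set.range u)) (h : ∀ n, 0 < u n → k * u n ≤ secondDiff u n) (n : ℤ) :
    u n ≤ 0 := by
  by_contra! hn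
  set S := sSup (Set.range u) with hS
  have hle : ∀ j, u j ≤ S := fun j => le_csSup hb ⟨j, rfl⟩
  have hSpos : 0 < S := hn.trans_le (hle n)
  -- The supremum S need not be attained. At an index where u exceeds both numbers, the second
  -- difference is at most 2(S - u) < kS/2 < ku, a contradiction.
  have hlt : max (S / 2) (S - k * S / 4) < S := by
    refine max_lt (by linarith) ?_
    have := mul_pos hk hSpos
    linarith
  obtain ⟨_, ⟨j, rfl⟩, hj⟩ := exists_lt_of_lt_csSup (Set.range_nonempty u) hlt
  have h1 := (le_max_left _ _).trans_lt hj
  have h2 := (le_max_right _ _).trans_lt hj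
  have h3 := h j (by linarith)
  have h4 := hle (j + 1)
  have h5 := hle (j - 1)
  unfold secondDiff at h3
  nlinarith

/-- Solvability of a coercive second order difference equation in the bounded sequences. -/
theorem exists_bounded_secondDiff_eq {b r : ℤ → ℝ} {β M : ℝ} (hβ : 0 < β) (hb : ∀ n, β ≤ b n)
    (hr : ∀ n, |r n| ≤ M) :
    ∃ y : ℤ → ℝ, (∃ C, ∀ n, |y n| ≤ C) ∧ ∀ n, secondDiff y n = b n * y n + r n := by
  have hpos : ∀ n, 0 < 2 + b n := fun n => by linarith [hb n]
  have hM : 0 ≤ M := (abs_nonneg _).trans (hr 0)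
  -- Solving the equation for the central value gives a Jacobi iteration, a sup-norm contraction
  -- with constant 2/(2 + β).
  let T : BoundedContinuousFunction ℤ ℝ → BoundedContinuousFunction ℤ ℝ := fun y =>
    BoundedContinuousFunction.ofNormedAddCommGroupDiscrete
      (fun n => (y (n + 1) + y (n - 1) - r n) / (2 + b n)) (‖y‖ + ‖y‖ + M) (fun n => by
        have h1 := y.norm_coe_le_norm (n + 1)
        have h2 := y.norm_coe_le_norm (n - 1)
        have h3 := hr n
        rw [Real.norm_eq_abs, abs_div, abs_of_pos (hpos n)]
        rw [Real.norm_eq_abs] at h1 h2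
        have h4 : |y (n + 1) + y (n - 1) - r n| ≤ ‖y‖ + ‖y‖ + M :=
          (abs_sub _ _).trans (add_le_add ((abs_add_le _ _).trans (add_le_add h1 h2)) h3)
        refine (div_le_self (abs_nonneg _) (by linarith [hb n])).trans h4)
  have hT : ∀ y n, T y n = (y (n + 1) + y (n - 1) - r n) / (2 + b n) := fun _ _ => rfl
  have hK : ContractingWith (2 / (2 + β)).toNNReal T := by
    refine ⟨?_, LipschitzWith.of_dist_le_mul fun y z => ?_⟩
    · rw [Real.toNNReal_lt_one, div_lt_one (by positivity)]
      linarith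
    · rw [Real.coe_toNNReal _ (by positivity),
        BoundedContinuousFunction.dist_le (by positivity)]
      intro n
      have h1 := BoundedContinuousFunction.dist_coe_le_dist (f := y) (g := z) (n + 1)
      have h2 := BoundedContinuousFunction.dist_coe_le_dist (f := y) (g := z) (n - 1)
      rw [hT, hT, Real.dist_eq, ← sub_div, abs_div, abs_of_pos (hpos n)]
      rw [Real.dist_eq] at h1 h2
      have h4 : |y (n + 1) + y (n - 1) - r n - (z (n + 1) + z (n - 1) - r n)| ≤ 2 * dist y z := by
        have : y (n + 1) + y (n - 1) - r n - (z (n + 1) + z (n - 1) - r n)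
          = (y (n + 1) - z (n + 1)) + (y (n - 1) - z (n - 1)) := by ring
        rw [this]
        exact (abs_add_le _ _).trans (by linarith)
      calc _ ≤ 2 * dist y z / (2 + b n) := by gcongr; exact (hpos n).le
        _ ≤ 2 * dist y z / (2 + β) := by gcongr; exact hb n
        _ = _ := by ring
  let y := hK.fixedPoint T
  refine ⟨y, ⟨‖y‖, fun n => y.norm_coe_le_norm n⟩, fun n => ?_⟩
  have h1 : T y n = y n := by rw [hK.fixedPoint_isFixedPt.eq]
  rw [hT, div_eq_iff (hpos n).ne'] at h1
  unfold secondDiff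
  linarith

/-- The weights `sinh (2 n s) / n`, with value `2 s` at `n = 0`. -/
def gapWeight (s : ℝ) (n : ℤ) : ℝ := 2 * ∫ x in (0 : ℝ)..s, cosh (2 * n * x)

theorem gapWeight_neg (s : ℝ) (n : ℤ) : gapWeight s (-n) = gapWeight s n := by
  simp [gapWeight]

theorem gapWeight_zero (s : ℝ) : gapWeight s 0 = 2 * s := by
  simp [gapWeight]

theorem mul_gapWeight (s : ℝ) (n : ℤ) : n * gapWeight s n = sinh (2 * n * s) := by
  rcases eq_or_ne n 0 with rfl | hn
  · simp
  have hn' : (n : ℝ) ≠ 0 := by exact_mod_cast hn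
  have h : ∫ x in (0 : ℝ)..s, cosh (2 * n * x)
      = sinh (2 * n * s) / (2 * n) - sinh (2 * n * 0) / (2 * n) := by
    refine intervalIntegral.integral_eq_sub_of_hasDerivAt (f := fun x => sinh (2 * n * x) / (2 * n))
      (fun x _ => ?_) ((by fun_prop : Continuous _).intervalIntegrable _ _)
    have h1 : HasDerivAt (fun x : ℝ => 2 * (n : ℝ) * x) (2 * n) x := by
      simpa using (hasDerivAt_id x).const_mul (2 * (n : ℝ))
    have h2 := ((hasDerivAt_sinh (2 * n * x)).comp x h1).div_const (2 * (n : ℝ))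
    rwa [mul_div_assoc, div_self (by simpa using hn'), mul_one] at h2
  rw [gapWeight, h]
  simp
  field_simp

theorem gapWeight_one (s : ℝ) : gapWeight s 1 = sinh (2 * s) := by
  simpa using mul_gapWeight s 1

theorem gapWeight_mono {s : ℝ} (hs : 0 ≤ s) {k n : ℤ} (h : |k| ≤ |n|) :
    gapWeight s k ≤ gapWeight s n := by
  unfold gapWeight
  gcongr
  refine intervalIntegral.integral_mono_on hs ((by fun_prop : Continuous _).intervalIntegrable _ _)
    ((by fun_prop : Continuous _).intervalIntegrable _ _) fun x hx => ?_
  rw [cosh_le_cosh, abs_mul, abs_mul, abs_mul, abs_mul]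
  have : |(k : ℝ)| ≤ |(n : ℝ)| := by exact_mod_cast h
  gcongr

theorem two_mul_le_gapWeight {s : ℝ} (hs : 0 ≤ s) (n : ℤ) : 2 * s ≤ gapWeight s n := by
  rw [← gapWeight_zero]
  exact gapWeight_mono hs (by simp)

theorem gapWeight_pos {s : ℝ} (hs : 0 < s) (n : ℤ) : 0 < gapWeight s n :=
  (by positivity : 0 < 2 * s).trans_le (two_mul_le_gapWeight hs.le n)

/-- At n = 2 the weight is sinh(2s) cosh(2s), and the weights increase with |n|. In the uniqueness
proof this makes the weight m_n - sinh 2s positive away from n = 0, ±1. -/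
theorem sinh_lt_gapWeight {s : ℝ} (hs : 0 < s) {n : ℤ} (hn : 2 ≤ |n|) :
    sinh (2 * s) < gapWeight s n := by
  have h1 : gapWeight s 2 ≤ gapWeight s n := gapWeight_mono hs.le (by simpa using hn)
  have h2 := mul_gapWeight s 2
  have h3 : (2 * ((2 : ℤ) : ℝ) * s) = 2 * (2 * s) := by push_cast; ring
  rw [h3, sinh_two_mul] at h2
  push_cast at h2
  have h4 : 0 < sinh (2 * s) := sinh_pos_iff.2 (by positivity)
  have h5 : 1 < cosh (2 * s) := one_lt_cosh.2 (by positivity)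
  nlinarith

/-- With x = |n|s, sinh 2x = 4 sinh(x/2) cosh(x/2) cosh x ≥ (x/2) exp(3x/2). The rate 3/2 is below
the true rate 2, which pays for the division by n uniformly in s, and above 1, so that the Laurent
series converge beyond the closed annulus. -/
theorem mul_exp_le_gapWeight {s : ℝ} (hs : 0 ≤ s) (n : ℤ) :
    s / 2 * exp (3 / 2 * s * |(n : ℝ)|) ≤ gapWeight s n := by
  have key : ∀ k : ℕ, s / 2 * exp (3 / 2 * s * k) ≤ gapWeight s k := by
    intro k
    rcases Nat.eq_zero_or_pos k with rfl | hk
    · simp only [Nat.cast_zero, mul_zero, exp_zero, mul_one]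
      have := two_mul_le_gapWeight hs 0
      linarith
    have hk' : (0 : ℝ) < k := by exact_mod_cast hk
    have h1 := mul_gapWeight s k
    set x := k * s with hx
    have hx0 : 0 ≤ x := by positivity
    have h2 : sinh (2 * ((k : ℤ) : ℝ) * s) = 4 * sinh (x / 2) * cosh (x / 2) * cosh x := by
      have : 2 * ((k : ℤ) : ℝ) * s = 2 * x := by rw [hx]; push_cast; ring
      rw [this, sinh_two_mul]
      conv_lhs => rw [show x = 2 * (x / 2) by ring, sinh_two_mul, ← show x = 2 * (x / 2) by ring]
      ring
    have h3 : x / 2 ≤ sinh (x / 2) := self_le_sinh_iff.2 (by positivity)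
    have h4 : exp (x / 2) / 2 ≤ cosh (x / 2) := by
      rw [cosh_eq]; linarith [exp_pos (-(x / 2))]
    have h5 : exp x / 2 ≤ cosh x := by
      rw [cosh_eq]; linarith [exp_pos (-x)]
    have h6 : exp (3 / 2 * s * k) = exp (x / 2) * exp x := by
      rw [← exp_add]; congr 1; rw [hx]; ring
    have h7 : 4 * (x / 2) * (exp (x / 2) / 2) * (exp x / 2) ≤
        4 * sinh (x / 2) * cosh (x / 2) * cosh x := by
      have := exp_pos (x / 2)
      have := exp_pos x
      gcongr
    rw [h2] at h1
    rw [h6]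
    push_cast at h1
    refine le_of_mul_le_mul_left ?_ hk'
    rw [h1]
    refine le_trans (le_of_eq ?_) h7
    rw [hx]; ring
  rcases le_total 0 n with h | h
  · lift n to ℕ using h
    simpa using key n
  · obtain ⟨k, rfl⟩ : ∃ k : ℤ, n = -k := ⟨-n, by simp⟩
    have hk : 0 ≤ k := by linarith
    lift k to ℕ using hk
    rw [gapWeight_neg]
    simpa using key k

/-- The constant `2 cosh (2 s) - 2` of the difference equations. -/
def gapConst (s : ℝ) : ℝ := 2 * cosh (2 * s) - 2

theorem gapConst_pos {s : ℝ} (hs : 0 < s) : 0 < gapConst s := by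
  have : 1 < cosh (2 * s) := one_lt_cosh.2 (by positivity)
  unfold gapConst; linarith

/-- Under the integral, the second difference of cosh(2nx) in n is (2 cosh 2x - 2) cosh(2nx), and
the factor is at most `gapConst s` on [0, s]. -/
theorem secondDiff_gapWeight {s : ℝ} (hs : 0 ≤ s) (n : ℤ) :
    |secondDiff (gapWeight s) n| ≤ gapConst s * gapWeight s n := by
  have hi : ∀ k : ℤ, IntervalIntegrable (fun x : ℝ => cosh (2 * k * x)) MeasureTheory.volume 0 s :=
    fun k => (by fun_prop : Continuous _).intervalIntegrable _ _
  have h1 : secondDiff (gapWeight s) n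
      = 2 * ∫ x in (0 : ℝ)..s, (2 * cosh (2 * x) - 2) * cosh (2 * n * x) := by
    unfold secondDiff gapWeight
    have : ∀ x : ℝ, (2 * cosh (2 * x) - 2) * cosh (2 * n * x) =
        cosh (2 * ((n + 1 : ℤ) : ℝ) * x) - 2 * cosh (2 * n * x) +
          cosh (2 * ((n - 1 : ℤ) : ℝ) * x) := by
      intro x
      have e1 : 2 * ((n + 1 : ℤ) : ℝ) * x = 2 * n * x + 2 * x := by push_cast; ring
      have e2 : 2 * ((n - 1 : ℤ) : ℝ) * x = 2 * n * x - 2 * x := by push_cast; ring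
      rw [e1, e2, cosh_add, cosh_sub]; ring
    simp_rw [this]
    rw [intervalIntegral.integral_add ((hi _).sub ((hi _).const_mul 2)) (hi _),
      intervalIntegral.integral_sub (hi _) ((hi _).const_mul 2),
      intervalIntegral.integral_const_mul]
    ring
  have h2 : ∀ x ∈ Set.Icc 0 s, 0 ≤ (2 * cosh (2 * x) - 2) * cosh (2 * n * x) := fun x _ =>
    mul_nonneg (by linarith [one_le_cosh (2 * x)]) (cosh_pos _).le
  rw [h1, abs_of_nonneg (mul_nonneg zero_le_two (intervalIntegral.integral_nonneg hs h2)),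
    gapWeight, mul_left_comm, ← intervalIntegral.integral_const_mul (gapConst s)]
  refine mul_le_mul_of_nonneg_left ?_ zero_le_two
  refine intervalIntegral.integral_mono_on hs ((by fun_prop : Continuous _).intervalIntegrable _ _)
    ((by fun_prop : Continuous _).intervalIntegrable _ _) fun x hx => ?_
  have : cosh (2 * x) ≤ cosh (2 * s) := by
    rw [cosh_le_cosh, abs_of_nonneg (by linarith [hx.1]), abs_of_nonneg (by linarith)]
    linarith [hx.2]
  unfold gapConst
  gcongr

/-- The addition formula and |sinh| ≤ cosh give the pointwise bound (exp(2x) - 1) cosh(2nx) for the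
integrands: the weights vary by a relative amount O(s) per step. -/
theorem abs_gapWeight_add_one_sub {s : ℝ} (hs : 0 ≤ s) (n : ℤ) :
    |gapWeight s (n + 1) - gapWeight s n| ≤ (exp (2 * s) - 1) * gapWeight s n := by
  have hi : ∀ k : ℤ, IntervalIntegrable (fun x : ℝ => cosh (2 * k * x)) MeasureTheory.volume 0 s :=
    fun k => (by fun_prop : Continuous _).intervalIntegrable _ _
  rw [gapWeight, gapWeight, ← mul_sub, ← intervalIntegral.integral_sub (hi _) (hi _), abs_mul,
    abs_two, mul_left_comm, ← intervalIntegral.integral_const_mul (exp (2 * s) - 1)]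
  refine mul_le_mul_of_nonneg_left ?_ zero_le_two
  refine (intervalIntegral.abs_integral_le_integral_abs hs).trans ?_
  refine intervalIntegral.integral_mono_on hs ((by fun_prop : Continuous _).intervalIntegrable _ _)
    ((by fun_prop : Continuous _).intervalIntegrable _ _) fun x hx => ?_
  have e1 : 2 * ((n + 1 : ℤ) : ℝ) * x = 2 * n * x + 2 * x := by push_cast; ring
  have h0 : 0 ≤ sinh (2 * x) := sinh_nonneg_iff.2 (by linarith [hx.1])
  have h1 : |sinh (2 * n * x)| ≤ cosh (2 * n * x) :=
    abs_le.2 ⟨by linarith [cosh_add_sinh (2 * n * x), exp_pos (2 * n * x)],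
      (sinh_lt_cosh _).le⟩
  have h2 : exp (2 * x) ≤ exp (2 * s) := exp_le_exp.2 (by linarith [hx.2])
  have h3 := one_le_cosh (2 * x)
  have h4 := cosh_pos (2 * n * x)
  rw [e1, cosh_add, show cosh (2 * n * x) * cosh (2 * x) + sinh (2 * n * x) * sinh (2 * x)
    - cosh (2 * n * x) = (cosh (2 * x) - 1) * cosh (2 * n * x)
      + sinh (2 * x) * sinh (2 * n * x) by ring]
  calc _ ≤ |(cosh (2 * x) - 1) * cosh (2 * n * x)| + |sinh (2 * x) * sinh (2 * n * x)| :=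
        abs_add_le _ _
    _ = (cosh (2 * x) - 1) * cosh (2 * n * x) + sinh (2 * x) * |sinh (2 * n * x)| := by
        rw [abs_mul, abs_mul, abs_of_nonneg (by linarith : 0 ≤ cosh (2 * x) - 1),
          abs_of_pos h4, abs_of_nonneg h0]
    _ ≤ (cosh (2 * x) - 1) * cosh (2 * n * x) + sinh (2 * x) * cosh (2 * n * x) := by gcongr
    _ = (exp (2 * x) - 1) * cosh (2 * n * x) := by rw [← cosh_add_sinh]; ring
    _ ≤ _ := by gcongr

end

/-! ### The difference equation of the shear problem: existence, decay and the key estimate. -/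

section
open Filter Topology Real

/-- The weights `sinh (2 n s) / n + sinh (2 s)`. -/
def wallWeight (s : ℝ) (n : ℤ) : ℝ := gapWeight s n + sinh (2 * s)

/-- The real even sequences that are the Laurent coefficients of the Goursat function of the
shear problem. -/
structure IsShearSeq (s : ℝ) (G : ℤ → ℝ) : Prop where
  even : ∀ n, G (-n) = G n
  -- What remains of the no-slip condition once the second Goursat function is eliminated.
  eqn : ∀ n, secondDiff (fun k => wallWeight s k * G k) n = gapConst s * (gapWeight s n * G n + 1)
  bound : ∀ n, |wallWeight s n * G n| ≤ 1 + sinh (2 * s) / (2 * s)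
  decay : ∃ C, ∀ n : ℤ, |gapWeight s n * G n + 1| ≤ C * exp (-(3 / 2 * s * |(n : ℝ)|))

/-- Equality holds away from 0, where the sequence is a pure exponential; at 0 the concave kink only
lowers the second difference. So exp(-l|n|) is a barrier for the maximum principle. -/
theorem secondDiff_exp_neg_le {l : ℝ} (hl : 0 ≤ l) (n : ℤ) :
    secondDiff (fun k : ℤ => exp (-(l * |(k : ℝ)|))) n ≤
      (2 * cosh l - 2) * exp (-(l * |(n : ℝ)|)) := by
  have key : exp (-(l * |((n + 1 : ℤ) : ℝ)|)) + exp (-(l * |((n - 1 : ℤ) : ℝ)|)) ≤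
      2 * cosh l * exp (-(l * |(n : ℝ)|)) := by
    have e : 2 * cosh l * exp (-(l * |(n : ℝ)|))
        = exp (-(l * (|(n : ℝ)| + 1))) + exp (-(l * (|(n : ℝ)| - 1))) := by
      rw [cosh_eq, show -(l * (|(n : ℝ)| + 1)) = -l + -(l * |(n : ℝ)|) by ring,
        show -(l * (|(n : ℝ)| - 1)) = l + -(l * |(n : ℝ)|) by ring, exp_add, exp_add]
      ring
    rw [e]
    push_cast
    rcases lt_trichotomy n 0 with h | h | h
    · have h' : (n : ℝ) ≤ -1 := by exact_mod_cast Int.le_sub_one_of_lt h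
      rw [abs_of_nonpos (by linarith : (n : ℝ) + 1 ≤ 0), abs_of_nonpos (by linarith : (n : ℝ) ≤ 0),
        abs_of_nonpos (by linarith : (n : ℝ) - 1 ≤ 0), add_comm]
      refine le_of_eq ?_
      congr 3 <;> ring
    · subst h
      have h1 : exp (-(l * 1)) ≤ exp (-(l * (-1))) := exp_le_exp.2 (by linarith)
      simpa using h1
    · have h' : (1 : ℝ) ≤ n := by exact_mod_cast h
      rw [abs_of_nonneg (by linarith : 0 ≤ (n : ℝ) + 1), abs_of_nonneg (by linarith : 0 ≤ (n : ℝ)),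
        abs_of_nonneg (by linarith : 0 ≤ (n : ℝ) - 1)]
  unfold secondDiff
  linarith

/-- Exponential decay of the bounded solutions of a coercive difference equation with
exponentially decaying right hand side. -/
theorem abs_le_exp_of_secondDiff {y : ℤ → ℝ} {k l K C : ℝ} (hl : 0 ≤ l) (hlk : 2 * cosh l - 2 < k)
    (hy : ∀ n, |y n| ≤ C)
    (h : ∀ n : ℤ, |secondDiff y n - k * y n| ≤ K * exp (-(l * |(n : ℝ)|))) (n : ℤ) :
    |y n| ≤ K / (k - (2 * cosh l - 2)) * exp (-(l * |(n : ℝ)|)) := by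
  have hd : 0 < k - (2 * cosh l - 2) := by linarith
  have hk : 0 < k := by linarith [one_le_cosh l]
  have hK : 0 ≤ K := by
    by_contra! hK
    have h1 := (abs_nonneg _).trans (h 0)
    have := exp_pos (-(l * |((0 : ℤ) : ℝ)|))
    nlinarith
  set D := K / (k - (2 * cosh l - 2)) with hD
  have hD0 : 0 ≤ D := by positivity
  have hKD : K = D * (k - (2 * cosh l - 2)) := by
    rw [hD, div_mul_cancel₀ _ hd.ne']
  have main : ∀ z : ℤ → ℝ, (∀ n, |z n| ≤ C) →
      (∀ n : ℤ, |secondDiff z n - k * z n| ≤ K * exp (-(l * |(n : ℝ)|))) →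
      ∀ n : ℤ, z n ≤ D * exp (-(l * |(n : ℝ)|)) := by
    intro z hz h n
    have := nonpos_of_mul_le_secondDiff (u := fun n : ℤ => z n - D * exp (-(l * |(n : ℝ)|))) hk
      ⟨C, by
        rintro _ ⟨j, rfl⟩
        have h1 := (abs_le.1 (hz j)).2
        have h2 : 0 ≤ D * exp (-(l * |(j : ℝ)|)) := by positivity
        simp only
        linarith⟩ (fun j _ => by
        have h1 := (abs_le.1 (h j)).1
        have h2 := mul_le_mul_of_nonneg_left (secondDiff_exp_neg_le hl j) hD0
        have h3 : secondDiff (fun n : ℤ => z n - D * exp (-(l * |(n : ℝ)|))) j = secondDiff z j -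
            D * secondDiff (fun k : ℤ => exp (-(l * |(k : ℝ)|))) j := by
          unfold secondDiff; ring
        rw [h3]
        rw [hKD] at h1
        linarith) n
    linarith
  refine abs_le.2 ⟨?_, main y hy h n⟩
  have := main (fun n => -y n) (fun n => by simpa using hy n) (fun n => by
    have e : secondDiff (fun n => -y n) n - k * -y n = -(secondDiff y n - k * y n) := by
      unfold secondDiff; ring
    rw [e, abs_neg]
    exact h n) n
  linarith

theorem wallWeight_neg (s : ℝ) (n : ℤ) : wallWeight s (-n) = wallWeight s n := by
  simp [wallWeight, gapWeight_neg]

theorem wallWeight_pos {s : ℝ} (hs : 0 < s) (n : ℤ) : 0 < wallWeight s n :=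
  add_pos (gapWeight_pos hs n) (sinh_pos_iff.2 (by positivity))

theorem gapWeight_le_wallWeight {s : ℝ} (hs : 0 < s) (n : ℤ) : gapWeight s n ≤ wallWeight s n :=
  le_add_of_nonneg_right (sinh_nonneg_iff.2 (by positivity))

/-- Put y = wG + 1. The equation becomes Δ²y = κ(m y + sinh 2s)/w, coercive because m_n ≥ 2s. The
constants 0 and -sinh(2s)/(2s) bracket y by the maximum principle, and the same principle applied to
y(-n) - y(n) gives evenness. -/
theorem exists_isShearSeq {s : ℝ} (hs : 0 < s) : ∃ G, IsShearSeq s G := by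
  have hS : 0 < sinh (2 * s) := sinh_pos_iff.2 (by positivity)
  have hκ := gapConst_pos hs
  have hm := gapWeight_pos hs
  have hq := wallWeight_pos hs
  have hqm : ∀ n, wallWeight s n = gapWeight s n + sinh (2 * s) := fun _ => rfl
  have h2s := two_mul_le_gapWeight hs.le
  have hβ : ∀ n, gapConst s * (2 * s / (2 * s + sinh (2 * s))) ≤
      gapConst s * (gapWeight s n / wallWeight s n) := by
    intro n
    refine mul_le_mul_of_nonneg_left ?_ hκ.le
    rw [div_le_div_iff₀ (by positivity) (hq n), hqm]
    nlinarith [h2s n]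
  have hβ0 : 0 < gapConst s * (2 * s / (2 * s + sinh (2 * s))) := by positivity
  obtain ⟨y, ⟨C, hC⟩, hy⟩ := exists_bounded_secondDiff_eq
    (b := fun n => gapConst s * (gapWeight s n / wallWeight s n))
    (r := fun n => gapConst s * (sinh (2 * s) / wallWeight s n)) (M := gapConst s) hβ0 hβ
    (fun n => by
      have h1 : 0 ≤ gapConst s * (sinh (2 * s) / wallWeight s n) :=
        mul_nonneg hκ.le (div_nonneg hS.le (hq n).le)
      rw [abs_of_nonneg h1]
      refine mul_le_of_le_one_right hκ.le ?_
      rw [div_le_one (hq n), hqm]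
      linarith [hm n])
  set B := sinh (2 * s) / (2 * s) with hB
  have hB0 : 0 < B := by positivity
  have hneg : ∀ n, y n ≤ 0 := by
    refine nonpos_of_mul_le_secondDiff hβ0 ⟨C, ?_⟩ fun n hn => ?_
    · rintro _ ⟨j, rfl⟩
      exact (le_abs_self _).trans (hC j)
    · rw [hy]
      have h1 : 0 ≤ gapConst s * (sinh (2 * s) / wallWeight s n) :=
        mul_nonneg hκ.le (div_nonneg hS.le (hq n).le)
      have h2 := mul_le_mul_of_nonneg_right (hβ n) hn.le
      linarith
  have hlow : ∀ n, -B ≤ y n := by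
    intro n
    have := nonpos_of_mul_le_secondDiff (u := fun n => -y n - B) hβ0 ⟨C, by
        rintro _ ⟨j, rfl⟩
        have := neg_le_abs (y j)
        have := hC j
        simp only
        linarith⟩ (fun n hn => by
      have e : secondDiff (fun n => -y n - B) n = -secondDiff y n := by
        unfold secondDiff; ring
      rw [e, hy]
      have h1 : gapConst s * (sinh (2 * s) / wallWeight s n) ≤
          gapConst s * (gapWeight s n / wallWeight s n) * B := by
        rw [mul_assoc]
        refine mul_le_mul_of_nonneg_left ?_ hκ.le
        rw [div_mul_eq_mul_div]
        refine div_le_div_of_nonneg_right ?_ (hq n).le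
        rw [hB, mul_div_assoc', le_div_iff₀ (by positivity)]
        nlinarith [h2s n]
      have h2 := mul_le_mul_of_nonneg_right (hβ n) hn.le
      linarith) n
    linarith
  have heven : ∀ n, y (-n) = y n := by
    have aux : ∀ n, y (-n) - y n ≤ 0 := by
      refine nonpos_of_mul_le_secondDiff hβ0 ⟨C + C, ?_⟩ fun n hn => ?_
      · rintro _ ⟨j, rfl⟩
        have h1 := (le_abs_self _).trans (hC (-j))
        have h2 := (neg_le_abs _).trans (hC j)
        simp only
        linarith
      · have h1 := hy n
        have h2 := hy (-n)
        simp only [gapWeight_neg, wallWeight_neg] at h2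
        have e : secondDiff (fun n => y (-n) - y n) n = secondDiff y (-n) - secondDiff y n := by
          simp only [secondDiff]
          rw [show -(n + 1) = -n - 1 by ring, show -(n - 1) = -n + 1 by ring]
          ring
        rw [e, h1, h2]
        have h3 := mul_le_mul_of_nonneg_right (hβ n) hn.le
        linarith
    intro n
    have h1 := aux n
    have h2 := aux (-n)
    rw [neg_neg] at h2
    linarith
  have hqG : ∀ n, wallWeight s n * ((y n - 1) / wallWeight s n) = y n - 1 := fun n =>
    mul_div_cancel₀ _ (hq n).ne'
  have hmG : ∀ n, gapWeight s n * ((y n - 1) / wallWeight s n) + 1 =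
      gapWeight s n / wallWeight s n * y n + sinh (2 * s) / wallWeight s n := by
    intro n
    have := (hq n).ne'
    field_simp
    rw [hqm]; ring
  have hSq : ∀ n : ℤ, sinh (2 * s) / wallWeight s n ≤
      sinh (2 * s) * (2 / s) * exp (-(3 / 2 * s * |(n : ℝ)|)) := by
    intro n
    rw [div_le_iff₀ (hq n)]
    have h1 := (mul_exp_le_gapWeight hs.le n).trans (gapWeight_le_wallWeight hs n)
    have h2 : 0 ≤ sinh (2 * s) * (2 / s) * exp (-(3 / 2 * s * |(n : ℝ)|)) := by positivity
    have h3 := mul_le_mul_of_nonneg_left h1 h2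
    refine le_trans (le_of_eq ?_) h3
    rw [exp_neg]
    have := (exp_pos (3 / 2 * s * |(n : ℝ)|)).ne'
    field_simp
  have hyB : ∀ n, |y n| ≤ B := fun n => abs_le.2 ⟨hlow n, (hneg n).trans hB0.le⟩
  -- Here Δ²y - κy = κ (sinh 2s / w)(1 - y), whose right side decays at rate 3s/2; this rate is
  -- admissible because 2 cosh(3s/2) - 2 < κ.
  have hdec := abs_le_exp_of_secondDiff (y := y) (k := gapConst s) (l := 3 / 2 * s)
    (K := gapConst s * (1 + B) * (sinh (2 * s) * (2 / s))) (C := B) (by positivity)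
    (by
      have : cosh (3 / 2 * s) < cosh (2 * s) := by
        rw [cosh_lt_cosh, abs_of_pos (by positivity), abs_of_pos (by positivity)]
        linarith
      unfold gapConst
      linarith) hyB
    (fun n => by
      have h1 : secondDiff y n - gapConst s * y n =
          gapConst s * (sinh (2 * s) / wallWeight s n) * (1 - y n) := by
        rw [hy]
        have := (hq n).ne'
        field_simp
        rw [hqm]
        ring
      rw [h1, abs_mul, abs_of_nonneg (mul_nonneg hκ.le (div_nonneg hS.le (hq n).le)),
        abs_of_nonneg (by linarith [hneg n])]
      have h2 := hSq n
      have h3 : 1 - y n ≤ 1 + B := by linarith [hlow n]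
      calc _ ≤ gapConst s * (sinh (2 * s) * (2 / s) * exp (-(3 / 2 * s * |(n : ℝ)|))) * (1 + B) := by
            gcongr
            linarith [hneg n]
        _ = _ := by ring)
  refine ⟨fun n => (y n - 1) / wallWeight s n, ⟨fun n => ?_, fun n => ?_, fun n => ?_, ?_⟩⟩
  · rw [heven, wallWeight_neg]
  · simp only [hqG]
    rw [hmG]
    have : secondDiff (fun k => y k - 1) n = secondDiff y n := by unfold secondDiff; ring
    rw [this, hy]
    ring
  · rw [hqG, abs_le]
    constructor <;> linarith [hlow n, hneg n]
  · refine ⟨gapConst s * (1 + B) * (sinh (2 * s) * (2 / s)) /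
      (gapConst s - (2 * cosh (3 / 2 * s) - 2)) + sinh (2 * s) * (2 / s), fun n => ?_⟩
    rw [hmG]
    refine (abs_add_le _ _).trans ?_
    rw [add_mul]
    refine add_le_add ?_ ?_
    · rw [abs_mul, abs_of_nonneg (div_nonneg (hm n).le (hq n).le)]
      refine (mul_le_of_le_one_left (abs_nonneg _) ?_).trans (hdec n)
      rw [div_le_one (hq n)]
      exact gapWeight_le_wallWeight hs n
    · rw [abs_of_nonneg (div_nonneg hS.le (hq n).le)]
      exact hSq n

/-- A discrete Landau inequality. -/
theorem abs_sub_le_of_secondDiff {y : ℤ → ℝ} {A B : ℝ} (hA : ∀ n, |y n| ≤ A)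
    (hB : ∀ n, |secondDiff y n| ≤ B) {L : ℕ} (hL : 0 < L) (n : ℤ) :
    |y (n + 1) - y n| ≤ 2 * A / L + L * B := by
  have hL' : (0 : ℝ) < L := by exact_mod_cast hL
  have hB0 : 0 ≤ B := (abs_nonneg _).trans (hB 0)
  have h1 : ∀ j : ℕ, |(y (n + j + 1) - y (n + j)) - (y (n + 1) - y n)| ≤ j * B := by
    intro j
    induction j with
    | zero => simp
    | succ j ih =>
      have h2 := hB (n + j + 1)
      unfold secondDiff at h2
      rw [show n + (j : ℤ) + 1 - 1 = n + j by ring] at h2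
      push_cast
      rw [show n + ((j : ℤ) + 1) = n + j + 1 by ring]
      have h3 := abs_add_le (y (n + j + 1 + 1) - 2 * y (n + j + 1) + y (n + j))
        ((y (n + j + 1) - y (n + j)) - (y (n + 1) - y n))
      rw [show y (n + j + 1 + 1) - y (n + j + 1) - (y (n + 1) - y n) =
        (y (n + j + 1 + 1) - 2 * y (n + j + 1) + y (n + j)) +
        ((y (n + j + 1) - y (n + j)) - (y (n + 1) - y n)) by ring]
      linarith
  -- Over L steps the first difference drifts by at most LB, so y(n + L) - y(n) is L times it up to
  -- an error L·LB, while its size is at most 2A.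
  have h2 : ∀ j : ℕ, j ≤ L → |(y (n + j) - y n) - j * (y (n + 1) - y n)| ≤ j * (L * B) := by
    intro j
    induction j with
    | zero => simp
    | succ j ih =>
      intro hj
      have h3 := ih (by omega)
      have h4 : (j : ℝ) * B ≤ L * B := by
        have : (j : ℝ) ≤ L := by exact_mod_cast (by omega : j ≤ L)
        gcongr
      have h5 := h1 j
      push_cast
      rw [show n + ((j : ℤ) + 1) = n + j + 1 by ring]
      have h6 := abs_add_le ((y (n + j) - y n) - j * (y (n + 1) - y n))
        ((y (n + j + 1) - y (n + j)) - (y (n + 1) - y n))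
      rw [show y (n + j + 1) - y n - ((j : ℝ) + 1) * (y (n + 1) - y n) =
        ((y (n + j) - y n) - j * (y (n + 1) - y n)) +
        ((y (n + j + 1) - y (n + j)) - (y (n + 1) - y n)) by ring]
      linarith
  have h3 := h2 L le_rfl
  have h4 := abs_sub (y (n + L)) (y n)
  have h5 : L * |y (n + 1) - y n| ≤ 2 * A + L * (L * B) := by
    have h6 := abs_sub (y (n + L) - y n) ((y (n + L) - y n) - L * (y (n + 1) - y n))
    rw [sub_sub_cancel, abs_mul, abs_of_pos hL'] at h6
    linarith [hA (n + L), hA n]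
  rw [← mul_le_mul_iff_right₀ hL']
  refine h5.trans (le_of_eq ?_)
  field_simp

theorem gapConst_le {s : ℝ} (hs : 0 ≤ s) : gapConst s ≤ 4 * s ^ 2 * exp (2 * s) := by
  have h1 : gapConst s = 4 * sinh s ^ 2 := by
    unfold gapConst; rw [cosh_two_mul, cosh_sq]; ring
  have h2 : sinh s ≤ s * exp s := by
    have h3 := one_sub_le_exp_neg (2 * s)
    have h4 : exp (-s) = exp s * exp (-(2 * s)) := by rw [← exp_add]; congr 1; ring
    rw [sinh_eq, h4]
    nlinarith [exp_pos s]
  have h5 : 0 ≤ sinh s := sinh_nonneg_iff.2 hs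
  have h6 : exp (2 * s) = exp s ^ 2 := by rw [← exp_nat_mul]; norm_num
  rw [h1, h6]
  nlinarith [mul_self_le_mul_self h5 h2]

theorem sinh_div_le_exp {x : ℝ} (hx : 0 < x) : sinh x / x ≤ exp x := by
  rw [div_le_iff₀ hx, sinh_eq]
  have h3 := one_sub_le_exp_neg (2 * x)
  have h4 : exp (-x) = exp x * exp (-(2 * x)) := by rw [← exp_add]; congr 1; ring
  rw [h4]
  nlinarith [exp_pos x]

theorem exp_sub_one_le {x : ℝ} : exp x - 1 ≤ x * exp x := by
  have h3 := one_sub_le_exp_neg x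
  have h4 : exp x * exp (-x) = 1 := by rw [← exp_add]; simp
  nlinarith [exp_pos x]

/-- The decisive estimate: the second differences of the coefficients are of order `s ^ 2` relative
to the natural size of the coefficients, uniformly in `s`. -/
theorem IsShearSeq.abs_wallWeight_mul_secondDiff_le {s : ℝ} {G : ℤ → ℝ} (hG : IsShearSeq s G)
    (hs : 0 < s) (n : ℤ) :
    |wallWeight s n * secondDiff G n| ≤ 148 * exp (2 * s) ^ 4 * s ^ 2 := by
  set E := exp (2 * s) with hE
  have hE1 : 1 ≤ E := one_le_exp (by positivity)
  have hsE : s ≤ E := by linarith [add_one_le_exp (2 * s)]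
  have hm := gapWeight_pos hs
  have hq := wallWeight_pos hs
  have hY : ∀ n, |wallWeight s n * G n| ≤ 2 * E := fun n => by
    have := sinh_div_le_exp (by positivity : 0 < 2 * s)
    exact (hG.bound n).trans (by linarith)
  have hmG : ∀ n, gapWeight s n * |G n| ≤ 2 * E := fun n => by
    have := hY n
    rw [abs_mul, abs_of_pos (hq n)] at this
    exact (mul_le_mul_of_nonneg_right (gapWeight_le_wallWeight hs n) (abs_nonneg _)).trans this
  have hκ := gapConst_le hs.le
  have hκ0 := gapConst_pos hs
  have hE2 : E ≤ E ^ 2 := by nlinarith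
  -- Immediate from the equation: κ ≤ 4s²E, and mG + 1 is bounded.
  have hd2Y : ∀ n, |secondDiff (fun k => wallWeight s k * G k) n| ≤ 12 * s ^ 2 * E ^ 2 := by
    intro n
    rw [hG.eqn, abs_mul, abs_of_pos hκ0]
    have h1 : |gapWeight s n * G n + 1| ≤ 3 * E := by
      refine (abs_add_le _ _).trans ?_
      rw [abs_mul, abs_of_pos (hm n), abs_one]
      linarith [hmG n]
    calc _ ≤ (4 * s ^ 2 * E) * (3 * E) := by gcongr
      _ = _ := by ring
  -- The choice L ≈ 1/s balances the two terms of the Landau inequality: size O(1) and second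
  -- difference O(s²) give first difference O(s).
  have hdY : ∀ n, |wallWeight s (n + 1) * G (n + 1) - wallWeight s n * G n| ≤ 28 * E ^ 3 * s := by
    intro n
    have hL : 0 < ⌈1 / s⌉₊ := Nat.ceil_pos.2 (by positivity)
    have h1 := abs_sub_le_of_secondDiff hY hd2Y hL n
    have h2 : 1 / s ≤ (⌈1 / s⌉₊ : ℝ) := Nat.le_ceil _
    have h3 : (⌈1 / s⌉₊ : ℝ) < 1 / s + 1 := Nat.ceil_lt_add_one (by positivity)
    have h4 : 2 * (2 * E) / (⌈1 / s⌉₊ : ℝ) ≤ 2 * (2 * E) * s := by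
      rw [div_le_iff₀ (by exact_mod_cast hL)]
      have : 1 ≤ s * (⌈1 / s⌉₊ : ℝ) := by
        rw [div_le_iff₀ hs] at h2; linarith
      nlinarith
    have h5 : (⌈1 / s⌉₊ : ℝ) * (12 * s ^ 2 * E ^ 2) ≤ (1 / s + 1) * (12 * s ^ 2 * E ^ 2) := by
      gcongr
    have h6 : (1 / s + 1) * (12 * s ^ 2 * E ^ 2) = 12 * s * E ^ 2 * (1 + s) := by
      field_simp
    refine h1.trans ((add_le_add h4 (h5.trans h6.le)).trans ?_)
    have e3 : E ^ 2 ≤ E ^ 3 := by nlinarith [mul_nonneg (sq_nonneg E) (by linarith : 0 ≤ E - 1)]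
    have e4 : E ^ 2 * s ≤ E ^ 3 := by
      rw [pow_succ E 2]; gcongr
    have : 2 * (2 * E) * s + 12 * s * E ^ 2 * (1 + s)
      = s * (4 * E + 12 * E ^ 2 + 12 * (E ^ 2 * s)) := by ring
    rw [this]
    nlinarith
  have hdq : ∀ n, |gapWeight s (n + 1) - gapWeight s n| ≤ 2 * s * E * gapWeight s n := by
    intro n
    refine (abs_gapWeight_add_one_sub hs.le n).trans ?_
    have := exp_sub_one_le (x := 2 * s)
    exact mul_le_mul_of_nonneg_right this (hm n).le
  have hqq : ∀ n, wallWeight s (n + 1) - wallWeight s n = gapWeight s (n + 1) - gapWeight s n :=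
    fun n => by unfold wallWeight; ring
  -- Strip the weight from the product: its own variation is O(s) relative to itself and multiplies
  -- the bounded quantity mG.
  have hdG : ∀ n, |wallWeight s n * (G (n + 1) - G n)| ≤ 32 * E ^ 3 * s := by
    intro n
    have h1 : |gapWeight s (n + 1) - gapWeight s n| ≤ 2 * s * E * gapWeight s (n + 1) := by
      have := hdq (-(n + 1))
      rw [show -(n + 1) + 1 = -n by ring, gapWeight_neg, gapWeight_neg, abs_sub_comm] at this
      exact this
    have h2 : wallWeight s n * (G (n + 1) - G n) =
        (wallWeight s (n + 1) * G (n + 1) - wallWeight s n * G n) -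
          (gapWeight s (n + 1) - gapWeight s n) * G (n + 1) := by
      rw [← hqq]; ring
    rw [h2]
    refine (abs_sub _ _).trans ?_
    have h3 : |(gapWeight s (n + 1) - gapWeight s n) * G (n + 1)| ≤ 4 * s * E ^ 2 := by
      rw [abs_mul]
      calc _ ≤ 2 * s * E * gapWeight s (n + 1) * |G (n + 1)| := by gcongr
        _ = 2 * s * E * (gapWeight s (n + 1) * |G (n + 1)|) := by ring
        _ ≤ 2 * s * E * (2 * E) := mul_le_mul_of_nonneg_left (hmG _) (by positivity)
        _ = _ := by ring
    have e3 : E ^ 2 ≤ E ^ 3 := by nlinarith [mul_nonneg (sq_nonneg E) (by linarith : 0 ≤ E - 1)]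
    have e5 : s * E ^ 2 ≤ s * E ^ 3 := by gcongr
    linarith [hdY n]
  have hdG' : ∀ n, |wallWeight s n * (G (n - 1) - G n)| ≤ 32 * E ^ 3 * s := by
    intro n
    have := hdG (-n)
    rwa [wallWeight_neg, show -n + 1 = -(n - 1) by ring, hG.even, hG.even] at this
  have hmq : ∀ n x, |gapWeight s n * x| ≤ |wallWeight s n * x| := fun n x => by
    rw [abs_mul, abs_mul, abs_of_pos (hm n), abs_of_pos (hq n)]
    exact mul_le_mul_of_nonneg_right (gapWeight_le_wallWeight hs n) (abs_nonneg _)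
  -- The discrete product rule; the last bracket is identically zero. The four surviving terms are
  -- O(s²), with constants 12 + 8 + 64 + 64 = 148.
  have key : wallWeight s n * secondDiff G n = secondDiff (fun k => wallWeight s k * G k) n
      - secondDiff (gapWeight s) n * G n
      - (gapWeight s (n + 1) - gapWeight s n) * (G (n + 1) - G n)
      - (gapWeight s (n - 1) - gapWeight s n) * (G (n - 1) - G n)
      - (gapWeight s (n + 1) - gapWeight s n + (gapWeight s (n - 1) - gapWeight s n)
        - secondDiff (gapWeight s) n) * G n := by
    unfold secondDiff wallWeight; ring
  have key0 : gapWeight s (n + 1) - gapWeight s n + (gapWeight s (n - 1) - gapWeight s n)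
        - secondDiff (gapWeight s) n = 0 := by
    unfold secondDiff; ring
  rw [key, key0, zero_mul, sub_zero]
  have t2 : |secondDiff (gapWeight s) n * G n| ≤ 8 * s ^ 2 * E ^ 2 := by
    rw [abs_mul]
    calc _ ≤ gapConst s * gapWeight s n * |G n| := by
          gcongr; exact secondDiff_gapWeight hs.le n
      _ = gapConst s * (gapWeight s n * |G n|) := by ring
      _ ≤ 4 * s ^ 2 * E * (2 * E) := by
          have := hmG n
          have := mul_nonneg (hm n).le (abs_nonneg (G n))
          gcongr
      _ = _ := by ring
  have t3 : |(gapWeight s (n + 1) - gapWeight s n) * (G (n + 1) - G n)| ≤ 64 * E ^ 4 * s ^ 2 := by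
    rw [abs_mul]
    calc _ ≤ 2 * s * E * gapWeight s n * |G (n + 1) - G n| := by gcongr; exact hdq n
      _ = 2 * s * E * |gapWeight s n * (G (n + 1) - G n)| := by
          rw [abs_mul, abs_of_pos (hm n)]; ring
      _ ≤ 2 * s * E * (32 * E ^ 3 * s) := by gcongr; exact (hmq _ _).trans (hdG n)
      _ = _ := by ring
  have t4 : |(gapWeight s (n - 1) - gapWeight s n) * (G (n - 1) - G n)| ≤ 64 * E ^ 4 * s ^ 2 := by
    have hd := hdq (-n)
    rw [gapWeight_neg, show -n + 1 = -(n - 1) by ring, gapWeight_neg] at hd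
    rw [abs_mul]
    calc _ ≤ 2 * s * E * gapWeight s n * |G (n - 1) - G n| := by gcongr
      _ = 2 * s * E * |gapWeight s n * (G (n - 1) - G n)| := by
          rw [abs_mul, abs_of_pos (hm n)]; ring
      _ ≤ 2 * s * E * (32 * E ^ 3 * s) := by gcongr; exact (hmq _ _).trans (hdG' n)
      _ = _ := by ring
  have t1 := hd2Y n
  have e4 : E ^ 2 ≤ E ^ 4 := pow_le_pow_right₀ hE1 (by norm_num)
  have e5 : s ^ 2 * E ^ 2 ≤ s ^ 2 * E ^ 4 := by gcongr
  have r1 := abs_sub (secondDiff (fun k => wallWeight s k * G k) n) (secondDiff (gapWeight s) n * G n)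
  have r2 := abs_sub (secondDiff (fun k => wallWeight s k * G k) n
    - secondDiff (gapWeight s) n * G n) ((gapWeight s (n + 1) - gapWeight s n) * (G (n + 1) - G n))
  have r3 := abs_sub (secondDiff (fun k => wallWeight s k * G k) n
    - secondDiff (gapWeight s) n * G n - (gapWeight s (n + 1) - gapWeight s n) * (G (n + 1) - G n))
    ((gapWeight s (n - 1) - gapWeight s n) * (G (n - 1) - G n))
  linarith

/-- Dividing by w_n ≥ (s/2) exp(3s|n|/2) leaves one factor s, exactly what compensates the 1/s from
summing the exponentials over n. -/
theorem IsShearSeq.abs_secondDiff_le {s : ℝ} {G : ℤ → ℝ} (hG : IsShearSeq s G)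
    (hs : 0 < s) (n : ℤ) :
    |secondDiff G n| ≤ 296 * exp (2 * s) ^ 4 * s * exp (-(3 / 2 * s * |(n : ℝ)|)) := by
  have h1 := hG.abs_wallWeight_mul_secondDiff_le hs n
  have h2 := (mul_exp_le_gapWeight hs.le n).trans (gapWeight_le_wallWeight hs n)
  rw [abs_mul, abs_of_pos (wallWeight_pos hs n)] at h1
  have h3 := (mul_le_mul_of_nonneg_right h2 (abs_nonneg (secondDiff G n))).trans h1
  have h4 : exp (3 / 2 * s * |(n : ℝ)|) * exp (-(3 / 2 * s * |(n : ℝ)|)) = 1 := by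
    rw [← exp_add]; simp
  have h5 : 0 < 2 / s * exp (-(3 / 2 * s * |(n : ℝ)|)) := by positivity
  have h6 := mul_le_mul_of_nonneg_left h3 h5.le
  calc |secondDiff G n| = (exp (3 / 2 * s * |(n : ℝ)|) * exp (-(3 / 2 * s * |(n : ℝ)|))) *
        (2 / s * (s / 2)) * |secondDiff G n| := by rw [h4]; field_simp
    _ = 2 / s * exp (-(3 / 2 * s * |(n : ℝ)|)) *
        (s / 2 * exp (3 / 2 * s * |(n : ℝ)|) * |secondDiff G n|) := by ring
    _ ≤ _ := h6
    _ = _ := by field_simp; ring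

end

/-! ### Laurent series with exponentially decaying coefficients on annuli. -/

section
open Filter Topology Real

/-- The sum of a Laurent series. -/
def laurentSum (c : ℤ → ℂ) (t : ℂ) : ℂ := ∑' n : ℤ, c n * t ^ n

/-- The open annulus `exp (-r) < |t| < exp r`. -/
def openAnnulus (r : ℝ) : Set ℂ := {t | exp (-r) < ‖t‖ ∧ ‖t‖ < exp r}

/-- The closed annulus `exp (-r) ≤ |t| ≤ exp r`. -/
def closedAnnulus (r : ℝ) : Set ℂ := {t | exp (-r) ≤ ‖t‖ ∧ ‖t‖ ≤ exp r}

/-- Exponential decay, at the rate `r`, of a sequence indexed by the integers. -/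
def ExpDecay (r : ℝ) (c : ℤ → ℂ) : Prop := ∃ C, ∀ n : ℤ, ‖c n‖ ≤ C * exp (-(r * |(n : ℝ)|))

/-- Two geometric series, with 1 - exp(-r) ≥ r exp(-r). The explicit 1/r matters: r will be a
multiple of s. -/
theorem hasSum_exp_neg_abs {r : ℝ} (hr : 0 < r) :
    Summable (fun n : ℤ => exp (-(r * |(n : ℝ)|))) ∧
      ∑' n : ℤ, exp (-(r * |(n : ℝ)|)) ≤ 2 * exp r / r := by
  have h1 : exp (-r) < 1 := by rw [exp_lt_one_iff]; linarith
  have hg := hasSum_geometric_of_lt_one (exp_pos (-r)).le h1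
  have e : ∀ n : ℕ, exp (-(r * |((n : ℤ) : ℝ)|)) = exp (-r) ^ n := by
    intro n
    rw [← exp_nat_mul, Int.cast_natCast, abs_of_nonneg (Nat.cast_nonneg n)]
    congr 1; ring
  have e' : ∀ n : ℕ, exp (-(r * |((-((n : ℤ) + 1) : ℤ) : ℝ)|)) = exp (-r) ^ n * exp (-r) := by
    intro n
    rw [← pow_succ, ← e (n + 1)]
    congr 3
    push_cast
    rw [← abs_neg]; congr 1; ring
  have hs : HasSum (fun n : ℤ => exp (-(r * |(n : ℝ)|)))
      ((1 - exp (-r))⁻¹ + (1 - exp (-r))⁻¹ * exp (-r)) :=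
    HasSum.of_nat_of_neg_add_one (by simpa only [e] using hg)
      (by simpa only [e'] using hg.mul_right (exp (-r)))
  refine ⟨hs.summable, ?_⟩
  rw [hs.tsum_eq]
  have h2 : 0 < 1 - exp (-r) := by linarith
  have h3 : r * exp (-r) ≤ 1 - exp (-r) := by
    have h4 := one_sub_le_exp_neg (-r)
    have h5 : exp (-r) * exp r = 1 := by rw [← exp_add]; simp
    rw [neg_neg] at h4
    nlinarith [exp_pos (-r)]
  have h6 : (1 - exp (-r))⁻¹ ≤ exp r / r := by
    rw [inv_le_comm₀ h2 (by positivity), inv_div, div_eq_mul_inv, ← exp_neg]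
    exact h3
  have h7 : (1 - exp (-r))⁻¹ * exp (-r) ≤ exp r / r :=
    (mul_le_of_le_one_right (inv_nonneg.2 h2.le) h1.le).trans h6
  calc _ ≤ exp r / r + exp r / r := add_le_add h6 h7
    _ = _ := by ring

theorem norm_zpow_le_exp {t : ℂ} {r : ℝ} (ht : t ∈ closedAnnulus r) (n : ℤ) :
    ‖t ^ n‖ ≤ exp (r * |(n : ℝ)|) := by
  have h0 : 0 < ‖t‖ := (exp_pos _).trans_le ht.1
  have h1 : |log ‖t‖| ≤ r := abs_le.2 ⟨(le_log_iff_exp_le h0).2 ht.1, (log_le_iff_le_exp h0).2 ht.2⟩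
  rw [norm_zpow, ← rpow_intCast, rpow_def_of_pos h0]
  refine exp_le_exp.2 ((le_abs_self _).trans ?_)
  rw [abs_mul]
  gcongr

theorem openAnnulus_subset_closedAnnulus (r : ℝ) : openAnnulus r ⊆ closedAnnulus r :=
  fun _ h => ⟨h.1.le, h.2.le⟩

theorem closedAnnulus_subset_openAnnulus {r r' : ℝ} (h : r < r') :
    closedAnnulus r ⊆ openAnnulus r' :=
  fun _ ht => ⟨(exp_lt_exp.2 (neg_lt_neg h)).trans_le ht.1, ht.2.trans_lt (exp_lt_exp.2 h)⟩

theorem openAnnulus_mono {r r' : ℝ} (h : r ≤ r') : openAnnulus r ⊆ openAnnulus r' :=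
  fun _ ht => ⟨(exp_le_exp.2 (neg_le_neg h)).trans_lt ht.1, ht.2.trans_le (exp_le_exp.2 h)⟩

theorem isOpen_openAnnulus (r : ℝ) : IsOpen (openAnnulus r) :=
  (isOpen_lt continuous_const continuous_norm).inter (isOpen_lt continuous_norm continuous_const)

theorem ne_zero_of_mem_openAnnulus {r : ℝ} {t : ℂ} (ht : t ∈ openAnnulus r) : t ≠ 0 :=
  norm_pos_iff.1 ((exp_pos _).trans ht.1)

theorem ne_zero_of_mem_closedAnnulus {r : ℝ} {t : ℂ} (ht : t ∈ closedAnnulus r) : t ≠ 0 :=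
  norm_pos_iff.1 ((exp_pos _).trans_le ht.1)

theorem exists_mem_openAnnulus_lt {r : ℝ} {t : ℂ} (ht : t ∈ openAnnulus r) :
    ∃ r' < r, t ∈ openAnnulus r' := by
  have h0 : 0 < ‖t‖ := (exp_pos _).trans ht.1
  have h1 : -r < log ‖t‖ := (lt_log_iff_exp_lt h0).2 ht.1
  have h2 : log ‖t‖ < r := (log_lt_iff_lt_exp h0).2 ht.2
  refine ⟨(r + |log ‖t‖|) / 2, by linarith [abs_lt.2 ⟨h1, h2⟩], ?_⟩
  have h3 := abs_lt.2 ⟨h1, h2⟩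
  constructor
  · rw [← lt_log_iff_exp_lt h0]; linarith [neg_abs_le (log ‖t‖)]
  · rw [← log_lt_iff_lt_exp h0]; linarith [le_abs_self (log ‖t‖)]

theorem norm_mul_zpow_le {r r' C : ℝ} {c : ℤ → ℂ}
    (hc : ∀ n : ℤ, ‖c n‖ ≤ C * exp (-(r * |(n : ℝ)|))) {t : ℂ} (ht : t ∈ closedAnnulus r') (n : ℤ) :
    ‖c n * t ^ n‖ ≤ C * exp (-((r - r') * |(n : ℝ)|)) := by
  rw [norm_mul]
  calc _ ≤ C * exp (-(r * |(n : ℝ)|)) * exp (r' * |(n : ℝ)|) := by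
        gcongr
        · exact (norm_nonneg _).trans (hc n)
        · exact hc n
        · exact norm_zpow_le_exp ht n
    _ = _ := by rw [mul_assoc, ← exp_add]; congr 2; ring

theorem ExpDecay.summable {r : ℝ} {c : ℤ → ℂ} (hc : ExpDecay r c) {t : ℂ}
    (ht : t ∈ openAnnulus r) : Summable fun n : ℤ => c n * t ^ n := by
  obtain ⟨r', hr', ht'⟩ := exists_mem_openAnnulus_lt ht
  obtain ⟨C, hC⟩ := hc
  exact Summable.of_norm_bounded ((hasSum_exp_neg_abs (sub_pos.2 hr')).1.mul_left C)
    (norm_mul_zpow_le hC (openAnnulus_subset_closedAnnulus _ ht'))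

theorem norm_laurentSum_le {r r' C : ℝ} (h : r' < r) {c : ℤ → ℂ}
    (hc : ∀ n : ℤ, ‖c n‖ ≤ C * exp (-(r * |(n : ℝ)|))) {t : ℂ} (ht : t ∈ closedAnnulus r') :
    ‖laurentSum c t‖ ≤ C * (2 * exp (r - r') / (r - r')) := by
  have hC : 0 ≤ C := by
    have := (norm_nonneg _).trans (hc 0)
    simpa using this
  have hs := hasSum_exp_neg_abs (sub_pos.2 h)
  refine (tsum_of_norm_bounded (hs.1.mul_left C).hasSum (norm_mul_zpow_le hc ht)).trans ?_
  rw [tsum_mul_left]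
  gcongr
  exact hs.2

theorem ExpDecay.add {r : ℝ} {c d : ℤ → ℂ} (hc : ExpDecay r c) (hd : ExpDecay r d) :
    ExpDecay r (fun n => c n + d n) := by
  obtain ⟨C, hC⟩ := hc
  obtain ⟨D, hD⟩ := hd
  exact ⟨C + D, fun n => (norm_add_le _ _).trans (by rw [add_mul]; exact add_le_add (hC n) (hD n))⟩

theorem ExpDecay.const_mul {r : ℝ} {c : ℤ → ℂ} (hc : ExpDecay r c) (a : ℂ) :
    ExpDecay r (fun n => a * c n) := by
  obtain ⟨C, hC⟩ := hc
  exact ⟨‖a‖ * C, fun n => by rw [norm_mul, mul_assoc]; gcongr; exact hC n⟩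

theorem ExpDecay.shift {r : ℝ} (hr : 0 ≤ r) {c : ℤ → ℂ} (hc : ExpDecay r c) (k : ℤ) :
    ExpDecay r (fun n => c (n + k)) := by
  obtain ⟨C, hC⟩ := hc
  have h0 : 0 ≤ C := by simpa using (norm_nonneg _).trans (hC 0)
  refine ⟨C * exp (r * |(k : ℝ)|), fun n => (hC _).trans ?_⟩
  rw [mul_assoc, ← exp_add]
  gcongr
  have h1 : |(n : ℝ)| ≤ |((n + k : ℤ) : ℝ)| + |(k : ℝ)| := by
    have := abs_sub ((n + k : ℤ) : ℝ) (k : ℝ)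
    push_cast at this ⊢
    simpa using this
  nlinarith

theorem abs_mul_exp_le {e : ℝ} (he : 0 < e) (x : ℝ) : |x| ≤ 1 / e * exp (e * |x|) := by
  have := add_one_le_exp (e * |x|)
  rw [div_mul_eq_mul_div, one_mul, le_div_iff₀ he]
  linarith

theorem ExpDecay.intCast_mul {r r' : ℝ} (h : r' < r) {c : ℤ → ℂ} (hc : ExpDecay r c) :
    ExpDecay r' (fun n => n * c n) := by
  obtain ⟨C, hC⟩ := hc
  refine ⟨1 / (r - r') * C, fun n => ?_⟩
  have h0 : 0 ≤ C := by simpa using (norm_nonneg _).trans (hC 0)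
  rw [norm_mul, Complex.norm_intCast]
  have h1 := abs_mul_exp_le (sub_pos.2 h) (n : ℝ)
  calc _ ≤ (1 / (r - r') * exp ((r - r') * |(n : ℝ)|)) * (C * exp (-(r * |(n : ℝ)|))) := by
        gcongr; exact hC n
    _ = 1 / (r - r') * C * (exp ((r - r') * |(n : ℝ)|) * exp (-(r * |(n : ℝ)|))) := by ring
    _ = _ := by rw [← exp_add]; congr 2; ring

theorem ExpDecay.div_intCast {r : ℝ} {c : ℤ → ℂ} (hc : ExpDecay r c) :
    ExpDecay r (fun n => c n / n) := by
  obtain ⟨C, hC⟩ := hc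
  refine ⟨C, fun n => (le_trans ?_ (hC n))⟩
  rw [norm_div, Complex.norm_intCast]
  -- At n = 0 the quotient is 0 by convention, so dividing the coefficients by n drops the constant
  -- term.
  rcases eq_or_ne n 0 with rfl | hn
  · simp
  · refine div_le_self (norm_nonneg _) ?_
    exact_mod_cast Int.one_le_abs hn

theorem ExpDecay.differentiableOn {r : ℝ} {c : ℤ → ℂ} (hc : ExpDecay r c) :
    DifferentiableOn ℂ (laurentSum c) (openAnnulus r) := by
  intro t ht
  obtain ⟨r', hr', ht'⟩ := exists_mem_openAnnulus_lt ht
  obtain ⟨C, hC⟩ := hc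
  refine (DifferentiableOn.differentiableAt ?_ ((isOpen_openAnnulus r').mem_nhds ht')).differentiableWithinAt
  refine Complex.differentiableOn_tsum_of_summable_norm
    ((hasSum_exp_neg_abs (sub_pos.2 hr')).1.mul_left C) (fun n => ?_) (isOpen_openAnnulus r')
    fun n w hw => norm_mul_zpow_le hC (openAnnulus_subset_closedAnnulus _ hw) n
  exact fun w hw => ((differentiableAt_zpow.2 (Or.inl (ne_zero_of_mem_openAnnulus hw))).const_mul
    _).differentiableWithinAt

theorem ExpDecay.hasDerivAt {r : ℝ} {c : ℤ → ℂ} (hc : ExpDecay r c) {t : ℂ}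
    (ht : t ∈ openAnnulus r) :
    HasDerivAt (laurentSum c) (laurentSum (fun n => n * c n) t / t) t := by
  have hd := hc.differentiableOn.differentiableAt ((isOpen_openAnnulus r).mem_nhds ht)
  suffices h : laurentSum (fun n => n * c n) t / t = deriv (laurentSum c) t by
    rw [h]; exact hd.hasDerivAt
  have ht0 := ne_zero_of_mem_openAnnulus ht
  obtain ⟨r', hr', ht'⟩ := exists_mem_openAnnulus_lt ht
  obtain ⟨C, hC⟩ := hc
  have := Complex.hasSum_deriv_of_summable_norm
    ((hasSum_exp_neg_abs (sub_pos.2 hr')).1.mul_left C) (F := fun n w => c n * w ^ n)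
    (fun n => fun w hw => ((differentiableAt_zpow.2
      (Or.inl (ne_zero_of_mem_openAnnulus hw))).const_mul _).differentiableWithinAt)
    (isOpen_openAnnulus r')
    (fun n w hw => norm_mul_zpow_le hC (openAnnulus_subset_closedAnnulus _ hw) n) ht'
  rw [show laurentSum c = fun w => ∑' n : ℤ, c n * w ^ n from rfl, ← this.tsum_eq, laurentSum,
    ← tsum_div_const]
  congr 1
  ext n
  rw [deriv_const_mul _ (differentiableAt_zpow.2 (Or.inl ht0)), deriv_zpow, zpow_sub_one₀ ht0]
  ring

theorem laurentSum_sub_one (c : ℤ → ℂ) {t : ℂ} (ht : t ≠ 0) :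
    laurentSum (fun n => c (n - 1)) t = t * laurentSum c t := by
  unfold laurentSum
  rw [← tsum_mul_left, ← (Equiv.addRight (1 : ℤ)).tsum_eq]
  congr 1
  ext n
  simp only [Equiv.coe_addRight, add_sub_cancel_right, zpow_add_one₀ ht]
  ring

theorem laurentSum_add_one (c : ℤ → ℂ) {t : ℂ} (ht : t ≠ 0) :
    laurentSum (fun n => c (n + 1)) t = t⁻¹ * laurentSum c t := by
  have := laurentSum_sub_one (fun n => c (n + 1)) ht
  simp only [sub_add_cancel] at this
  change laurentSum c t = _ at this
  rw [this, inv_mul_cancel_left₀ ht]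

theorem laurentSum_neg_index (c : ℤ → ℂ) (t : ℂ) :
    laurentSum (fun n => c (-n)) t = laurentSum c t⁻¹ := by
  unfold laurentSum
  rw [← (Equiv.neg ℤ).tsum_eq]
  congr 1
  ext n
  simp

theorem laurentSum_const_mul (c : ℤ → ℂ) (a t : ℂ) :
    laurentSum (fun n => a * c n) t = a * laurentSum c t := by
  unfold laurentSum
  rw [← tsum_mul_left]
  congr 1; ext n; ring

theorem laurentSum_add {r : ℝ} {c d : ℤ → ℂ} (hc : ExpDecay r c) (hd : ExpDecay r d) {t : ℂ}
    (ht : t ∈ openAnnulus r) :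
    laurentSum (fun n => c n + d n) t = laurentSum c t + laurentSum d t := by
  unfold laurentSum
  rw [← (hc.summable ht).tsum_add (hd.summable ht)]
  congr 1; ext n; ring

/-- Index shifts multiply the sum by t or 1/t, and t - 2 + 1/t = (t - 1)²/t. The double zero at t =
1 is the quadratic decay at infinity. -/
theorem laurentSum_secondDiff {r : ℝ} (hr : 0 ≤ r) {c : ℤ → ℂ} (hc : ExpDecay r c) {t : ℂ}
    (ht : t ∈ openAnnulus r) :
    laurentSum (secondDiff c) t = (t - 1) ^ 2 / t * laurentSum c t := by
  have ht0 := ne_zero_of_mem_openAnnulus ht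
  have h1 : secondDiff c = fun n => (c (n + 1) + (-2) * c n) + c (n - 1) := by
    ext n; unfold secondDiff; ring
  have hs := hc.shift hr (-1)
  simp only [← sub_eq_add_neg] at hs
  rw [h1, laurentSum_add ((hc.shift hr 1).add (hc.const_mul (-2))) hs ht,
    laurentSum_add (hc.shift hr 1) (hc.const_mul (-2)) ht, laurentSum_add_one c ht0,
    laurentSum_sub_one c ht0, laurentSum_const_mul]
  field_simp
  ring

theorem conj_laurentSum (c : ℤ → ℂ) (t : ℂ) :
    (starRingEnd ℂ) (laurentSum c t) =
      laurentSum (fun n => (starRingEnd ℂ) (c n)) ((starRingEnd ℂ) t) := by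
  unfold laurentSum
  rw [Complex.conj_tsum]
  simp

end

/-! ### The Goursat functions of the shear flow on the annulus and the boundary condition. -/

section
open Filter Topology Real

/-- The complex coefficients attached to a real sequence. -/
def shearCoeff (G : ℤ → ℝ) (n : ℤ) : ℂ := (G n : ℂ)

/-- The coefficients `2 (m_n G_n + 1)`. -/
def excessCoeff (s : ℝ) (G : ℤ → ℝ) (n : ℤ) : ℂ := ((2 * (gapWeight s n * G n + 1) : ℝ) : ℂ)

/-- The coefficients of positive index of the second Goursat function. -/
def remainderHalf (s : ℝ) (G : ℤ → ℝ) (n : ℤ) : ℂ :=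
  (excessCoeff s G (n - 1) - excessCoeff s G (n + 1)) / (4 * Complex.sinh (2 * s)) +
    excessCoeff s G n / 2 + shearCoeff G n / n * (Complex.exp (2 * s))⁻¹ ^ n

/-- The coefficients of the second Goursat function. -/
def remainderCoeff (s : ℝ) (G : ℤ → ℝ) (n : ℤ) : ℂ :=
  if 0 < n then remainderHalf s G n else if n < 0 then -remainderHalf s G (-n) else 0

/-- The derivative of the first Goursat function, as a function on the annulus. -/
def slope (G : ℤ → ℝ) (t : ℂ) : ℂ := -((t - 1) ^ 2 / (2 * t)) * laurentSum (shearCoeff G) t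

/-- The single-valued part of the first Goursat function. -/
def potential (G : ℤ → ℝ) (t : ℂ) : ℂ := laurentSum (fun n => shearCoeff G n / n) t

/-- The regular part of the second Goursat function. -/
def remainder (s : ℝ) (G : ℤ → ℝ) (t : ℂ) : ℂ := laurentSum (remainderCoeff s G) t

/-- The normalized position variable on the annulus. -/
def position (t : ℂ) : ℂ := (t + 1) / (t - 1)

/-- The normalized complex velocity on the annulus. -/
def annulusVelocity (s : ℝ) (G : ℤ → ℝ) (t : ℂ) : ℂ :=
  Complex.I * (2 * G 0 * (log ‖t‖ : ℝ) + potential G t +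
    position t * (starRingEnd ℂ) (slope G t) + (starRingEnd ℂ) (position t + remainder s G t))

section

variable {s : ℝ} {G : ℤ → ℝ}

theorem IsShearSeq.expDecay_shearCoeff (hG : IsShearSeq s G) (hs : 0 < s) :
    ExpDecay (3 / 2 * s) (shearCoeff G) := by
  refine ⟨2 / s * (1 + sinh (2 * s) / (2 * s)), fun n => ?_⟩
  rw [shearCoeff, Complex.norm_real, norm_eq_abs]
  have h1 := hG.bound n
  have h2 := (mul_exp_le_gapWeight hs.le n).trans (gapWeight_le_wallWeight hs n)
  rw [abs_mul, abs_of_pos (wallWeight_pos hs n)] at h1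
  have h3 := (mul_le_mul_of_nonneg_right h2 (abs_nonneg (G n))).trans h1
  have h4 : exp (3 / 2 * s * |(n : ℝ)|) * exp (-(3 / 2 * s * |(n : ℝ)|)) = 1 := by
    rw [← exp_add]; simp
  have h5 : 0 < 2 / s * exp (-(3 / 2 * s * |(n : ℝ)|)) := by positivity
  have h6 := mul_le_mul_of_nonneg_left h3 h5.le
  calc |G n| = (exp (3 / 2 * s * |(n : ℝ)|) * exp (-(3 / 2 * s * |(n : ℝ)|))) *
        (2 / s * (s / 2)) * |G n| := by rw [h4]; field_simp
    _ = 2 / s * exp (-(3 / 2 * s * |(n : ℝ)|)) *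
        (s / 2 * exp (3 / 2 * s * |(n : ℝ)|) * |G n|) := by ring
    _ ≤ _ := h6
    _ = _ := by ring

theorem IsShearSeq.expDecay_excessCoeff (hG : IsShearSeq s G) :
    ExpDecay (3 / 2 * s) (excessCoeff s G) := by
  obtain ⟨C, hC⟩ := hG.decay
  refine ⟨2 * C, fun n => ?_⟩
  rw [excessCoeff, Complex.norm_real, norm_eq_abs, abs_mul, abs_two, mul_assoc]
  gcongr
  exact hC n

theorem IsShearSeq.shearCoeff_neg (hG : IsShearSeq s G) (n : ℤ) :
    shearCoeff G (-n) = shearCoeff G n := by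
  rw [shearCoeff, shearCoeff, hG.even]

theorem IsShearSeq.excessCoeff_neg (hG : IsShearSeq s G) (n : ℤ) :
    excessCoeff s G (-n) = excessCoeff s G n := by
  rw [excessCoeff, excessCoeff, hG.even, gapWeight_neg]

theorem exp_two_eq (s : ℝ) : Complex.exp (2 * s) = ((exp (2 * s) : ℝ) : ℂ) := by push_cast; rfl

theorem IsShearSeq.expDecay_remainderCoeff (hG : IsShearSeq s G) (hs : 0 < s) :
    ExpDecay (3 / 2 * s) (remainderCoeff s G) := by
  have hV := hG.expDecay_excessCoeff
  have h0 : 0 ≤ 3 / 2 * s := by positivity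
  have h1 : ExpDecay (3 / 2 * s) (fun n => (4 * Complex.sinh (2 * s))⁻¹ *
      (excessCoeff s G (n + -1) + (-1) * excessCoeff s G (n + 1)) + 1 / 2 * excessCoeff s G n) :=
    (((hV.shift h0 (-1)).add ((hV.shift h0 1).const_mul (-1))).const_mul _).add (hV.const_mul _)
  obtain ⟨C, hC⟩ := h1
  obtain ⟨D, hD⟩ := (hG.expDecay_shearCoeff hs).div_intCast
  have key : ∀ n : ℤ, 0 < n → ‖remainderHalf s G n‖ ≤ (C + D) * exp (-(3 / 2 * s * |(n : ℝ)|)) := by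
    intro n hn
    have e : remainderHalf s G n = ((4 * Complex.sinh (2 * s))⁻¹ *
      (excessCoeff s G (n + -1) + (-1) * excessCoeff s G (n + 1)) + 1 / 2 * excessCoeff s G n) +
        shearCoeff G n / n * (Complex.exp (2 * s))⁻¹ ^ n := by
      unfold remainderHalf
      rw [sub_eq_add_neg n 1]
      ring
    rw [e, add_mul]
    refine (norm_add_le _ _).trans (add_le_add (hC n) ?_)
    rw [norm_mul]
    refine (mul_le_of_le_one_right (norm_nonneg _) ?_).trans (hD n)
    lift n to ℕ using hn.le
    rw [zpow_natCast, norm_pow, norm_inv, exp_two_eq, Complex.norm_real, norm_eq_abs,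
      abs_of_pos (exp_pos _)]
    exact pow_le_one₀ (by positivity) (inv_le_one_of_one_le₀ (one_le_exp (by positivity)))
  refine ⟨C + D, fun n => ?_⟩
  unfold remainderCoeff
  split_ifs with h1 h2
  · exact key n h1
  · have := key (-n) (by omega)
    rw [norm_neg]
    simpa using this
  · rw [norm_zero]
    have h3 := (norm_nonneg _).trans (hC 0)
    have h4 := (norm_nonneg _).trans (hD 0)
    simp only [Int.cast_zero, abs_zero, mul_zero, neg_zero, exp_zero, mul_one] at h3 h4
    positivity

theorem IsShearSeq.laurentSum_shearCoeff_inv (hG : IsShearSeq s G) (t : ℂ) :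
    laurentSum (shearCoeff G) t⁻¹ = laurentSum (shearCoeff G) t := by
  rw [← laurentSum_neg_index]
  simp only [hG.shearCoeff_neg]

theorem IsShearSeq.slope_inv (hG : IsShearSeq s G) {t : ℂ} (ht : t ≠ 0) :
    slope G t⁻¹ = slope G t := by
  rw [slope, slope, hG.laurentSum_shearCoeff_inv]
  congr 1
  field_simp
  ring

theorem IsShearSeq.potential_inv (hG : IsShearSeq s G) (t : ℂ) :
    potential G t⁻¹ = -potential G t := by
  rw [potential, potential, ← laurentSum_neg_index, neg_eq_neg_one_mul, ← laurentSum_const_mul]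
  congr 1
  ext n
  rw [hG.shearCoeff_neg]
  push_cast
  ring

theorem remainder_inv (s : ℝ) (G : ℤ → ℝ) (t : ℂ) : remainder s G t⁻¹ = -remainder s G t := by
  rw [remainder, remainder, ← laurentSum_neg_index, neg_eq_neg_one_mul, ← laurentSum_const_mul]
  congr 1
  ext n
  unfold remainderCoeff
  rcases lt_trichotomy n 0 with h | h | h
  · rw [if_pos (by omega), if_neg (by omega), if_pos h]; ring
  · subst h; simp
  · rw [if_neg (by omega), if_pos (by omega), if_pos h, neg_neg]; ring

theorem position_inv {t : ℂ} (ht : t ≠ 0) : position t⁻¹ = -position t := by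
  unfold position
  have h1 : t⁻¹ + 1 = (t + 1) / t := by field_simp; ring
  have h2 : t⁻¹ - 1 = -(t - 1) / t := by field_simp; ring
  rw [h1, h2, div_div_div_cancel_right₀ ht, div_neg]

/-- Inversion of t is z ↦ -z, under which the shear flow is odd; so no slip on the outer circle
gives no slip on the inner one. -/
theorem IsShearSeq.annulusVelocity_inv (hG : IsShearSeq s G) {t : ℂ} (ht : t ≠ 0) :
    annulusVelocity s G t⁻¹ = -annulusVelocity s G t := by
  unfold annulusVelocity
  rw [hG.slope_inv ht, hG.potential_inv, remainder_inv, position_inv ht, norm_inv, log_inv]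
  simp only [map_add, map_neg, Complex.ofReal_neg]
  ring

/-- The recurrence satisfied by the coefficients `2 (m_n G_n + 1)`. -/
theorem IsShearSeq.secondDiff_excess (hG : IsShearSeq s G) (n : ℤ) :
    excessCoeff s G (n + 1) - 2 * Complex.cosh (2 * s) * excessCoeff s G n + excessCoeff s G (n - 1)
      = -2 * Complex.sinh (2 * s) * secondDiff (shearCoeff G) n := by
  have h := hG.eqn n
  unfold secondDiff wallWeight gapConst at h
  have h' := congrArg (fun x : ℝ => (x : ℂ)) h
  simp only at h'
  push_cast at h'
  unfold excessCoeff secondDiff shearCoeff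
  push_cast
  linear_combination 2 * h'

/-- Generating-function form of `secondDiff_excess`. The factor t + 1/t - 2 cosh 2s vanishes at t =
exp(2s), so it absorbs the denominator of conj(position) = (exp(2s) + t)/(exp(2s) - t) on the outer
circle. -/
theorem IsShearSeq.slope_eq (hG : IsShearSeq s G) (hs : 0 < s) {t : ℂ}
    (ht : t ∈ openAnnulus (3 / 2 * s)) :
    4 * Complex.sinh (2 * s) * slope G t =
      (t + t⁻¹ - 2 * Complex.cosh (2 * s)) * laurentSum (excessCoeff s G) t := by
  have ht0 := ne_zero_of_mem_openAnnulus ht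
  have h0 : 0 ≤ 3 / 2 * s := by positivity
  have hV := hG.expDecay_excessCoeff
  have hg := hG.expDecay_shearCoeff hs
  have h1 : laurentSum (fun n => (excessCoeff s G (n + 1) +
      (-2 * Complex.cosh (2 * s)) * excessCoeff s G n) + excessCoeff s G (n + -1)) t =
      laurentSum (fun n => (-2 * Complex.sinh (2 * s)) * secondDiff (shearCoeff G) n) t := by
    congr 1
    ext n
    rw [← hG.secondDiff_excess, ← sub_eq_add_neg n 1]
    ring
  rw [laurentSum_add ((hV.shift h0 1).add (hV.const_mul _)) (hV.shift h0 (-1)) ht,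
    laurentSum_add (hV.shift h0 1) (hV.const_mul _) ht, laurentSum_const_mul, laurentSum_const_mul,
    laurentSum_add_one _ ht0, laurentSum_secondDiff h0 hg ht] at h1
  have h2 := laurentSum_sub_one (excessCoeff s G) ht0
  simp only [sub_eq_add_neg] at h2
  rw [h2] at h1
  unfold slope
  have h3 : -((t - 1) ^ 2 / (2 * t)) = -(1 / 2) * ((t - 1) ^ 2 / t) := by field_simp
  rw [h3]
  linear_combination -h1

/-- Coefficient form of no slip on |t| = exp(s). For n > 0 it defines the remainder; for n < 0 it is
forced by the odd extension of the remainder together with m_n = sinh(2ns)/n. The right side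
collects the expansion of (t + 1)/(t - 1) for |t| > 1 and the constant 2sG_0 of the logarithm. -/
theorem IsShearSeq.remainder_identity (hG : IsShearSeq s G) (n : ℤ) :
    (excessCoeff s G (n - 1) - excessCoeff s G (n + 1)) / (4 * Complex.sinh (2 * s)) +
      excessCoeff s G n / 2 - remainderCoeff s G n +
        shearCoeff G n / n * (Complex.exp (2 * s))⁻¹ ^ n
      = if 0 < n then (0 : ℂ) else if n < 0 then 2 else 1 + 2 * (s : ℂ) * (G 0 : ℂ) := by
  unfold remainderCoeff
  split_ifs with h1 h2
  · unfold remainderHalf; ring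
  · unfold remainderHalf
    have h3 : (n : ℂ) ≠ 0 := by exact_mod_cast h2.ne
    have h4 : n * gapWeight s n = sinh (2 * n * s) := mul_gapWeight s n
    have h5 : excessCoeff s G n = shearCoeff G n / n *
        ((Complex.exp (2 * s)) ^ n - (Complex.exp (2 * s))⁻¹ ^ n) + 2 := by
      rw [inv_zpow, ← zpow_neg, ← Complex.exp_int_mul, ← Complex.exp_int_mul]
      have e1 : (n : ℂ) * (2 * s) = ((2 * n * s : ℝ) : ℂ) := by push_cast; ring
      have e2 : ((-n : ℤ) : ℂ) * (2 * s) = -((2 * n * s : ℝ) : ℂ) := by push_cast; ring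
      have e3 : Complex.exp ((2 * n * s : ℝ) : ℂ) - Complex.exp (-((2 * n * s : ℝ) : ℂ)) =
          2 * ((n * gapWeight s n : ℝ) : ℂ) := by
        rw [h4, Complex.ofReal_sinh, Complex.two_sinh]
      rw [e1, e2, e3, excessCoeff, shearCoeff]
      push_cast
      field_simp
    rw [show -n - 1 = -(n + 1) by ring, show -n + 1 = -(n - 1) by ring]
    simp only [hG.excessCoeff_neg, hG.shearCoeff_neg]
    rw [inv_zpow, inv_zpow] at *
    rw [zpow_neg, inv_inv]
    push_cast
    rw [div_neg]
    linear_combination h5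
  · obtain rfl : n = 0 := by omega
    have := hG.excessCoeff_neg 1
    simp only [zero_sub, zero_add, this, sub_self, zero_div]
    simp only [excessCoeff, gapWeight_zero, shearCoeff]
    push_cast
    simp
    ring

/-- On the circle conj t = exp(2s)/t, so the conjugate of the velocity becomes analytic in t.
`slope_eq` turns its rational coefficient into a Laurent polynomial, and what is left is
`remainder_identity` summed against tⁿ. -/
theorem IsShearSeq.annulusVelocity_eq_zero (hG : IsShearSeq s G) (hs : 0 < s) {t : ℂ}
    (ht : ‖t‖ = exp s) : annulusVelocity s G t = 0 := by
  have h0 : 0 ≤ 3 / 2 * s := by positivity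
  have htm : t ∈ openAnnulus (3 / 2 * s) := by
    constructor <;> rw [ht, exp_lt_exp] <;> linarith
  have ht0 := ne_zero_of_mem_openAnnulus htm
  set Q := Complex.exp (2 * s) with hQ
  have hQ0 : Q ≠ 0 := Complex.exp_ne_zero _
  have hQn : ‖Q‖ = exp (2 * s) := by
    rw [hQ, exp_two_eq, Complex.norm_real, norm_eq_abs, abs_of_pos (exp_pos _)]
  have hconj : (starRingEnd ℂ) t = Q / t := by
    rw [eq_div_iff ht0, mul_comm, Complex.mul_conj, Complex.normSq_eq_norm_sq, ht, hQ, exp_two_eq,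
      ← exp_nat_mul]
    norm_num
  have htQ : t / Q ∈ openAnnulus (3 / 2 * s) := by
    have : ‖t / Q‖ = exp (-s) := by rw [norm_div, ht, hQn, ← exp_sub]; congr 1; ring
    constructor <;> rw [this, exp_lt_exp] <;> linarith
  have hV := hG.expDecay_excessCoeff
  have hg := hG.expDecay_shearCoeff hs
  have hR := hG.expDecay_remainderCoeff hs
  have hgn := hg.div_intCast
  have h1t : 1 < ‖t‖ := by rw [ht]; exact one_lt_exp_iff.2 hs
  have ht1 : t ≠ 1 := by rintro rfl; simp at h1t
  -- summation of the coefficient identity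
  have hsum : laurentSum (fun n => ((4 * Complex.sinh (2 * s))⁻¹ *
      (excessCoeff s G (n + -1) + (-1) * excessCoeff s G (n + 1)) + 1 / 2 * excessCoeff s G n) +
        (-1) * remainderCoeff s G n) t + potential G (t / Q) = position t + 2 * s * G 0 := by
    have hX : ExpDecay (3 / 2 * s) (fun n => ((4 * Complex.sinh (2 * s))⁻¹ *
      (excessCoeff s G (n + -1) + (-1) * excessCoeff s G (n + 1)) + 1 / 2 * excessCoeff s G n) +
        (-1) * remainderCoeff s G n) :=
      ((((hV.shift h0 (-1)).add ((hV.shift h0 1).const_mul (-1))).const_mul _).add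
        (hV.const_mul _)).add (hR.const_mul _)
    rw [laurentSum, potential, laurentSum, ← (hX.summable htm).tsum_add (hgn.summable htQ)]
    have hgeo : HasSum (fun n : ℕ => t⁻¹ ^ n) (1 - t⁻¹)⁻¹ :=
      hasSum_geometric_of_norm_lt_one (by rw [norm_inv]; exact inv_lt_one_of_one_lt₀ h1t)
    have hE : HasSum (fun n : ℤ => (if 0 < n then (0 : ℂ) else if n < 0 then 2 else
        1 + 2 * (s : ℂ) * (G 0 : ℂ)) * t ^ n)
        ((1 + 2 * (s : ℂ) * (G 0 : ℂ)) + 2 * t⁻¹ * (1 - t⁻¹)⁻¹) := by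
      refine HasSum.of_nat_of_neg_add_one ?_ ?_
      · have := hasSum_single (f := fun n : ℕ => (if 0 < (n : ℤ) then (0 : ℂ) else
          if (n : ℤ) < 0 then 2 else 1 + 2 * (s : ℂ) * (G 0 : ℂ)) * t ^ (n : ℤ)) 0
          (fun k hk => by rw [if_pos (by omega), zero_mul])
        simpa using this
      · have h := hgeo.mul_left (2 * t⁻¹)
        have e : (fun n : ℕ => (if 0 < -((n : ℤ) + 1) then (0 : ℂ) else
          if -((n : ℤ) + 1) < 0 then 2 else 1 + 2 * (s : ℂ) * (G 0 : ℂ)) * t ^ (-((n : ℤ) + 1))) =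
            fun n : ℕ => 2 * t⁻¹ * t⁻¹ ^ n := by
          ext n
          rw [if_neg (by omega), if_pos (by omega), zpow_neg, ← inv_zpow, zpow_add_one₀
            (inv_ne_zero ht0), zpow_natCast]
          ring
        rw [e]
        exact h
    have e : ∀ n : ℤ, (((4 * Complex.sinh (2 * s))⁻¹ *
      (excessCoeff s G (n + -1) + (-1) * excessCoeff s G (n + 1)) + 1 / 2 * excessCoeff s G n) +
        (-1) * remainderCoeff s G n) * t ^ n + shearCoeff G n / n * (t / Q) ^ n =
        (if 0 < n then (0 : ℂ) else if n < 0 then 2 else 1 + 2 * (s : ℂ) * (G 0 : ℂ)) * t ^ n := by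
      intro n
      rw [← hG.remainder_identity, div_eq_mul_inv t Q, mul_zpow, sub_eq_add_neg n 1]
      ring
    simp_rw [e]
    rw [hE.tsum_eq]
    unfold position
    have h1 : t - 1 ≠ 0 := sub_ne_zero.2 ht1
    have h2 : 1 - t⁻¹ = (t - 1) / t := by field_simp
    rw [h2]
    field_simp
    ring
  rw [laurentSum_add (((((hV.shift h0 (-1)).add ((hV.shift h0 1).const_mul (-1))).const_mul _).add
        (hV.const_mul _))) (hR.const_mul _) htm,
    laurentSum_add (((hV.shift h0 (-1)).add ((hV.shift h0 1).const_mul (-1))).const_mul _)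
        (hV.const_mul _) htm, laurentSum_const_mul, laurentSum_const_mul, laurentSum_const_mul,
    laurentSum_add (hV.shift h0 (-1)) ((hV.shift h0 1).const_mul (-1)) htm, laurentSum_const_mul,
    laurentSum_add_one _ ht0] at hsum
  have h2 := laurentSum_sub_one (excessCoeff s G) ht0
  simp only [sub_eq_add_neg] at h2
  rw [h2] at hsum
  have hpot : potential G (t / Q) = -potential G ((starRingEnd ℂ) t) := by
    rw [hconj, ← hG.potential_inv, inv_div]
  have hpc : potential G ((starRingEnd ℂ) t) = (starRingEnd ℂ) (potential G t) := by
    unfold potential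
    rw [conj_laurentSum]
    simp [shearCoeff]
  have hslope := hG.slope_eq hs htm
  have hC : Complex.cosh (2 * s) = (Q + Q⁻¹) / 2 := by
    rw [Complex.cosh, hQ, Complex.exp_neg]
  have hS : Complex.sinh (2 * s) = (Q - Q⁻¹) / 2 := by
    rw [Complex.sinh, hQ, Complex.exp_neg]
  have hS0 : Complex.sinh (2 * s) ≠ 0 := by
    have : Complex.sinh (2 * s) = ((sinh (2 * s) : ℝ) : ℂ) := by push_cast; rfl
    rw [this, Complex.ofReal_ne_zero]
    exact (sinh_pos_iff.2 (by positivity)).ne'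
  have hQt : Q - t ≠ 0 := by
    intro h
    have := congrArg norm (sub_eq_zero.1 h)
    rw [hQn, ht] at this
    have := exp_injective this
    linarith
  have hposc : position ((starRingEnd ℂ) t) = (Q + t) / (Q - t) := by
    unfold position
    rw [hconj]
    have e1 : Q / t + 1 = (Q + t) / t := by field_simp
    have e2 : Q / t - 1 = (Q - t) / t := by field_simp
    rw [e1, e2, div_div_div_cancel_right₀ ht0]
  have hposc' : position ((starRingEnd ℂ) t) = (starRingEnd ℂ) (position t) := by
    simp [position]
  suffices h : (starRingEnd ℂ) (2 * G 0 * (log ‖t‖ : ℝ) + potential G t +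
      position t * (starRingEnd ℂ) (slope G t) + (starRingEnd ℂ) (position t + remainder s G t))
      = 0 by
    rw [map_eq_zero] at h
    rw [annulusVelocity, h, mul_zero]
  rw [map_add, map_add, map_add, map_mul, map_mul, map_mul, Complex.conj_conj, Complex.conj_conj,
    ← hpc, ← hposc', hposc, ht, log_exp, Complex.conj_ofReal, Complex.conj_ofReal, map_ofNat]
  have hrem : remainder s G t = laurentSum (remainderCoeff s G) t := rfl
  have key : 4 * Complex.sinh (2 * s) * ((Q + t) / (Q - t) * slope G t) =
      -(t - t⁻¹ + 2 * Complex.sinh (2 * s)) * laurentSum (excessCoeff s G) t := by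
    rw [show 4 * Complex.sinh (2 * s) * ((Q + t) / (Q - t) * slope G t) =
      (Q + t) / (Q - t) * (4 * Complex.sinh (2 * s) * slope G t) by ring, hslope, hC, hS]
    field_simp
    ring
  rw [hpot, ← hrem] at hsum
  have key2 : (Q + t) / (Q - t) * slope G t =
      -((4 * Complex.sinh (2 * s))⁻¹ * (t - t⁻¹) + 1 / 2) * laurentSum (excessCoeff s G) t := by
    have hS4 : 4 * Complex.sinh (2 * s) ≠ 0 := by simpa using hS0
    rw [← mul_right_inj' hS4, key]
    field_simp
    ring
  rw [key2]
  linear_combination -hsum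

end

end

/-! ### Stokes flow and strain in complex notation; Goursat pairs give Stokes flows. -/

section
open Filter Topology Real

/-- The identification of the Euclidean plane with the complex plane. -/
def toComplex : Plane ≃ₗᵢ[ℝ] ℂ := Complex.orthonormalBasisOneI.repr.symm

theorem toComplex_apply (x : Plane) : toComplex x = x 0 + x 1 * Complex.I :=
  Complex.orthonormalBasisOneI_repr_symm_apply x

theorem toComplex_re (x : Plane) : (toComplex x).re = x 0 := by simp [toComplex_apply]

theorem toComplex_im (x : Plane) : (toComplex x).im = x 1 := by simp [toComplex_apply]

theorem toComplex_symm_zero (z : ℂ) : toComplex.symm z 0 = z.re := by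
  rw [← toComplex_re, LinearIsometryEquiv.apply_symm_apply]

theorem toComplex_symm_one (z : ℂ) : toComplex.symm z 1 = z.im := by
  rw [← toComplex_im, LinearIsometryEquiv.apply_symm_apply]

theorem toComplex_single_zero : toComplex (EuclideanSpace.single 0 1) = 1 := by
  simp [toComplex_apply]

theorem toComplex_single_one : toComplex (EuclideanSpace.single 1 1) = Complex.I := by
  simp [toComplex_apply]

/-- The planar vector field attached to a complex velocity. -/
def planarField (U : ℂ → ℂ) (x : Plane) : Plane := toComplex.symm (U (toComplex x))

theorem planarField_conj (v : Plane → Plane) :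
    planarField (fun z => toComplex (v (toComplex.symm z))) = v := by
  ext x
  simp [planarField]

theorem fderiv_planarField (U : ℂ → ℂ) (x h : Plane) :
    fderiv ℝ (planarField U) x h = toComplex.symm (fderiv ℝ U (toComplex x) (toComplex h)) := by
  have h1 : planarField U = toComplex.symm ∘ (U ∘ toComplex.toContinuousLinearEquiv) := rfl
  rw [h1, LinearIsometryEquiv.comp_fderiv, ContinuousLinearEquiv.comp_right_fderiv]
  rfl

theorem laplacian_planarField (U : ℂ → ℂ) (x : Plane) :
    Laplacian.laplacian (planarField U) x =
      toComplex.symm (fderiv ℝ (fderiv ℝ U) (toComplex x) 1 1 +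
        fderiv ℝ (fderiv ℝ U) (toComplex x) Complex.I Complex.I) := by
  have h1 : planarField U =
      (toComplex.symm.toContinuousLinearEquiv) ∘ (U ∘ toComplex.toContinuousLinearEquiv) := rfl
  have h2 : ∀ m : Fin 2 → Plane, iteratedFDeriv ℝ 2 (U ∘ toComplex.toContinuousLinearEquiv) x m =
      iteratedFDeriv ℝ 2 U (toComplex x) (fun i => toComplex (m i)) := by
    intro m
    have := ContinuousLinearEquiv.iteratedFDerivWithin_comp_right
      toComplex.toContinuousLinearEquiv U (uniqueDiffOn_univ (𝕜 := ℝ)) (x := x)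
      (Set.mem_univ _) 2
    rw [Set.preimage_univ, iteratedFDerivWithin_univ, iteratedFDerivWithin_univ] at this
    rw [this]
    rfl
  have h3 : ∀ m : Fin 2 → Plane, iteratedFDeriv ℝ 2 (planarField U) x m =
      toComplex.symm (iteratedFDeriv ℝ 2 (U ∘ toComplex.toContinuousLinearEquiv) x m) := by
    intro m
    rw [h1, ContinuousLinearEquiv.iteratedFDeriv_comp_left]
    rfl
  have h4 : ∀ i : Fin 2, iteratedFDeriv ℝ 2 (planarField U) x
      ![EuclideanSpace.basisFun (Fin 2) ℝ i, EuclideanSpace.basisFun (Fin 2) ℝ i] =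
      toComplex.symm (fderiv ℝ (fderiv ℝ U) (toComplex x)
        (toComplex (EuclideanSpace.single i 1)) (toComplex (EuclideanSpace.single i 1))) := by
    intro i
    rw [h3, h2, iteratedFDeriv_two_apply]
    simp
  rw [InnerProductSpace.laplacian_eq_iteratedFDeriv_orthonormalBasis _
    (EuclideanSpace.basisFun (Fin 2) ℝ)]
  simp only [Fin.sum_univ_two, h4]
  rw [toComplex_single_zero, toComplex_single_one, map_add]

theorem gradient_comp_toComplex (Q : ℂ → ℝ) (x : Plane) :
    gradient (fun y => Q (toComplex y)) x =
      toComplex.symm (fderiv ℝ Q (toComplex x) 1 + fderiv ℝ Q (toComplex x) Complex.I *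
        Complex.I) := by
  have h : ∀ h : Plane, inner ℝ (gradient (fun y => Q (toComplex y)) x) h =
      fderiv ℝ Q (toComplex x) (toComplex h) := by
    intro h
    rw [inner_gradient_left]
    have h1 : (fun y => Q (toComplex y)) = Q ∘ toComplex.toContinuousLinearEquiv := rfl
    rw [h1, ContinuousLinearEquiv.comp_right_fderiv]
    rfl
  ext i
  have h2 := h (EuclideanSpace.single i 1)
  rw [EuclideanSpace.inner_single_right] at h2
  fin_cases i
  · simp only [Fin.zero_eta, Fin.isValue, toComplex_single_zero] at h2 ⊢
    rw [toComplex_symm_zero]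
    simpa using h2
  · simp only [Fin.mk_one, Fin.isValue, toComplex_single_one] at h2 ⊢
    rw [toComplex_symm_one]
    simpa using h2

/-- The real linear map `h ↦ a h + b (conj h)`. -/
def wirtinger (a b : ℂ) : ℂ →L[ℝ] ℂ :=
  a • ContinuousLinearMap.id ℝ ℂ + b • (Complex.conjCLE : ℂ →L[ℝ] ℂ)

theorem wirtinger_apply (a b h : ℂ) : wirtinger a b h = a * h + b * (starRingEnd ℂ) h := by
  simp [wirtinger]

theorem hasFDerivAt_of_hasDerivAt {f : ℂ → ℂ} {f' z : ℂ} (hf : HasDerivAt f f' z) :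
    HasFDerivAt f (wirtinger f' 0) z := by
  refine hf.complexToReal_fderiv.congr_fderiv ?_
  ext
  simp [wirtinger_apply]

theorem hasFDerivAt_conj_of_hasDerivAt {f : ℂ → ℂ} {f' z : ℂ} (hf : HasDerivAt f f' z) :
    HasFDerivAt (fun z => (starRingEnd ℂ) (f z)) (wirtinger 0 ((starRingEnd ℂ) f')) z := by
  refine ((Complex.conjCLE : ℂ →L[ℝ] ℂ).hasFDerivAt.comp z hf.complexToReal_fderiv).congr_fderiv ?_
  ext
  simp [wirtinger_apply]

theorem norm_wirtinger_le (a b : ℂ) : ‖wirtinger a b‖ ≤ ‖a‖ + ‖b‖ := by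
  refine ContinuousLinearMap.opNorm_le_bound _ (by positivity) fun h => ?_
  rw [wirtinger_apply]
  refine (norm_add_le _ _).trans ?_
  rw [norm_mul, norm_mul, RCLike.norm_conj, add_mul]

/-- The Stokes system in terms of the complex velocity. -/
theorem isStokesFlow_planarField_iff {μ : ℝ} {Ω : Set ℂ} {U : ℂ → ℂ} {Q : ℂ → ℝ} :
    IsStokesFlow μ (toComplex ⁻¹' Ω) (planarField U) (fun x => Q (toComplex x)) ↔
      ContDiffOn ℝ 2 U Ω ∧ ContDiffOn ℝ 1 Q Ω ∧
      (∀ z ∈ Ω, μ * (fderiv ℝ (fderiv ℝ U) z 1 1 + fderiv ℝ (fderiv ℝ U) z Complex.I Complex.I) =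
        fderiv ℝ Q z 1 + fderiv ℝ Q z Complex.I * Complex.I) ∧
      (∀ z ∈ Ω, (fderiv ℝ U z 1).re + (fderiv ℝ U z Complex.I).im = 0) := by
  have hdiv : ∀ x, divergence (planarField U) x =
      (fderiv ℝ U (toComplex x) 1).re + (fderiv ℝ U (toComplex x) Complex.I).im := by
    intro x
    rw [divergence, Fin.sum_univ_two, partialDeriv, partialDeriv, fderiv_planarField,
      fderiv_planarField, toComplex_single_zero, toComplex_single_one, toComplex_symm_zero,
      toComplex_symm_one]
  have hmom : ∀ x, (μ • Laplacian.laplacian (planarField U) x =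
      gradient (fun y => Q (toComplex y)) x) ↔ μ * (fderiv ℝ (fderiv ℝ U) (toComplex x) 1 1 +
        fderiv ℝ (fderiv ℝ U) (toComplex x) Complex.I Complex.I) =
        fderiv ℝ Q (toComplex x) 1 + fderiv ℝ Q (toComplex x) Complex.I * Complex.I := by
    intro x
    rw [laplacian_planarField, gradient_comp_toComplex, ← map_smul, toComplex.symm.injective.eq_iff,
      Complex.real_smul]
  have hsmooth : ContDiffOn ℝ 2 (planarField U) (toComplex ⁻¹' Ω) ↔ ContDiffOn ℝ 2 U Ω := by
    have h1 : planarField U = toComplex.symm ∘ (U ∘ toComplex) := rfl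
    rw [h1]
    refine (toComplex.symm.toContinuousLinearEquiv.comp_contDiffOn_iff).trans ?_
    exact toComplex.toContinuousLinearEquiv.contDiffOn_comp_iff
  have hsmooth' : ContDiffOn ℝ 1 (fun x => Q (toComplex x)) (toComplex ⁻¹' Ω) ↔
      ContDiffOn ℝ 1 Q Ω := toComplex.toContinuousLinearEquiv.contDiffOn_comp_iff
  constructor
  · rintro ⟨h1, h2, h3, h4⟩
    refine ⟨hsmooth.1 h1, hsmooth'.1 h2, fun z hz => ?_, fun z hz => ?_⟩
    · have := (hmom (toComplex.symm z)).1 (h3 _ (by simpa using hz))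
      simpa using this
    · have := h4 (toComplex.symm z) (by simpa using hz)
      rw [hdiv] at this
      simpa using this
  · rintro ⟨h1, h2, h3, h4⟩
    exact ⟨hsmooth.2 h1, hsmooth'.2 h2, fun x hx => (hmom x).2 (h3 _ hx),
      fun x hx => (hdiv x).trans (h4 _ hx)⟩

/-- The strain tensor in terms of the complex velocity. -/
theorem strain_planarField {U : ℂ → ℂ} {x : Plane} {a b : ℂ}
    (h : fderiv ℝ U (toComplex x) = wirtinger a b) (ha : a.re = 0) :
    strain (planarField U) x = !![b.re, b.im; b.im, -b.re] := by
  have hp : ∀ j i, partialDeriv (planarField U) j i x =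
      (toComplex.symm (wirtinger a b (toComplex (EuclideanSpace.single j 1)))) i := by
    intro j i
    rw [partialDeriv, fderiv_planarField, h]
  ext i j
  fin_cases i <;> fin_cases j <;>
    simp [strain, jacobian, hp, wirtinger_apply, toComplex_single_zero, toComplex_single_one,
      toComplex_symm_zero, toComplex_symm_one, ha] <;> ring

/-- A Goursat representation yields a solution of the Stokes system. -/
theorem isStokesFlow_of_goursat {μ : ℝ} {Ω : Set ℂ} (hΩ : IsOpen Ω) {U P K : ℂ → ℂ}
    (hP : DifferentiableOn ℂ P Ω) (hK : DifferentiableOn ℂ K Ω)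
    (hU : ∀ z ∈ Ω, HasFDerivAt U (wirtinger (P z - (starRingEnd ℂ) (P z))
      ((starRingEnd ℂ) (K z) - z * (starRingEnd ℂ) (deriv P z))) z) :
    IsStokesFlow μ (toComplex ⁻¹' Ω) (planarField U)
      (fun x => -4 * μ * (P (toComplex x)).re) := by
  have hP' : DifferentiableOn ℂ (deriv P) Ω := hP.deriv hΩ
  have cP : ContDiffOn ℝ 1 P Ω := (hP.contDiffOn hΩ).restrict_scalars ℝ
  have cP' : ContDiffOn ℝ 1 (deriv P) Ω := (hP'.contDiffOn hΩ).restrict_scalars ℝ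
  have cK : ContDiffOn ℝ 1 K Ω := (hK.contDiffOn hΩ).restrict_scalars ℝ
  have cconj : ∀ {f : ℂ → ℂ}, ContDiffOn ℝ 1 f Ω →
      ContDiffOn ℝ 1 (fun z => (starRingEnd ℂ) (f z)) Ω := fun hf =>
    Complex.conjCLE.contDiff.comp_contDiffOn hf
  set α : ℂ → ℂ := fun z => P z - (starRingEnd ℂ) (P z) with hα
  set β : ℂ → ℂ := fun z => (starRingEnd ℂ) (K z) - z * (starRingEnd ℂ) (deriv P z) with hβ
  have cα : ContDiffOn ℝ 1 α Ω := cP.sub (cconj cP)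
  have cβ : ContDiffOn ℝ 1 β Ω := (cconj cK).sub (contDiffOn_id.mul (cconj cP'))
  have hfd : ∀ z ∈ Ω, fderiv ℝ U z = wirtinger (α z) (β z) := fun z hz => (hU z hz).fderiv
  have hPd : ∀ z ∈ Ω, HasDerivAt P (deriv P z) z := fun z hz =>
    (hP.differentiableAt (hΩ.mem_nhds hz)).hasDerivAt
  have hPd' : ∀ z ∈ Ω, HasDerivAt (deriv P) (deriv (deriv P) z) z := fun z hz =>
    (hP'.differentiableAt (hΩ.mem_nhds hz)).hasDerivAt
  have hKd : ∀ z ∈ Ω, HasDerivAt K (deriv K z) z := fun z hz =>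
    (hK.differentiableAt (hΩ.mem_nhds hz)).hasDerivAt
  refine (isStokesFlow_planarField_iff (Q := fun z => -4 * μ * (P z).re)).2 ⟨?_, ?_, fun z hz => ?_, fun z hz => ?_⟩
  · rw [show (2 : WithTop ℕ∞) = 1 + 1 by norm_num, contDiffOn_succ_iff_fderiv_of_isOpen hΩ]
    refine ⟨fun z hz => (hU z hz).differentiableAt.differentiableWithinAt, by simp, ?_⟩
    refine ContDiffOn.congr (f := fun z => wirtinger (α z) (β z)) ?_ hfd
    exact (cα.smul contDiffOn_const).add (cβ.smul contDiffOn_const)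
  · exact contDiffOn_const.mul (Complex.reCLM.contDiff.comp_contDiffOn cP)
  -- Both sides equal -4μ conj P'. The Laplacian is four times the z-derivative of conj K - z conj
  -- P', and the gradient of -4μ Re P, as a complex number, is twice its derivative in conj z.
  · have h1 : HasFDerivAt (fderiv ℝ U) (((wirtinger (deriv P z) 0 -
        wirtinger 0 ((starRingEnd ℂ) (deriv P z)))).smulRight (ContinuousLinearMap.id ℝ ℂ) +
        ((wirtinger 0 ((starRingEnd ℂ) (deriv K z)) - (z • wirtinger 0 ((starRingEnd ℂ)
          (deriv (deriv P) z)) + (starRingEnd ℂ) (deriv P z) • wirtinger 1 0))).smulRight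
            (Complex.conjCLE : ℂ →L[ℝ] ℂ)) z := by
      have e : fderiv ℝ U =ᶠ[𝓝 z] fun z => wirtinger (α z) (β z) := by
        filter_upwards [hΩ.mem_nhds hz] with w hw using hfd w hw
      refine HasFDerivAt.congr_of_eventuallyEq ?_ e
      have hαd := (hasFDerivAt_of_hasDerivAt (hPd z hz)).sub (hasFDerivAt_conj_of_hasDerivAt (hPd z hz))
      have hβd := (hasFDerivAt_conj_of_hasDerivAt (hKd z hz)).sub ((hasFDerivAt_of_hasDerivAt (hasDerivAt_id z)).mul (hasFDerivAt_conj_of_hasDerivAt (hPd' z hz)))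
      exact (hαd.smul_const _).add (hβd.smul_const _)
    have h2 : HasFDerivAt (fun z => -4 * μ * (P z).re)
        ((-4 * μ) • (Complex.reCLM.comp (wirtinger (deriv P z) 0))) z :=
      (Complex.reCLM.hasFDerivAt.comp z (hasFDerivAt_of_hasDerivAt (hPd z hz))).const_mul _
    rw [h1.fderiv, h2.fderiv]
    apply Complex.ext <;> simp [wirtinger_apply] <;> ring
  · rw [hfd z hz, wirtinger_apply, wirtinger_apply]
    simp [hα]

end

/-! ### The two-disk exterior and its Möbius map onto an annulus. -/

section
open Filter Topology Real Asymptotics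

/-- The exterior of two disks of radius `R` centred at `c` and `-c`, in the complex plane. -/
def exteriorDomain (R c : ℝ) : Set ℂ := {z | R < ‖z - c‖ ∧ R < ‖z + c‖}

theorem dist_toComplex_right (c : ℝ) (x : Plane) : dist x !₂[c, 0] = ‖toComplex x - c‖ := by
  have : toComplex !₂[c, 0] = c := by simp [toComplex_apply]
  rw [← toComplex.dist_map, this, dist_eq_norm]

theorem fluidDomain_eq {R δ : ℝ} (hR : 0 < R) :
    fluidDomain R δ = toComplex ⁻¹' exteriorDomain R (R + δ / 2) := by
  unfold fluidDomain leftDisk rightDisk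
  rw [closure_union, closure_ball _ hR.ne', closure_ball _ hR.ne']
  ext x
  simp only [Set.mem_compl_iff, Set.mem_union, Metric.mem_closedBall, dist_toComplex_right, not_or,
    not_le, Set.mem_preimage, exteriorDomain, Set.mem_ofPred_eq]
  rw [and_comm]
  push_cast
  rw [show toComplex x - (-(R : ℂ) - δ / 2) = toComplex x + (R + δ / 2) by ring]

theorem closure_fluidDomain_subset {R δ : ℝ} (hR : 0 < R) {x : Plane}
    (hx : x ∈ closure (fluidDomain R δ)) :
    R ≤ ‖toComplex x - (R + δ / 2 : ℝ)‖ ∧ R ≤ ‖toComplex x + (R + δ / 2 : ℝ)‖ := by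
  have hc : IsClosed {x : Plane | R ≤ ‖toComplex x - (R + δ / 2 : ℝ)‖ ∧
      R ≤ ‖toComplex x + (R + δ / 2 : ℝ)‖} := by
    have h1 : IsClosed {x : Plane | R ≤ ‖toComplex x - (R + δ / 2 : ℝ)‖} :=
      isClosed_le continuous_const ((toComplex.continuous.sub continuous_const).norm)
    have h2 : IsClosed {x : Plane | R ≤ ‖toComplex x + (R + δ / 2 : ℝ)‖} :=
      isClosed_le continuous_const ((toComplex.continuous.add continuous_const).norm)
    exact h1.inter h2
  refine closure_minimal ?_ hc hx
  rw [fluidDomain_eq hR]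
  exact fun y hy => ⟨hy.1.le, hy.2.le⟩

theorem mem_frontier_disks_iff {R δ : ℝ} (hR : 0 < R) {x : Plane} :
    x ∈ frontier (leftDisk R δ) ∪ frontier (rightDisk R δ) ↔
      ‖toComplex x - (R + δ / 2 : ℝ)‖ = R ∨ ‖toComplex x + (R + δ / 2 : ℝ)‖ = R := by
  unfold leftDisk rightDisk
  rw [frontier_ball _ hR.ne', frontier_ball _ hR.ne', Set.mem_union, Metric.mem_sphere,
    Metric.mem_sphere, dist_toComplex_right, dist_toComplex_right, or_comm]
  push_cast
  rw [show toComplex x - (-(R : ℂ) - δ / 2) = toComplex x + (R + δ / 2) by ring]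

/-- The half-width of the annulus for given radius and distance: `cosh s = 1 + δ / (2 R)`. -/
theorem exists_halfWidth {R δ : ℝ} (hR : 0 < R) (hδ : 0 < δ) :
    ∃ s, 0 < s ∧ R * cosh s = R + δ / 2 := by
  have h1 : 1 < 1 + δ / (2 * R) := by
    have : 0 < δ / (2 * R) := by positivity
    linarith
  refine ⟨arcosh (1 + δ / (2 * R)), arcosh_pos h1, ?_⟩
  rw [cosh_arcosh h1.le]
  field_simp

/-- The Möbius map of the exterior of the two disks onto the annulus; infinity goes to `1`. -/
def toAnnulus (a : ℝ) (z : ℂ) : ℂ := (z + a) / (z - a)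

section geometry

variable {R s : ℝ}

/-- Circles of Apollonius: |z - R cosh s| = R is the locus |z + a| = exp(s)|z - a| with a = R sinh
s. One identity decides the inside, the outside and the circle at once. -/
theorem normSq_identity (R s : ℝ) (z : ℂ) :
    exp (2 * s) * ‖z - (R * sinh s : ℝ)‖ ^ 2 - ‖z + (R * sinh s : ℝ)‖ ^ 2 =
      (exp (2 * s) - 1) * (‖z - (R * cosh s : ℝ)‖ ^ 2 - R ^ 2) := by
  have h1 : sinh s * (exp (2 * s) + 1) = cosh s * (exp (2 * s) - 1) := by
    have : exp (2 * s) = exp s * exp s := by rw [← exp_add]; congr 1; ring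
    have h2 : exp s * exp (-s) = 1 := by rw [← exp_add]; simp
    rw [sinh_eq, cosh_eq, this]
    linear_combination (-exp s) * h2
  have h3 := cosh_sq s
  simp only [← Complex.normSq_eq_norm_sq, Complex.normSq_apply, Complex.sub_re, Complex.sub_im,
    Complex.add_re, Complex.add_im, Complex.ofReal_re, Complex.ofReal_im]
  linear_combination (-2 * z.re * R) * h1 - (exp (2 * s) - 1) * R ^ 2 * h3

theorem normSq_identity' (R s : ℝ) (z : ℂ) :
    exp (2 * s) * ‖z + (R * sinh s : ℝ)‖ ^ 2 - ‖z - (R * sinh s : ℝ)‖ ^ 2 =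
      (exp (2 * s) - 1) * (‖z + (R * cosh s : ℝ)‖ ^ 2 - R ^ 2) := by
  have := normSq_identity R s (-z)
  have e : ∀ w : ℂ, ‖-z - w‖ = ‖z + w‖ := fun w => by rw [← norm_neg]; congr 1; ring
  have e' : ∀ w : ℂ, ‖-z + w‖ = ‖z - w‖ := fun w => by rw [← norm_neg]; congr 1; ring
  rwa [e, e', e] at this

theorem ne_of_le_norm_sub (hR : 0 < R) (hs : 0 < s) {z : ℂ} (hz : R ≤ ‖z - (R * cosh s : ℝ)‖) :
    z ≠ (R * sinh s : ℝ) := by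
  rintro rfl
  have h := normSq_identity R s ((R * sinh s : ℝ) : ℂ)
  rw [sub_self, norm_zero, ← Complex.ofReal_add, Complex.norm_real, norm_eq_abs, sq_abs] at h
  have h1 : 1 < exp (2 * s) := one_lt_exp_iff.2 (by positivity)
  have h2 : 0 < sinh s := sinh_pos_iff.2 hs
  have h3 : R ^ 2 ≤ ‖((R * sinh s : ℝ) : ℂ) - (R * cosh s : ℝ)‖ ^ 2 := by gcongr
  have h4 : 0 < R * sinh s + R * sinh s := by positivity
  nlinarith [pow_pos h4 2]

theorem exp_sq_mul_le_iff {x y : ℝ} (hx : 0 ≤ x) (hy : 0 ≤ y) :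
    y ^ 2 ≤ exp (2 * s) * x ^ 2 ↔ y ≤ exp s * x := by
  have : exp (2 * s) * x ^ 2 = (exp s * x) ^ 2 := by
    rw [mul_pow, ← exp_nat_mul]; norm_num
  rw [this, sq_le_sq₀ hy (by positivity)]

theorem norm_toAnnulus_le_iff (hR : 0 < R) (hs : 0 < s) {z : ℂ} (hz : z ≠ (R * sinh s : ℝ)) :
    ‖toAnnulus (R * sinh s) z‖ ≤ exp s ↔ R ≤ ‖z - (R * cosh s : ℝ)‖ := by
  have h0 : 0 < ‖z - (R * sinh s : ℝ)‖ := norm_pos_iff.2 (sub_ne_zero.2 hz)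
  have h1 : 0 < exp (2 * s) - 1 := by
    have : 1 < exp (2 * s) := one_lt_exp_iff.2 (by positivity)
    linarith
  have h := normSq_identity R s z
  rw [toAnnulus, norm_div, div_le_iff₀ h0, ← exp_sq_mul_le_iff h0.le (norm_nonneg _),
    ← sub_nonneg, h, mul_nonneg_iff_of_pos_left h1, sub_nonneg, sq_le_sq₀ hR.le (norm_nonneg _)]

theorem le_norm_toAnnulus_iff (hR : 0 < R) (hs : 0 < s) {z : ℂ} (hz : z ≠ (R * sinh s : ℝ)) :
    exp (-s) ≤ ‖toAnnulus (R * sinh s) z‖ ↔ R ≤ ‖z + (R * cosh s : ℝ)‖ := by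
  have h0 : 0 < ‖z - (R * sinh s : ℝ)‖ := norm_pos_iff.2 (sub_ne_zero.2 hz)
  have h1 : 0 < exp (2 * s) - 1 := by
    have : 1 < exp (2 * s) := one_lt_exp_iff.2 (by positivity)
    linarith
  have h := normSq_identity' R s z
  rw [toAnnulus, norm_div, le_div_iff₀ h0, exp_neg, inv_mul_le_iff₀ (exp_pos s),
    ← exp_sq_mul_le_iff (norm_nonneg _) h0.le,
    ← sub_nonneg, h, mul_nonneg_iff_of_pos_left h1, sub_nonneg, sq_le_sq₀ hR.le (norm_nonneg _)]

theorem norm_toAnnulus_eq_iff (hR : 0 < R) (hs : 0 < s) {z : ℂ} (hz : z ≠ (R * sinh s : ℝ)) :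
    ‖toAnnulus (R * sinh s) z‖ = exp s ↔ ‖z - (R * cosh s : ℝ)‖ = R := by
  have h0 : 0 < ‖z - (R * sinh s : ℝ)‖ := norm_pos_iff.2 (sub_ne_zero.2 hz)
  have h1 : exp (2 * s) - 1 ≠ 0 := by
    have : 1 < exp (2 * s) := one_lt_exp_iff.2 (by positivity)
    linarith
  have h := normSq_identity R s z
  have h2 : exp (2 * s) * ‖z - (R * sinh s : ℝ)‖ ^ 2 = (exp s * ‖z - (R * sinh s : ℝ)‖) ^ 2 := by
    rw [mul_pow, ← exp_nat_mul]; norm_num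
  rw [h2] at h
  rw [toAnnulus, norm_div, div_eq_iff h0.ne', ← sq_eq_sq₀ (norm_nonneg _) (by positivity), eq_comm,
    ← sub_eq_zero, h, mul_eq_zero_iff_left h1, sub_eq_zero, sq_eq_sq₀ (norm_nonneg _) hR.le]

theorem norm_toAnnulus_eq_neg_iff (hR : 0 < R) (hs : 0 < s) {z : ℂ} (hz : z ≠ (R * sinh s : ℝ)) :
    ‖toAnnulus (R * sinh s) z‖ = exp (-s) ↔ ‖z + (R * cosh s : ℝ)‖ = R := by
  have h0 : 0 < ‖z - (R * sinh s : ℝ)‖ := norm_pos_iff.2 (sub_ne_zero.2 hz)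
  have h1 : exp (2 * s) - 1 ≠ 0 := by
    have : 1 < exp (2 * s) := one_lt_exp_iff.2 (by positivity)
    linarith
  have h := normSq_identity' R s z
  have h2 : exp (2 * s) * ‖z + (R * sinh s : ℝ)‖ ^ 2 = (exp s * ‖z + (R * sinh s : ℝ)‖) ^ 2 := by
    rw [mul_pow, ← exp_nat_mul]; norm_num
  rw [h2] at h
  rw [toAnnulus, norm_div, div_eq_iff h0.ne', exp_neg, eq_inv_mul_iff_mul_eq₀ (exp_pos s).ne',
    ← sq_eq_sq₀ (by positivity) (norm_nonneg _),
    ← sub_eq_zero, h, mul_eq_zero_iff_left h1, sub_eq_zero, sq_eq_sq₀ (norm_nonneg _) hR.le]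

theorem mem_exteriorDomain_iff (hR : 0 < R) (hs : 0 < s) {z : ℂ} :
    z ∈ exteriorDomain R (R * cosh s) ↔
      z ≠ (R * sinh s : ℝ) ∧ toAnnulus (R * sinh s) z ∈ openAnnulus s := by
  constructor
  · rintro ⟨h1, h2⟩
    have hz := ne_of_le_norm_sub hR hs h1.le
    refine ⟨hz, lt_of_le_of_ne ((le_norm_toAnnulus_iff hR hs hz).2 h2.le) fun h => ?_,
      lt_of_le_of_ne ((norm_toAnnulus_le_iff hR hs hz).2 h1.le) fun h => ?_⟩
    · exact h2.ne' ((norm_toAnnulus_eq_neg_iff hR hs hz).1 h.symm)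
    · exact h1.ne' ((norm_toAnnulus_eq_iff hR hs hz).1 h)
  · rintro ⟨hz, h1, h2⟩
    refine ⟨lt_of_le_of_ne ((norm_toAnnulus_le_iff hR hs hz).1 h2.le) fun h => ?_,
      lt_of_le_of_ne ((le_norm_toAnnulus_iff hR hs hz).1 h1.le) fun h => ?_⟩
    · exact h2.ne ((norm_toAnnulus_eq_iff hR hs hz).2 h.symm)
    · exact h1.ne' ((norm_toAnnulus_eq_neg_iff hR hs hz).2 h.symm)

theorem mem_closedAnnulus_of_le (hR : 0 < R) (hs : 0 < s) {z : ℂ}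
    (h1 : R ≤ ‖z - (R * cosh s : ℝ)‖) (h2 : R ≤ ‖z + (R * cosh s : ℝ)‖) :
    toAnnulus (R * sinh s) z ∈ closedAnnulus s := by
  have hz := ne_of_le_norm_sub hR hs h1
  exact ⟨(le_norm_toAnnulus_iff hR hs hz).2 h2, (norm_toAnnulus_le_iff hR hs hz).2 h1⟩

end geometry

theorem toAnnulus_sub_one {a : ℝ} {z : ℂ} (hz : z ≠ a) : toAnnulus a z - 1 = 2 * a / (z - a) := by
  have := sub_ne_zero.2 hz
  unfold toAnnulus
  field_simp
  ring

theorem position_toAnnulus {a : ℝ} (ha : a ≠ 0) {z : ℂ} (hz : z ≠ a) :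
    position (toAnnulus a z) = z / a := by
  have h1 := sub_ne_zero.2 hz
  have h2 : (a : ℂ) ≠ 0 := by exact_mod_cast ha
  have h3 : toAnnulus a z + 1 = 2 * z / (z - a) := by
    unfold toAnnulus; field_simp; ring
  rw [position, toAnnulus_sub_one hz, h3, div_div_div_cancel_right₀ h1]
  field_simp

/-- Writing dt/dz in terms of t keeps all chain rules on the annulus and shows its double zero at t
= 1. -/
theorem hasDerivAt_toAnnulus {a : ℝ} (ha : a ≠ 0) {z : ℂ} (hz : z ≠ a) :
    HasDerivAt (toAnnulus a) (-(toAnnulus a z - 1) ^ 2 / (2 * a)) z := by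
  have h1 := sub_ne_zero.2 hz
  have h2 : (a : ℂ) ≠ 0 := by exact_mod_cast ha
  have h := ((hasDerivAt_id z).add_const (a : ℂ)).div ((hasDerivAt_id z).sub_const (a : ℂ)) h1
  have e : -(toAnnulus a z - 1) ^ 2 / (2 * a) =
      (1 * (id z - a) - (id z + a) * 1) / (id z - a) ^ 2 := by
    rw [toAnnulus_sub_one hz]
    simp only [id_eq]
    field_simp
    ring
  rw [e]
  exact h

end

/-! ### The constructed shear solution: derivatives, boundary values, decay. -/

section
open Filter Topology Real Asymptotics

/-- The derivative of the second Goursat function, as a function on the annulus. -/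
def slopeTwo (s : ℝ) (G : ℤ → ℝ) (t : ℂ) : ℂ :=
  1 - (t - 1) ^ 2 / (2 * t) * (G 0 + laurentSum (fun n => n * remainderCoeff s G n) t)

/-- The complex velocity of the shear solution. -/
def shearVelocity (a s : ℝ) (G : ℤ → ℝ) (z : ℂ) : ℂ :=
  Complex.I * (2 * a * G 0 * (log ‖toAnnulus a z‖ : ℝ) + a * potential G (toAnnulus a z) +
    z * (starRingEnd ℂ) (slope G (toAnnulus a z)) +
    (starRingEnd ℂ) (z + a * remainder s G (toAnnulus a z)))

theorem shearVelocity_eq {a s : ℝ} (ha : a ≠ 0) (G : ℤ → ℝ) {z : ℂ} (hz : z ≠ a) :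
    shearVelocity a s G z = a * annulusVelocity s G (toAnnulus a z) := by
  have h2 : (a : ℂ) ≠ 0 := by exact_mod_cast ha
  unfold shearVelocity annulusVelocity
  rw [position_toAnnulus ha hz]
  simp only [map_add, map_mul, Complex.conj_ofReal, map_div₀]
  field_simp

/-- The preimage of an annulus under `toAnnulus`. -/
def annulusPreimage (a r : ℝ) : Set ℂ := {z | z ≠ a ∧ toAnnulus a z ∈ openAnnulus r}

theorem isOpen_annulusPreimage {a r : ℝ} (ha : a ≠ 0) : IsOpen (annulusPreimage a r) := by
  have hc : ContinuousOn (toAnnulus a) {z : ℂ | z ≠ a} := fun z hz =>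
    (hasDerivAt_toAnnulus ha hz).continuousAt.continuousWithinAt
  exact hc.isOpen_inter_preimage isOpen_ne (isOpen_openAnnulus r)

theorem hasFDerivAt_log_norm {f : ℂ → ℂ} {f' z : ℂ} (hf : HasDerivAt f f' z) (h0 : f z ≠ 0) :
    HasFDerivAt (fun w => ((log ‖f w‖ : ℝ) : ℂ))
      (wirtinger (f' / (2 * f z)) ((starRingEnd ℂ) (f' / (2 * f z)))) z := by
  have h1 := (hasFDerivAt_of_hasDerivAt hf).norm_sq
  have h2 : ‖f z‖ ^ 2 ≠ 0 := pow_ne_zero 2 (norm_ne_zero_iff.2 h0)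
  have h3 := Complex.ofRealCLM.hasFDerivAt.comp z ((h1.log h2).const_mul (1 / 2 : ℝ))
  have e : (fun w => ((log ‖f w‖ : ℝ) : ℂ)) =
      Complex.ofRealCLM ∘ fun w => 1 / 2 * log (‖f w‖ ^ 2) := by
    ext w
    simp only [Function.comp_apply, Complex.ofRealCLM_apply, log_pow]
    congr 1
    push_cast
    ring
  rw [e]
  refine h3.congr_fderiv (ContinuousLinearMap.ext fun h => ?_)
  have h4 : ((‖f z‖ ^ 2 : ℝ) : ℂ) = f z * (starRingEnd ℂ) (f z) := by
    rw [Complex.mul_conj, Complex.normSq_eq_norm_sq]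
  have h5 : (starRingEnd ℂ) (f z) ≠ 0 := by simpa using h0
  have h6 : ((inner ℝ (f z) (f' * h) : ℝ) : ℂ) =
      ((starRingEnd ℂ) (f z) * (f' * h) + f z * (starRingEnd ℂ) (f' * h)) / 2 := by
    rw [Complex.inner]
    have := Complex.re_eq_add_conj (f' * h * (starRingEnd ℂ) (f z))
    rw [this, map_mul, Complex.conj_conj]
    ring
  simp only [ContinuousLinearMap.comp_apply, smul_apply, Complex.ofRealCLM_apply, wirtinger_apply,
    innerSL_apply_apply, smul_eq_mul, zero_mul, add_zero, nsmul_eq_mul]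
  push_cast
  push_cast at h4 h6
  rw [h4, h6, map_div₀, map_mul, map_mul, map_ofNat]
  field_simp

section

variable {a s : ℝ} {G : ℤ → ℝ}

theorem IsShearSeq.differentiableOn_slope (hG : IsShearSeq s G) (hs : 0 < s) :
    DifferentiableOn ℂ (slope G) (openAnnulus (3 / 2 * s)) := by
  have h1 := (hG.expDecay_shearCoeff hs).differentiableOn
  unfold slope
  refine DifferentiableOn.mul ?_ h1
  intro t ht
  have := ne_zero_of_mem_openAnnulus ht
  fun_prop (disch := simpa using this)

/-- The factor n in the coefficients costs some decay rate; 4/3 lies strictly between 1 and 3/2, so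
the domain still contains the closed annulus. -/
theorem IsShearSeq.differentiableOn_slopeTwo (hG : IsShearSeq s G) (hs : 0 < s) :
    DifferentiableOn ℂ (slopeTwo s G) (openAnnulus (4 / 3 * s)) := by
  have h1 := ((hG.expDecay_remainderCoeff hs).intCast_mul
    (by linarith : 4 / 3 * s < 3 / 2 * s)).differentiableOn
  unfold slopeTwo
  refine (differentiableOn_const _).sub (DifferentiableOn.mul ?_ ((differentiableOn_const _).add h1))
  intro t ht
  have := ne_zero_of_mem_openAnnulus ht
  fun_prop (disch := simpa using this)

/-- A Laurent series cannot have G_0/t in its derivative; that term comes from the logarithm in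
`shearVelocity`. -/
theorem IsShearSeq.hasDerivAt_potential (hG : IsShearSeq s G) (hs : 0 < s) {t : ℂ}
    (ht : t ∈ openAnnulus (3 / 2 * s)) :
    HasDerivAt (potential G) ((laurentSum (shearCoeff G) t - G 0) / t) t := by
  have hg := hG.expDecay_shearCoeff hs
  have h := hg.div_intCast.hasDerivAt ht
  suffices e : laurentSum (fun n => n * (shearCoeff G n / n)) t =
      laurentSum (shearCoeff G) t - G 0 by
    rw [e] at h; exact h
  have h1 : HasSum (fun n : ℤ => (if n = 0 then (G 0 : ℂ) else 0)) (G 0) := by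
    simpa using hasSum_ite_eq (0 : ℤ) (G 0 : ℂ)
  have h2 := (hg.summable ht).hasSum.sub h1
  rw [laurentSum, laurentSum, ← h2.tsum_eq]
  congr 1
  ext n
  split_ifs with h
  · subst h; simp [shearCoeff]
  · have : (n : ℂ) ≠ 0 := by exact_mod_cast h
    rw [mul_div_cancel₀ _ this, sub_zero]

theorem hasDerivAt_slope_toAnnulus (hG : IsShearSeq s G) (hs : 0 < s) (ha : a ≠ 0) {z : ℂ}
    (hz : z ∈ annulusPreimage a (3 / 2 * s)) :
    HasDerivAt (fun z => slope G (toAnnulus a z)) (deriv (slope G) (toAnnulus a z) *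
      (-(toAnnulus a z - 1) ^ 2 / (2 * a))) z :=
  ((hG.differentiableOn_slope hs).differentiableAt
    ((isOpen_openAnnulus _).mem_nhds hz.2)).hasDerivAt.comp z (hasDerivAt_toAnnulus ha hz.1)

/-- The Goursat form with P = i `slope` and K = -i `slopeTwo`. Half of the derivative of log|t|
completes `potential` so that its z-derivative is the slope; the other half supplies the G_0 in
`slopeTwo`. -/
theorem hasFDerivAt_shearVelocity (hG : IsShearSeq s G) (hs : 0 < s) (ha : a ≠ 0) {z : ℂ}
    (hz : z ∈ annulusPreimage a (3 / 2 * s)) :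
    HasFDerivAt (shearVelocity a s G)
      (wirtinger (Complex.I * slope G (toAnnulus a z) -
          (starRingEnd ℂ) (Complex.I * slope G (toAnnulus a z)))
        ((starRingEnd ℂ) (-Complex.I * slopeTwo s G (toAnnulus a z)) - z * (starRingEnd ℂ)
          (deriv (fun z => Complex.I * slope G (toAnnulus a z)) z))) z := by
  have ha' : (a : ℂ) ≠ 0 := by exact_mod_cast ha
  have hT := hasDerivAt_toAnnulus ha hz.1
  have ht0 := ne_zero_of_mem_openAnnulus hz.2
  have hsl := hasDerivAt_slope_toAnnulus hG hs ha hz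
  rw [(hsl.const_mul Complex.I).deriv]
  have hpot := (hG.hasDerivAt_potential hs hz.2).comp z hT
  have hrem := ((hG.expDecay_remainderCoeff hs).hasDerivAt hz.2).comp z hT
  have hlog := hasFDerivAt_log_norm hT ht0
  have h := (((hlog.const_mul (2 * a * G 0 : ℂ)).add
    (hasFDerivAt_of_hasDerivAt (hpot.const_mul (a : ℂ)))).add
    ((hasFDerivAt_of_hasDerivAt (hasDerivAt_id z)).mul (hasFDerivAt_conj_of_hasDerivAt hsl))).add
    (hasFDerivAt_conj_of_hasDerivAt ((hasDerivAt_id z).add (hrem.const_mul (a : ℂ))))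
  refine (h.const_mul Complex.I).congr_fderiv (ContinuousLinearMap.ext fun w => ?_)
  set t := toAnnulus a z with ht
  set D := deriv (slope G) t
  have ht0' : (starRingEnd ℂ) t ≠ 0 := by simpa using ht0
  simp only [smul_apply, add_apply,
    wirtinger_apply, smul_eq_mul, zero_mul, add_zero, zero_add, one_mul, id_eq]
  simp only [slope, slopeTwo, map_mul, map_sub, map_add, map_div₀, map_neg, map_pow, map_one,
    map_ofNat, Complex.conj_I, Complex.conj_ofReal]
  field_simp
  ring

theorem shearVelocity_eq_zero_right (hG : IsShearSeq s G) (hs : 0 < s) (ha : a ≠ 0) {z : ℂ}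
    (hz : z ≠ a) (h : ‖toAnnulus a z‖ = exp s) : shearVelocity a s G z = 0 := by
  rw [shearVelocity_eq ha G hz, hG.annulusVelocity_eq_zero hs h, mul_zero]

theorem shearVelocity_eq_zero_left (hG : IsShearSeq s G) (hs : 0 < s) (ha : a ≠ 0) {z : ℂ}
    (hz : z ≠ a) (h : ‖toAnnulus a z‖ = exp (-s)) : shearVelocity a s G z = 0 := by
  have h0 : toAnnulus a z ≠ 0 := norm_pos_iff.1 (by rw [h]; exact exp_pos _)
  have h1 : annulusVelocity s G (toAnnulus a z)⁻¹ = 0 :=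
    hG.annulusVelocity_eq_zero hs (by rw [norm_inv, h, ← exp_neg, neg_neg])
  rw [hG.annulusVelocity_inv h0, neg_eq_zero] at h1
  rw [shearVelocity_eq ha G hz, h1, mul_zero]

end

/-! ### Decay at infinity -/

theorem tendsto_toComplex_cobounded :
    Tendsto toComplex (Bornology.cobounded Plane) (Bornology.cobounded ℂ) := by
  rw [← tendsto_norm_atTop_iff_cobounded]
  simp only [LinearIsometryEquiv.norm_map]
  exact tendsto_norm_cobounded_atTop

theorem tendsto_toComplex_symm_cobounded :
    Tendsto toComplex.symm (Bornology.cobounded ℂ) (Bornology.cobounded Plane) := by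
  rw [← tendsto_norm_atTop_iff_cobounded]
  simp only [LinearIsometryEquiv.norm_map]
  exact tendsto_norm_cobounded_atTop

theorem decayClass_planarField_iff {W : ℂ → ℂ} {Q : ℂ → ℝ} :
    DecayClass (planarField W) (fun x => Q (toComplex x)) ↔
      (∃ c, (fun z => W z - c) =O[Bornology.cobounded ℂ] fun z => ‖z‖⁻¹) ∧
      (fderiv ℝ W =O[Bornology.cobounded ℂ] fun z => (‖z‖ ^ 2)⁻¹) ∧
      (Q =O[Bornology.cobounded ℂ] fun z => (‖z‖ ^ 2)⁻¹) := by
  have hf : ∀ x, ‖fderiv ℝ (planarField W) x‖ = ‖fderiv ℝ W (toComplex x)‖ := by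
    intro x
    refine le_antisymm (ContinuousLinearMap.opNorm_le_bound _ (norm_nonneg _) fun h => ?_)
      (ContinuousLinearMap.opNorm_le_bound _ (norm_nonneg _) fun h => ?_)
    · rw [fderiv_planarField, LinearIsometryEquiv.norm_map]
      simpa using (fderiv ℝ W (toComplex x)).le_opNorm (toComplex h)
    · have h1 := (fderiv ℝ (planarField W) x).le_opNorm (toComplex.symm h)
      simpa [fderiv_planarField] using h1
  constructor
  · rintro ⟨⟨c, h1⟩, h2, h3⟩
    refine ⟨⟨toComplex c, ?_⟩, ?_, ?_⟩
    · refine ((h1.comp_tendsto tendsto_toComplex_symm_cobounded).congr_right fun z => by simp).norm_left.congr_left (fun z => ?_) |>.of_norm_left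
      simp only [Function.comp_apply, planarField, LinearIsometryEquiv.apply_symm_apply]
      rw [← toComplex.norm_map, map_sub, LinearIsometryEquiv.apply_symm_apply]
    · refine ((h2.comp_tendsto tendsto_toComplex_symm_cobounded).congr_right fun z => by simp).norm_left.congr_left (fun z => ?_) |>.of_norm_left
      simp only [Function.comp_apply, hf, LinearIsometryEquiv.apply_symm_apply]
    · refine ((h3.comp_tendsto tendsto_toComplex_symm_cobounded).congr_right fun z => by simp).congr_left (fun z => ?_)
      simp only [Function.comp_apply, LinearIsometryEquiv.apply_symm_apply]
  · rintro ⟨⟨c, h1⟩, h2, h3⟩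
    refine ⟨⟨toComplex.symm c, ?_⟩, ?_, ?_⟩
    · refine ((h1.comp_tendsto tendsto_toComplex_cobounded).congr_right fun z => by simp).norm_left.congr_left (fun z => ?_) |>.of_norm_left
      simp only [Function.comp_apply, planarField]
      rw [← map_sub, LinearIsometryEquiv.norm_map]
    · refine ((h2.comp_tendsto tendsto_toComplex_cobounded).congr_right fun z => by simp).norm_left.congr_left (fun z => ?_) |>.of_norm_left
      simp only [Function.comp_apply, hf]
    · exact (h3.comp_tendsto tendsto_toComplex_cobounded).congr_right fun z => by simp

theorem isBigO_toAnnulus_sub_one (a : ℝ) :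
    (fun z => toAnnulus a z - 1) =O[Bornology.cobounded ℂ] fun z => ‖z‖⁻¹ := by
  refine IsBigO.of_bound (4 * |a|) ?_
  filter_upwards [tendsto_norm_cobounded_atTop.eventually_gt_atTop (2 * |a|),
    tendsto_norm_cobounded_atTop.eventually_gt_atTop 0] with z hz hz0
  have hz' : z ≠ a := by
    rintro rfl
    rw [Complex.norm_real, norm_eq_abs] at hz
    linarith [abs_nonneg a]
  have h1 : ‖z‖ / 2 ≤ ‖z - a‖ := by
    have := norm_sub_norm_le z a
    rw [Complex.norm_real, norm_eq_abs] at this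
    linarith
  rw [toAnnulus_sub_one hz', norm_div, norm_mul, Complex.norm_real, norm_inv, norm_norm,
    norm_eq_abs, div_le_iff₀ (lt_of_lt_of_le (by positivity) h1)]
  have : 4 * |a| * ‖z‖⁻¹ * (‖z‖ / 2) = 2 * |a| := by field_simp; ring
  calc ‖(2 : ℂ)‖ * |a| = 4 * |a| * ‖z‖⁻¹ * (‖z‖ / 2) := by rw [this]; simp
    _ ≤ _ := by gcongr

theorem tendsto_toAnnulus (a : ℝ) : Tendsto (toAnnulus a) (Bornology.cobounded ℂ) (𝓝 1) := by
  have h1 : Tendsto (fun z : ℂ => ‖z‖⁻¹) (Bornology.cobounded ℂ) (𝓝 0) :=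
    tendsto_inv_atTop_zero.comp tendsto_norm_cobounded_atTop
  have h2 := ((isBigO_toAnnulus_sub_one a).trans_tendsto h1).add_const 1
  simpa using h2

theorem one_mem_openAnnulus {r : ℝ} (hr : 0 < r) : (1 : ℂ) ∈ openAnnulus r := by
  constructor
  · rw [norm_one, exp_lt_one_iff]; linarith
  · rw [norm_one, one_lt_exp_iff]; exact hr

theorem eventually_mem_annulusPreimage (a : ℝ) {r : ℝ} (hr : 0 < r) :
    ∀ᶠ z in Bornology.cobounded ℂ, z ∈ annulusPreimage a r := by
  filter_upwards [tendsto_norm_cobounded_atTop.eventually_gt_atTop |a|,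
    (tendsto_toAnnulus a).eventually_mem ((isOpen_openAnnulus r).mem_nhds (one_mem_openAnnulus hr))]
    with z h1 h2
  refine ⟨?_, h2⟩
  rintro rfl
  rw [Complex.norm_real, norm_eq_abs] at h1
  exact lt_irrefl _ h1

section

variable {a s : ℝ} {G : ℤ → ℝ}

theorem isBigO_comp_toAnnulus {E : Type*} [NormedAddCommGroup E] (a : ℝ) {f : ℂ → E}
    (hf : f =O[𝓝 1] fun t => t - 1) :
    (fun z => f (toAnnulus a z)) =O[Bornology.cobounded ℂ] fun z => ‖z‖⁻¹ :=
  (hf.comp_tendsto (tendsto_toAnnulus a)).trans (isBigO_toAnnulus_sub_one a)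

theorem isBigO_sq_comp_toAnnulus {E : Type*} [NormedAddCommGroup E] (a : ℝ) {f : ℂ → E}
    (hf : f =O[𝓝 1] fun t => (t - 1) ^ 2) :
    (fun z => f (toAnnulus a z)) =O[Bornology.cobounded ℂ] fun z => (‖z‖ ^ 2)⁻¹ := by
  have h : (fun z => f (toAnnulus a z)) =O[Bornology.cobounded ℂ] fun z => (‖z‖⁻¹) ^ 2 :=
    (hf.comp_tendsto (tendsto_toAnnulus a)).trans ((isBigO_toAnnulus_sub_one a).pow 2)
  exact h.congr_right fun z => inv_pow _ _

theorem IsShearSeq.slope_isBigO (hG : IsShearSeq s G) (hs : 0 < s) :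
    slope G =O[𝓝 1] fun t => (t - 1) ^ 2 := by
  have h1 := ((hG.expDecay_shearCoeff hs).differentiableOn.differentiableAt
    ((isOpen_openAnnulus _).mem_nhds (one_mem_openAnnulus (by positivity)))).continuousAt
  have h2 : ContinuousAt (fun t : ℂ => -(1 / (2 * t)) * laurentSum (shearCoeff G) t) 1 :=
    ContinuousAt.mul (by fun_prop (disch := simp)) h1
  have h3 := (isBigO_refl (fun t : ℂ => (t - 1) ^ 2) (𝓝 1)).mul (h2.tendsto.isBigO_one ℂ)
  refine h3.congr (fun t => ?_) fun t => mul_one _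
  unfold slope
  ring

theorem IsShearSeq.slopeTwo_isBigO (hG : IsShearSeq s G) (hs : 0 < s) :
    (fun t => slopeTwo s G t - 1) =O[𝓝 1] fun t => (t - 1) ^ 2 := by
  have h1 := (((hG.expDecay_remainderCoeff hs).intCast_mul
    (by linarith : 4 / 3 * s < 3 / 2 * s)).differentiableOn.differentiableAt
    ((isOpen_openAnnulus _).mem_nhds (one_mem_openAnnulus (by positivity)))).continuousAt
  have h2 : ContinuousAt (fun t : ℂ => -(1 / (2 * t)) *
      (G 0 + laurentSum (fun n => n * remainderCoeff s G n) t)) 1 :=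
    ContinuousAt.mul (by fun_prop (disch := simp)) (continuousAt_const.add h1)
  have h3 := (isBigO_refl (fun t : ℂ => (t - 1) ^ 2) (𝓝 1)).mul (h2.tendsto.isBigO_one ℂ)
  refine h3.congr (fun t => ?_) fun t => mul_one _
  unfold slopeTwo
  ring

/-- The slope has a double zero at 1, so its derivative is holomorphic near 1 and vanishes there. -/
theorem IsShearSeq.deriv_slope_isBigO (hG : IsShearSeq s G) (hs : 0 < s) :
    deriv (slope G) =O[𝓝 1] fun t => t - 1 := by
  have hmem := (isOpen_openAnnulus (3 / 2 * s)).mem_nhds (one_mem_openAnnulus (by positivity))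
  have h1 : DifferentiableAt ℂ (deriv (slope G)) 1 :=
    ((hG.differentiableOn_slope hs).deriv (isOpen_openAnnulus _)).differentiableAt hmem
  have h2 : deriv (slope G) 1 = 0 := by
    have h3 := (hG.slope_isBigO hs)
    have h4 : HasDerivAt (slope G) 0 1 := by
      rw [hasDerivAt_iff_isLittleO]
      have h5 : slope G 1 = 0 := by simp [slope]
      simp only [h5, sub_zero, smul_zero]
      refine h3.trans_isLittleO ?_
      have := (isLittleO_pow_id (𝕜 := ℂ) one_lt_two).comp_tendsto
        (show Tendsto (fun t : ℂ => t - 1) (𝓝 1) (𝓝 0) from by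
          have h : Continuous fun t : ℂ => t - 1 := by fun_prop
          simpa using h.tendsto 1)
      exact this
    exact h4.deriv
  simpa [h2] using h1.isBigO_sub

/-- The shear velocity differs from the background flow by a decaying field. -/
theorem shearVelocity_decay (hG : IsShearSeq s G) (hs : 0 < s) (ha : a ≠ 0) :
    ((fun z => shearVelocity a s G z - Complex.I * (starRingEnd ℂ) z) =O[Bornology.cobounded ℂ]
      fun z => ‖z‖⁻¹) ∧
    (fderiv ℝ (fun z => shearVelocity a s G z - Complex.I * (starRingEnd ℂ) z)
      =O[Bornology.cobounded ℂ] fun z => (‖z‖ ^ 2)⁻¹) := by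
  have hmem := (isOpen_openAnnulus (3 / 2 * s)).mem_nhds (one_mem_openAnnulus (by positivity))
  have hid : (fun z : ℂ => z) =O[Bornology.cobounded ℂ] fun z => ‖z‖ := (isBigO_refl _ _).norm_right
  have hcancel : (fun z : ℂ => ‖z‖ * (‖z‖ ^ 2)⁻¹) =O[Bornology.cobounded ℂ] fun z => ‖z‖⁻¹ := by
    refine IsBigO.of_bound 1 (Eventually.of_forall fun z => le_of_eq ?_)
    rcases eq_or_ne ‖z‖ 0 with h | h
    · simp [h]
    · rw [one_mul]; congr 1; field_simp
  constructor
  · have h1 : (fun t : ℂ => ((log ‖t‖ : ℝ) : ℂ)) =O[𝓝 1] fun t => t - 1 := by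
      have := (hasFDerivAt_log_norm (hasDerivAt_id (1 : ℂ)) one_ne_zero).isBigO_sub
      simpa using this
    have h2 : potential G =O[𝓝 1] fun t => t - 1 := by
      have h := ((hG.expDecay_shearCoeff hs).div_intCast.differentiableOn.differentiableAt
        hmem).isBigO_sub
      -- Odd under t ↦ 1/t, hence zero at the fixed point 1; the same holds for the remainder. So
      -- the constant velocity at infinity is zero for this solution.
      have h0 : potential G 1 = 0 := by
        have := hG.potential_inv 1
        rw [inv_one] at this
        exact self_eq_neg.1 this
      change (fun t => potential G t - potential G 1) =O[𝓝 1] _ at h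
      simpa [h0] using h
    have h3 : remainder s G =O[𝓝 1] fun t => t - 1 := by
      have h := ((hG.expDecay_remainderCoeff hs).differentiableOn.differentiableAt hmem).isBigO_sub
      have h0 : remainder s G 1 = 0 := by
        have := remainder_inv s G 1
        rw [inv_one] at this
        exact self_eq_neg.1 this
      change (fun t => remainder s G t - remainder s G 1) =O[𝓝 1] _ at h
      simpa [h0] using h
    have h4 : (fun z => z * (starRingEnd ℂ) (slope G (toAnnulus a z))) =O[Bornology.cobounded ℂ]
        fun z => ‖z‖⁻¹ := by
      refine IsBigO.trans (hid.mul (g₂ := fun z => (‖z‖ ^ 2)⁻¹) ?_) hcancel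
      have := isBigO_sq_comp_toAnnulus a (hG.slope_isBigO hs)
      refine this.norm_left.congr_left (fun z => ?_) |>.of_norm_left
      rw [RCLike.norm_conj]
    have h5 : (fun z => (starRingEnd ℂ) (a * remainder s G (toAnnulus a z)))
        =O[Bornology.cobounded ℂ] fun z => ‖z‖⁻¹ := by
      have := (isBigO_comp_toAnnulus a h3).const_mul_left (a : ℂ)
      refine this.norm_left.congr_left (fun z => ?_) |>.of_norm_left
      rw [RCLike.norm_conj]
    have h := ((((isBigO_comp_toAnnulus a h1).const_mul_left (2 * a * G 0 : ℂ)).add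
      ((isBigO_comp_toAnnulus a h2).const_mul_left (a : ℂ))).add (h4.add h5)).const_mul_left
      Complex.I
    refine h.congr_left fun z => ?_
    unfold shearVelocity
    rw [map_add]
    ring
  · have e : fderiv ℝ (fun z => shearVelocity a s G z - Complex.I * (starRingEnd ℂ) z)
        =ᶠ[Bornology.cobounded ℂ] fun z => wirtinger (Complex.I * slope G (toAnnulus a z) -
          (starRingEnd ℂ) (Complex.I * slope G (toAnnulus a z)))
        (Complex.I * (starRingEnd ℂ) (slopeTwo s G (toAnnulus a z) - 1) +
          z * (starRingEnd ℂ) (Complex.I * (deriv (slope G) (toAnnulus a z) *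
            ((toAnnulus a z - 1) ^ 2 / (2 * a))))) := by
      filter_upwards [eventually_mem_annulusPreimage a (by positivity : 0 < 3 / 2 * s)] with z hz
      have h1 := hasFDerivAt_shearVelocity hG hs ha hz
      rw [((hasDerivAt_slope_toAnnulus hG hs ha hz).const_mul Complex.I).deriv] at h1
      have h2 := (hasFDerivAt_conj_of_hasDerivAt (hasDerivAt_id z)).const_mul Complex.I
      refine (HasFDerivAt.fderiv ((h1.sub h2).congr_fderiv
        (ContinuousLinearMap.ext fun w => ?_)))
      simp only [smul_apply, sub_apply, wirtinger_apply, smul_eq_mul, map_mul, map_sub, map_one,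
        map_neg, Complex.conj_I, map_div₀, zero_mul, zero_add]
      ring
    refine IsBigO.congr' ?_ e.symm EventuallyEq.rfl
    have hsl := isBigO_sq_comp_toAnnulus a (hG.slope_isBigO hs)
    have h1 := hsl.const_mul_left Complex.I
    have h2 := (isBigO_sq_comp_toAnnulus a (hG.slopeTwo_isBigO hs)).const_mul_left Complex.I
    -- The growing factor z is paid for by the simple zero of the derivative of the slope at t = 1;
    -- the factor (t - 1)² gives the rate.
    have h3 : (fun z => z * (Complex.I * (deriv (slope G) (toAnnulus a z) *
            ((toAnnulus a z - 1) ^ 2 / (2 * a))))) =O[Bornology.cobounded ℂ]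
            fun z => (‖z‖ ^ 2)⁻¹ := by
      have h4 := isBigO_comp_toAnnulus a (hG.deriv_slope_isBigO hs)
      have h5 : (fun z => (toAnnulus a z - 1) ^ 2) =O[Bornology.cobounded ℂ]
          fun z => (‖z‖ ^ 2)⁻¹ :=
        isBigO_sq_comp_toAnnulus a (f := fun t => (t - 1) ^ 2) (isBigO_refl _ _)
      have h6 := hid.mul ((h4.mul h5).const_mul_left (Complex.I / (2 * a)))
      refine (h6.congr_left fun z => by ring).trans ?_
      refine IsBigO.of_bound 1 (Eventually.of_forall fun z => le_of_eq ?_)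
      rcases eq_or_ne ‖z‖ 0 with h | h
      · simp [h]
      · rw [one_mul]; congr 1; field_simp
    have h := (h1.norm_left.add h1.norm_left).add (h2.norm_left.add h3.norm_left)
    refine IsBigO.trans (IsBigO.of_bound 1 (Eventually.of_forall fun z => ?_)) h
    rw [one_mul]
    refine (norm_wirtinger_le _ _).trans (le_trans ?_ (le_abs_self _))
    refine add_le_add ((norm_sub_le _ _).trans (le_of_eq ?_)) ((norm_add_le _ _).trans (le_of_eq ?_))
    · rw [RCLike.norm_conj]
    · simp only [norm_mul, RCLike.norm_conj]

/-- The pair constructed from the coefficients is a no-slip shear solution. -/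
theorem isNoSlipShearSolution_shear {μ R δ : ℝ} (hG : IsShearSeq s G) (hR : 0 < R) (hs : 0 < s)
    (hc : R * cosh s = R + δ / 2) :
    IsNoSlipShearSolution μ R δ (planarField (shearVelocity (R * sinh s) s G))
      (fun x => -4 * μ * (Complex.I * slope G (toAnnulus (R * sinh s) (toComplex x))).re) := by
  have ha : R * sinh s ≠ 0 := (mul_pos hR (sinh_pos_iff.2 hs)).ne'
  set b := R * sinh s with hb
  have hsub : ∀ z : ℂ, R ≤ ‖z - (R * cosh s : ℝ)‖ → R ≤ ‖z + (R * cosh s : ℝ)‖ →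
      z ∈ annulusPreimage b (4 / 3 * s) := fun z h1 h2 =>
    ⟨ne_of_le_norm_sub hR hs h1,
      closedAnnulus_subset_openAnnulus (by linarith) (mem_closedAnnulus_of_le hR hs h1 h2)⟩
  have hsub' : annulusPreimage b (4 / 3 * s) ⊆ annulusPreimage b (3 / 2 * s) := fun z hz =>
    ⟨hz.1, openAnnulus_mono (by linarith) hz.2⟩
  have hT : DifferentiableOn ℂ (toAnnulus b) (annulusPreimage b (4 / 3 * s)) := fun z hz =>
    (hasDerivAt_toAnnulus ha hz.1).differentiableAt.differentiableWithinAt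
  have hflow : IsStokesFlow μ (toComplex ⁻¹' annulusPreimage b (4 / 3 * s))
      (planarField (shearVelocity b s G))
      (fun x => -4 * μ * (Complex.I * slope G (toAnnulus b (toComplex x))).re) :=
    isStokesFlow_of_goursat (isOpen_annulusPreimage ha)
      (P := fun z => Complex.I * slope G (toAnnulus b z))
      (K := fun z => -Complex.I * slopeTwo s G (toAnnulus b z))
      (((hG.differentiableOn_slope hs).comp hT fun z hz => (hsub' hz).2).const_mul _)
      (((hG.differentiableOn_slopeTwo hs).comp hT fun z hz => hz.2).const_mul _)
      fun z hz => hasFDerivAt_shearVelocity hG hs ha (hsub' hz)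
  have hdom : fluidDomain R δ ⊆ toComplex ⁻¹' annulusPreimage b (4 / 3 * s) := by
    rw [fluidDomain_eq hR, ← hc]
    exact fun x hx => hsub _ hx.1.le hx.2.le
  -- The construction is smooth on a neighbourhood of the closed fluid domain, so continuity up to
  -- the boundary needs no separate argument.
  have hclos : closure (fluidDomain R δ) ⊆ toComplex ⁻¹' annulusPreimage b (4 / 3 * s) := by
    intro x hx
    have := closure_fluidDomain_subset hR hx
    rw [← hc] at this
    exact hsub _ this.1 this.2
  refine ⟨⟨hflow.1.mono hdom, hflow.2.mono hdom, fun x hx => hflow.3 x (hdom hx),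
    fun x hx => hflow.4 x (hdom hx)⟩, hflow.1.continuousOn.mono hclos, fun x hx => ?_, ?_⟩
  · have e : shearVelocity b s G (toComplex x) = 0 := by
      rw [mem_frontier_disks_iff hR, ← hc] at hx
      rcases hx with h | h
      · have hz := ne_of_le_norm_sub hR hs h.ge
        exact shearVelocity_eq_zero_right hG hs ha hz ((norm_toAnnulus_eq_iff hR hs hz).2 h)
      · have hz : toComplex x ≠ b := by
          intro h0
          rw [h0, ← Complex.ofReal_add, Complex.norm_real, norm_eq_abs] at h
          have h1 : 0 < sinh s := sinh_pos_iff.2 hs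
          have h2 : 1 ≤ cosh s := one_le_cosh s
          rw [abs_of_nonneg (by positivity), hb] at h
          nlinarith
        exact shearVelocity_eq_zero_left hG hs ha hz ((norm_toAnnulus_eq_neg_iff hR hs hz).2 h)
    simp [planarField, e]
  · have e : (fun x => planarField (shearVelocity b s G) x - shearFlow x) =
        planarField (fun z => shearVelocity b s G z - Complex.I * (starRingEnd ℂ) z) := by
      ext x i
      fin_cases i <;> simp [planarField, shearFlow, toComplex_symm_zero, toComplex_symm_one,
        toComplex_re, toComplex_im]
    rw [e, decayClass_planarField_iff (Q := fun z => -4 * μ * (Complex.I * slope G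
      (toAnnulus b z)).re)]
    have h := shearVelocity_decay hG hs ha
    refine ⟨⟨0, by simpa using h.1⟩, h.2, ?_⟩
    have hsl := isBigO_sq_comp_toAnnulus b (hG.slope_isBigO hs)
    refine IsBigO.trans (IsBigO.of_bound 1 (Eventually.of_forall fun z => ?_))
      (hsl.norm_left.const_mul_left (4 * |μ|))
    rw [norm_mul, norm_mul, norm_mul, norm_mul, one_mul, norm_norm, norm_neg]
    simp only [norm_eq_abs, abs_abs, RCLike.norm_ofNat]
    gcongr
    refine (Complex.abs_re_le_norm _).trans ?_
    simp

end

end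

/-! ### Bounds for pressure and strain uniform in the gap. -/

section
open Filter Topology Real

section

variable {s a : ℝ} {G : ℤ → ℝ}

theorem secondDiff_shearCoeff (G : ℤ → ℝ) (n : ℤ) :
    secondDiff (shearCoeff G) n = ((secondDiff G n : ℝ) : ℂ) := by
  unfold secondDiff shearCoeff
  push_cast
  ring

theorem IsShearSeq.norm_secondDiff_le (hG : IsShearSeq s G) (hs : 0 < s) (n : ℤ) :
    ‖secondDiff (shearCoeff G) n‖ ≤ 296 * exp (8 * s) * s * exp (-(3 / 2 * s * |(n : ℝ)|)) := by
  have e : exp (8 * s) = exp (2 * s) ^ 4 := by rw [← exp_nat_mul]; congr 1; push_cast; ring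
  rw [secondDiff_shearCoeff, Complex.norm_real, norm_eq_abs, e]
  exact hG.abs_secondDiff_le hs n

theorem IsShearSeq.slope_eq_laurentSum (hG : IsShearSeq s G) (hs : 0 < s) {t : ℂ}
    (ht : t ∈ openAnnulus (3 / 2 * s)) :
    slope G t = -(1 / 2) * laurentSum (secondDiff (shearCoeff G)) t := by
  rw [laurentSum_secondDiff (by positivity) (hG.expDecay_shearCoeff hs) ht]
  have := ne_zero_of_mem_openAnnulus ht
  unfold slope
  field_simp

/-- On |t| ≤ exp(s) the terms decay at the remaining rate s/2, whose sum of order 1/s cancels the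
factor s in the coefficients. -/
theorem IsShearSeq.norm_slope_le (hG : IsShearSeq s G) (hs : 0 < s) {t : ℂ}
    (ht : t ∈ closedAnnulus s) : ‖slope G t‖ ≤ 592 * exp (9 * s) := by
  rw [hG.slope_eq_laurentSum hs (closedAnnulus_subset_openAnnulus (by linarith) ht), norm_mul]
  have h := norm_laurentSum_le (by linarith : s < 3 / 2 * s) (hG.norm_secondDiff_le hs) ht
  have e : 3 / 2 * s - s = s / 2 := by ring
  rw [e] at h
  have h1 : ‖(-(1 / 2) : ℂ)‖ = 1 / 2 := by rw [norm_neg]; norm_num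
  have h2 : exp (8 * s) * exp (s / 2) ≤ exp (9 * s) := by
    rw [← exp_add, exp_le_exp]; linarith
  have h3 : 296 * exp (8 * s) * s * (2 * exp (s / 2) / (s / 2)) =
      1184 * (exp (8 * s) * exp (s / 2)) := by field_simp; ring
  rw [h1]
  linarith

/-- The extra factor n is bounded by (4/s) exp(s|n|/4): differentiation costs exactly one more power
of 1/s. -/
theorem IsShearSeq.norm_deriv_slope_le (hG : IsShearSeq s G) (hs : 0 < s) {t : ℂ}
    (ht : t ∈ closedAnnulus s) : s * ‖deriv (slope G) t‖ ≤ 4736 * exp (10 * s) := by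
  have hd : ExpDecay (3 / 2 * s) (secondDiff (shearCoeff G)) := ⟨_, hG.norm_secondDiff_le hs⟩
  have hto := closedAnnulus_subset_openAnnulus (by linarith : s < 3 / 2 * s) ht
  have ht0 := ne_zero_of_mem_closedAnnulus ht
  have h1 : deriv (slope G) t =
      -(1 / 2) * (laurentSum (fun n => n * secondDiff (shearCoeff G) n) t / t) := by
    refine HasDerivAt.deriv (((hd.hasDerivAt hto).const_mul (-(1 / 2))).congr_of_eventuallyEq ?_)
    filter_upwards [(isOpen_openAnnulus _).mem_nhds hto] with w hw
    exact hG.slope_eq_laurentSum hs hw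
  have h2 : ∀ n : ℤ, ‖(n : ℂ) * secondDiff (shearCoeff G) n‖ ≤
      1184 * exp (8 * s) * exp (-(5 / 4 * s * |(n : ℝ)|)) := by
    intro n
    rw [norm_mul, Complex.norm_intCast]
    have h3 := abs_mul_exp_le (by positivity : 0 < s / 4) (n : ℝ)
    have h4 := mul_le_mul h3 (hG.norm_secondDiff_le hs n) (norm_nonneg _) (by positivity)
    have h5 : exp (s / 4 * |(n : ℝ)|) * exp (-(3 / 2 * s * |(n : ℝ)|)) =
        exp (-(5 / 4 * s * |(n : ℝ)|)) := by rw [← exp_add]; congr 1; ring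
    refine h4.trans_eq ?_
    rw [← h5]
    field_simp
    ring
  have h := norm_laurentSum_le (by linarith : s < 5 / 4 * s) h2 ht
  have e : 5 / 4 * s - s = s / 4 := by ring
  rw [e] at h
  have h6 : ‖t‖⁻¹ ≤ exp s := by
    rw [inv_le_comm₀ (norm_pos_iff.2 ht0) (exp_pos _), ← exp_neg]; exact ht.1
  have h7 : ‖(-(1 / 2) : ℂ)‖ = 1 / 2 := by rw [norm_neg]; norm_num
  rw [h1, norm_mul, norm_div, h7, div_eq_mul_inv ‖laurentSum _ t‖]
  have h8 := mul_le_mul h h6 (by positivity) (by positivity)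
  have h9 : exp (8 * s) * exp (s / 4) * exp s ≤ exp (10 * s) := by
    rw [← exp_add, ← exp_add, exp_le_exp]; linarith
  have h10 : s * (1184 * exp (8 * s) * (2 * exp (s / 4) / (s / 4)) * exp s) =
      9472 * (exp (8 * s) * exp (s / 4) * exp s) := by field_simp; ring
  have h11 := mul_le_mul_of_nonneg_left h8 hs.le
  linarith

/-- The second Wirtinger derivative of the shear velocity, up to a unit factor and conjugation,
as a function on the annulus. -/
def conjStrain (s : ℝ) (G : ℤ → ℝ) (t : ℂ) : ℂ :=
  slopeTwo s G t - (starRingEnd ℂ) (position t) * ((t - 1) ^ 2 / 2 * deriv (slope G) t)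

/-- The analytic part of `conjStrain`. -/
def analyticStrain (s : ℝ) (G : ℤ → ℝ) (t : ℂ) : ℂ :=
  slopeTwo s G t -
    (exp (2 * s) + t) / (exp (2 * s) - t) * ((t - 1) ^ 2 / 2 * deriv (slope G) t)

/-- The factor z = a · position and the 1/a in dt/dz cancel, so the size of the strain depends on s,
G and t but not on the scale a. -/
theorem norm_wirtinger_snd_shearVelocity (hG : IsShearSeq s G) (hs : 0 < s) (ha : a ≠ 0) {z : ℂ}
    (hz : z ∈ annulusPreimage a (3 / 2 * s)) :
    ‖(starRingEnd ℂ) (-Complex.I * slopeTwo s G (toAnnulus a z)) - z * (starRingEnd ℂ)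
      (deriv (fun z => Complex.I * slope G (toAnnulus a z)) z)‖ =
      ‖conjStrain s G (toAnnulus a z)‖ := by
  have ha' : (a : ℂ) ≠ 0 := by exact_mod_cast ha
  rw [((hasDerivAt_slope_toAnnulus hG hs ha hz).const_mul Complex.I).deriv, conjStrain,
    position_toAnnulus ha hz.1, ← RCLike.norm_conj]
  have e : (starRingEnd ℂ) ((starRingEnd ℂ) (-Complex.I * slopeTwo s G (toAnnulus a z)) -
      z * (starRingEnd ℂ) (Complex.I * (deriv (slope G) (toAnnulus a z) *
        (-(toAnnulus a z - 1) ^ 2 / (2 * a))))) = -Complex.I * (slopeTwo s G (toAnnulus a z) -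
      (starRingEnd ℂ) (z / a) * ((toAnnulus a z - 1) ^ 2 / 2 * deriv (slope G) (toAnnulus a z))) := by
    simp only [map_sub, map_mul, Complex.conj_conj, map_div₀, Complex.conj_ofReal]
    field_simp
    ring
  rw [e, norm_mul, norm_neg, Complex.norm_I, one_mul]

theorem exp_two_sub_ne_zero (hs : 0 < s) {t : ℂ} (ht : t ∈ openAnnulus (4 / 3 * s)) :
    (exp (2 * s) : ℂ) - t ≠ 0 := by
  intro h
  have h1 : ‖t‖ = exp (2 * s) := by
    rw [← sub_eq_zero.1 h, Complex.norm_real, norm_eq_abs, abs_of_pos (exp_pos _)]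
  have := ht.2
  rw [h1, exp_lt_exp] at this
  linarith

/-- With Q = exp(2s), |t - 1| ≤ |Q - t| + (Q - 1), where Q - 1 = (exp(s) - 1)(exp(s) + 1) is at most
twice exp(s)(exp(s) - 1) ≤ |Q - t|. -/
theorem norm_sub_one_le (hs : 0 < s) {t : ℂ} (ht : t ∈ closedAnnulus s) :
    ‖t - 1‖ ≤ 3 * ‖(exp (2 * s) : ℂ) - t‖ := by
  have e : exp (2 * s) = exp s * exp s := by rw [← exp_add]; congr 1; ring
  have h1 : exp (2 * s) - exp s ≤ ‖(exp (2 * s) : ℂ) - t‖ := by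
    have := norm_sub_norm_le (exp (2 * s) : ℂ) t
    rw [Complex.norm_real, norm_eq_abs, abs_of_pos (exp_pos _)] at this
    linarith [ht.2]
  have h2 : ‖t - 1‖ ≤ ‖(exp (2 * s) : ℂ) - t‖ + (exp (2 * s) - 1) := by
    have h3 : 1 ≤ exp (2 * s) := one_le_exp (by positivity)
    have h4 : t - 1 = -((exp (2 * s) : ℂ) - t) + ((exp (2 * s) - 1 : ℝ) : ℂ) := by
      push_cast; ring
    rw [h4]
    refine (norm_add_le _ _).trans (le_of_eq ?_)
    rw [norm_neg, Complex.norm_real, norm_eq_abs, abs_of_nonneg (by linarith)]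
  have h5 : 1 ≤ exp s := one_le_exp hs.le
  nlinarith

/-- On |t|² = Q = exp(2s) the conjugated position equals (Q + t)/(Q - t). Elsewhere in the annulus
the discrepancy carries the factor Q - |t|² = O(s), which absorbs the 1/s in the bound for the
derivative of the slope; `norm_sub_one_le` controls the remaining quotient. -/
theorem norm_conjStrain_sub_le (hG : IsShearSeq s G) (hs : 0 < s) {t : ℂ}
    (ht : t ∈ closedAnnulus s) (h1 : t ≠ 1) :
    ‖conjStrain s G t - analyticStrain s G t‖ ≤ 56832 * exp (12 * s) := by
  have hQ := exp_two_sub_ne_zero hs (closedAnnulus_subset_openAnnulus (by linarith) ht)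
  have hc : (starRingEnd ℂ) t - 1 ≠ 0 := by
    intro h
    have := congrArg (starRingEnd ℂ) (sub_eq_zero.1 h)
    rw [Complex.conj_conj, map_one] at this
    exact h1 this
  have hn : t * (starRingEnd ℂ) t = ((‖t‖ ^ 2 : ℝ) : ℂ) := by
    rw [Complex.mul_conj, Complex.normSq_eq_norm_sq]
  have e : conjStrain s G t - analyticStrain s G t =
      -(((exp (2 * s) - ‖t‖ ^ 2 : ℝ) : ℂ) * ((t - 1) ^ 2 / ((starRingEnd ℂ) t - 1)) *
        (deriv (slope G) t / ((exp (2 * s) : ℂ) - t))) := by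
    rw [Complex.ofReal_sub, ← hn]
    unfold conjStrain analyticStrain position
    simp only [map_div₀, map_add, map_sub, map_one]
    field_simp
    ring
  have hc' : ‖(starRingEnd ℂ) t - 1‖ = ‖t - 1‖ := by
    rw [← RCLike.norm_conj]; simp
  have ht1 : 0 < ‖t - 1‖ := norm_pos_iff.2 (sub_ne_zero.2 h1)
  have hQ' := norm_pos_iff.2 hQ
  have hle : ‖t‖ ^ 2 ≤ exp (2 * s) := by
    have : exp (2 * s) = exp s ^ 2 := by rw [← exp_nat_mul]; norm_num
    rw [this]
    exact pow_le_pow_left₀ (norm_nonneg _) ht.2 2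
  have hge : exp (2 * s) - ‖t‖ ^ 2 ≤ 4 * s * exp (2 * s) := by
    have h2 : exp (-(2 * s)) ≤ ‖t‖ ^ 2 := by
      have : exp (-(2 * s)) = exp (-s) ^ 2 := by rw [← exp_nat_mul]; congr 1; push_cast; ring
      rw [this]
      exact pow_le_pow_left₀ (exp_pos _).le ht.1 2
    have h3 := add_one_le_exp (-(4 * s))
    have h4 : exp (-(2 * s)) = exp (-(4 * s)) * exp (2 * s) := by
      rw [← exp_add]; congr 1; ring
    have h5 := mul_le_mul_of_nonneg_right h3 (exp_pos (2 * s)).le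
    linarith
  have h6 : ‖conjStrain s G t - analyticStrain s G t‖ =
      (exp (2 * s) - ‖t‖ ^ 2) * (‖t - 1‖ / ‖(exp (2 * s) : ℂ) - t‖) * ‖deriv (slope G) t‖ := by
    rw [e, norm_neg, norm_mul, norm_mul, norm_div, norm_div, norm_pow, hc', Complex.norm_real,
      norm_eq_abs, abs_of_nonneg (sub_nonneg.2 hle)]
    field_simp
  have h7 : ‖t - 1‖ / ‖(exp (2 * s) : ℂ) - t‖ ≤ 3 := (div_le_iff₀ hQ').2 (norm_sub_one_le hs ht)
  have h8 : exp (2 * s) * exp (10 * s) = exp (12 * s) := by rw [← exp_add]; congr 1; ring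
  calc _ ≤ 4 * s * exp (2 * s) * 3 * ‖deriv (slope G) t‖ := by
        rw [h6]
        gcongr
    _ = 12 * exp (2 * s) * (s * ‖deriv (slope G) t‖) := by ring
    _ ≤ 12 * exp (2 * s) * (4736 * exp (10 * s)) := by
        exact mul_le_mul_of_nonneg_left (hG.norm_deriv_slope_le hs ht) (by positivity)
    _ = _ := by rw [← h8]; ring

theorem hasDerivAt_position {t : ℂ} (ht : t ≠ 1) :
    HasDerivAt position (-2 / (t - 1) ^ 2) t := by
  have h1 := sub_ne_zero.2 ht
  refine (((hasDerivAt_id t).add_const 1).div ((hasDerivAt_id t).sub_const 1) h1).congr_deriv ?_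
  simp only [id]
  ring

theorem position_ne_one (t : ℂ) : position t ≠ 1 := by
  unfold position
  rcases eq_or_ne t 1 with rfl | h
  · simp
  · have := sub_ne_zero.2 h
    rw [Ne, div_eq_one_iff_eq this]
    intro h'
    have : (2 : ℂ) = 0 := by linear_combination h'
    norm_num at this

theorem toAnnulus_mul_position (ha : a ≠ 0) {t : ℂ} (ht : t ≠ 1) :
    toAnnulus a (a * position t) = t := by
  have h1 := sub_ne_zero.2 ht
  have ha' : (a : ℂ) ≠ 0 := by exact_mod_cast ha
  unfold toAnnulus position
  have h2 : (a : ℂ) * ((t + 1) / (t - 1)) - a = 2 * a / (t - 1) := by field_simp; ring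
  have h3 : (a : ℂ) * ((t + 1) / (t - 1)) + a = 2 * a * t / (t - 1) := by field_simp; ring
  rw [h2, h3]
  field_simp

theorem mul_position_mem_annulusPreimage (ha : a ≠ 0) {t : ℂ} (ht : t ≠ 1) {r : ℝ}
    (hr : t ∈ openAnnulus r) : (a : ℂ) * position t ∈ annulusPreimage a r := by
  have ha' : (a : ℂ) ≠ 0 := by exact_mod_cast ha
  refine ⟨fun h => position_ne_one t ?_, ?_⟩
  · exact mul_left_cancel₀ ha' (by rw [h, mul_one])
  · rw [toAnnulus_mul_position ha ht]; exact hr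

/-- If a map vanishes on the image of a circle, then its two Wirtinger derivatives have the same
modulus there. -/
theorem norm_wirtinger_eq_of_circle {U : ℂ → ℂ} {A B t : ℂ} (ha : a ≠ 0) (ht : t ≠ 1)
    (ht0 : t ≠ 0) (hU : HasFDerivAt U (wirtinger A B) (a * position t))
    (h0 : ∀ w : ℂ, ‖w‖ = ‖t‖ → w ≠ 1 → U (a * position w) = 0) : ‖B‖ = ‖A‖ := by
  have ha' : (a : ℂ) ≠ 0 := by exact_mod_cast ha
  have h1 := sub_ne_zero.2 ht
  have hc : HasDerivAt (fun θ : ℝ => t * Complex.exp (θ * Complex.I)) (t * Complex.I) 0 := by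
    have h2 := ((Complex.ofRealCLM.hasDerivAt (x := (0 : ℝ))).mul_const Complex.I).cexp.const_mul t
    simpa using h2
  have hp : HasDerivAt (fun θ : ℝ => (a : ℂ) * position (t * Complex.exp (θ * Complex.I)))
      (a * (-2 / (t - 1) ^ 2 * (t * Complex.I))) 0 := by
    refine HasDerivAt.const_mul (a : ℂ) ?_
    have h3 := hasDerivAt_position ht
    have h4 : HasDerivAt position (-2 / (t - 1) ^ 2)
        ((fun θ : ℝ => t * Complex.exp (θ * Complex.I)) 0) := by simpa using h3
    exact h4.comp 0 hc
  set v := (a : ℂ) * (-2 / (t - 1) ^ 2 * (t * Complex.I)) with hv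
  have hv0 : v ≠ 0 := by
    rw [hv]
    refine mul_ne_zero ha' (mul_ne_zero (div_ne_zero (by norm_num) (pow_ne_zero 2 h1))
      (mul_ne_zero ht0 Complex.I_ne_zero))
  have hz : HasDerivAt (fun θ : ℝ => U (a * position (t * Complex.exp (θ * Complex.I))))
      (wirtinger A B v) 0 := by
    have h4 : HasFDerivAt U (wirtinger A B)
        ((fun θ : ℝ => (a : ℂ) * position (t * Complex.exp (θ * Complex.I))) 0) := by simpa using hU
    exact h4.comp_hasDerivAt 0 hp
  have hz0 : HasDerivAt (fun θ : ℝ => U (a * position (t * Complex.exp (θ * Complex.I)))) 0 0 := by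
    refine (hasDerivAt_const (0 : ℝ) (0 : ℂ)).congr_of_eventuallyEq ?_
    have h5 : ∀ᶠ θ : ℝ in 𝓝 0, t * Complex.exp (θ * Complex.I) ≠ 1 :=
      hc.continuousAt.eventually_ne (by simpa using ht)
    filter_upwards [h5] with θ hθ
    exact h0 _ (by rw [norm_mul, Complex.norm_exp_ofReal_mul_I, mul_one]) hθ
  -- The derivative of U along the circle is A v + B conj v for the tangent v, and it is zero
  -- because U vanishes there.
  have h6 := hz.unique hz0
  rw [wirtinger_apply] at h6
  have h7 : ‖A * v‖ = ‖B * (starRingEnd ℂ) v‖ := by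
    rw [eq_neg_of_add_eq_zero_left h6, norm_neg]
  rw [norm_mul A, norm_mul B, RCLike.norm_conj] at h7
  exact (mul_right_cancel₀ (norm_ne_zero_iff.2 hv0) h7).symm

/-- By no slip the two Wirtinger derivatives of the velocity have equal modulus on the boundary, and
the first one, P - conj P, is at most twice the slope. -/
theorem norm_conjStrain_le_of_boundary (hG : IsShearSeq s G) (hs : 0 < s) {t : ℂ} (h1 : t ≠ 1)
    (ht : ‖t‖ = exp s ∨ ‖t‖ = exp (-s)) : ‖conjStrain s G t‖ ≤ 2 * ‖slope G t‖ := by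
  have htm : t ∈ openAnnulus (3 / 2 * s) := by
    rcases ht with h | h <;> constructor <;> rw [h, exp_lt_exp] <;> linarith
  -- The claim does not involve the scale, so a = 1 suffices.
  have ha : (1 : ℝ) ≠ 0 := one_ne_zero
  have hz := mul_position_mem_annulusPreimage ha h1 htm
  have hU := hasFDerivAt_shearVelocity hG hs ha hz
  have h2 := norm_wirtinger_eq_of_circle ha h1 (ne_zero_of_mem_openAnnulus htm) hU
    (fun w hw hw1 => by
      have hwm : w ∈ openAnnulus (3 / 2 * s) := by
        rcases ht with h | h <;> constructor <;> rw [hw, h, exp_lt_exp] <;> linarith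
      have hw2 := mul_position_mem_annulusPreimage ha hw1 hwm
      rcases ht with h | h
      · exact shearVelocity_eq_zero_right hG hs ha hw2.1
          (by rw [toAnnulus_mul_position ha hw1, hw, h])
      · exact shearVelocity_eq_zero_left hG hs ha hw2.1
          (by rw [toAnnulus_mul_position ha hw1, hw, h]))
  rw [norm_wirtinger_snd_shearVelocity hG hs ha hz, toAnnulus_mul_position ha h1] at h2
  rw [h2]
  refine (norm_sub_le _ _).trans (le_of_eq ?_)
  rw [RCLike.norm_conj, norm_mul, Complex.norm_I]
  ring

theorem closure_openAnnulus_subset (r : ℝ) : closure (openAnnulus r) ⊆ closedAnnulus r :=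
  closure_minimal (openAnnulus_subset_closedAnnulus r)
    ((isClosed_le continuous_const continuous_norm).inter
      (isClosed_le continuous_norm continuous_const))

theorem differentiableOn_analyticStrain (hG : IsShearSeq s G) (hs : 0 < s) :
    DifferentiableOn ℂ (analyticStrain s G) (openAnnulus (4 / 3 * s)) := by
  have h1 : DifferentiableOn ℂ (deriv (slope G)) (openAnnulus (4 / 3 * s)) :=
    ((hG.differentiableOn_slope hs).deriv (isOpen_openAnnulus _)).mono
      (openAnnulus_mono (by linarith))
  unfold analyticStrain
  refine (hG.differentiableOn_slopeTwo hs).sub (DifferentiableOn.mul ?_ (DifferentiableOn.mul ?_ h1))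
  · intro t ht
    have := exp_two_sub_ne_zero hs ht
    fun_prop (disch := simpa using this)
  · fun_prop

/-- Maximum modulus on the annulus. On both circles the value differs from `conjStrain` by at most
56832 exp(12s), and `conjStrain` is at most 2 · 592 exp(9s) there. The point t = 1 is harmless
because this function is holomorphic across it. -/
theorem norm_analyticStrain_le (hG : IsShearSeq s G) (hs : 0 < s) {t : ℂ}
    (ht : t ∈ closedAnnulus s) : ‖analyticStrain s G t‖ ≤ 60000 * exp (12 * s) := by
  have hb : Bornology.IsBounded (openAnnulus s) :=
    (Metric.isBounded_closedBall (x := (0 : ℂ)) (r := exp s)).subset fun w hw => by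
      simpa using hw.2.le
  have hbound : ∀ w ∈ closedAnnulus s, w ∉ openAnnulus s →
      ‖analyticStrain s G w‖ ≤ 60000 * exp (12 * s) := by
    intro w hw hw'
    have hw1 : w ≠ 1 := by
      rintro rfl
      exact hw' (one_mem_openAnnulus hs)
    have hor : ‖w‖ = exp s ∨ ‖w‖ = exp (-s) := by
      by_contra! h
      exact hw' ⟨lt_of_le_of_ne hw.1 h.2.symm, lt_of_le_of_ne hw.2 h.1⟩
    have h2 := norm_conjStrain_le_of_boundary hG hs hw1 hor
    have h3 := norm_conjStrain_sub_le hG hs hw hw1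
    have h4 := hG.norm_slope_le hs hw
    have h5 : exp (9 * s) ≤ exp (12 * s) := exp_le_exp.2 (by linarith)
    have h6 := norm_sub_le (conjStrain s G w) (conjStrain s G w - analyticStrain s G w)
    rw [sub_sub_cancel] at h6
    linarith [exp_pos (12 * s)]
  by_cases hto : t ∈ openAnnulus s
  · refine Complex.norm_le_of_forall_mem_frontier_norm_le hb ?_ ?_ (subset_closure hto)
    · refine DifferentiableOn.diffContOnCl ((differentiableOn_analyticStrain hG hs).mono ?_)
      exact (closure_openAnnulus_subset s).trans (closedAnnulus_subset_openAnnulus (by linarith))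
    · intro w hw
      rw [(isOpen_openAnnulus s).frontier_eq] at hw
      exact hbound w (closure_openAnnulus_subset s hw.1) hw.2
  · exact hbound t ht hto

theorem norm_conjStrain_le (hG : IsShearSeq s G) (hs : 0 < s) {t : ℂ}
    (ht : t ∈ closedAnnulus s) (h1 : t ≠ 1) : ‖conjStrain s G t‖ ≤ 120000 * exp (12 * s) := by
  have h2 := norm_analyticStrain_le hG hs ht
  have h3 := norm_conjStrain_sub_le hG hs ht h1
  have h4 := norm_add_le (analyticStrain s G t) (conjStrain s G t - analyticStrain s G t)
  rw [add_sub_cancel] at h4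
  linarith [exp_pos (12 * s)]

end

theorem toAnnulus_ne_one {a : ℝ} (ha : a ≠ 0) {z : ℂ} (hz : z ≠ a) : toAnnulus a z ≠ 1 := by
  have ha' : (a : ℂ) ≠ 0 := by exact_mod_cast ha
  rw [Ne, ← sub_eq_zero, toAnnulus_sub_one hz]
  exact div_ne_zero (by simpa using ha') (sub_ne_zero.2 hz)

/-- The uniform bounds for the shear solution. -/
theorem shear_bounds {μ R δ s : ℝ} {G : ℤ → ℝ} (hG : IsShearSeq s G) (hR : 0 < R) (hs : 0 < s)
    (hμ : 0 < μ) (hc : R * cosh s = R + δ / 2) {x : Plane} (hx : x ∈ fluidDomain R δ) :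
    (∀ i j, |strain (planarField (shearVelocity (R * sinh s) s G)) x i j| ≤
      120000 * exp (12 * s)) ∧
    |-4 * μ * (Complex.I * slope G (toAnnulus (R * sinh s) (toComplex x))).re| ≤
      2368 * μ * exp (12 * s) := by
  have ha : R * sinh s ≠ 0 := (mul_pos hR (sinh_pos_iff.2 hs)).ne'
  rw [fluidDomain_eq hR, ← hc, Set.mem_preimage, mem_exteriorDomain_iff hR hs] at hx
  set b := R * sinh s with hb
  set z := toComplex x with hzx
  have hz : z ∈ annulusPreimage b (3 / 2 * s) := ⟨hx.1, openAnnulus_mono (by linarith) hx.2⟩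
  have hcl := openAnnulus_subset_closedAnnulus _ hx.2
  have hU := (hasFDerivAt_shearVelocity hG hs ha hz).fderiv
  have hn := norm_wirtinger_snd_shearVelocity hG hs ha hz
  constructor
  · have h1 := norm_conjStrain_le hG hs hcl (toAnnulus_ne_one ha hx.1)
    rw [← hn] at h1
    have h2 := (Complex.abs_re_le_norm _).trans h1
    have h3 := (Complex.abs_im_le_norm _).trans h1
    rw [strain_planarField hU (by simp)]
    intro i j
    fin_cases i <;> fin_cases j
    · exact h2
    · exact h3
    · exact h3
    · exact (abs_neg _).trans_le h2
  · have h1 := hG.norm_slope_le hs hcl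
    have h2 := Complex.abs_re_le_norm (Complex.I * slope G (toAnnulus b z))
    rw [norm_mul, Complex.norm_I, one_mul] at h2
    have h5 : exp (9 * s) ≤ exp (12 * s) := exp_le_exp.2 (by linarith)
    rw [abs_mul, abs_mul, abs_neg, abs_of_pos hμ, abs_of_pos (by norm_num : (0 : ℝ) < 4)]
    have h6 : |(Complex.I * slope G (toAnnulus b z)).re| ≤ 592 * exp (12 * s) := by linarith
    calc _ ≤ 4 * μ * (592 * exp (12 * s)) := by gcongr
      _ = _ := by ring

end

/-! ### Every planar Stokes flow has a Goursat pair. -/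

section
open Filter Topology Real

/-- The Goursat representation of a planar Stokes flow. -/
theorem exists_goursat {μ : ℝ} (hμ : μ ≠ 0) {Ω : Set ℂ} (hΩ : IsOpen Ω) {U : ℂ → ℂ} {Q : ℂ → ℝ}
    (hU : ContDiffOn ℝ 2 U Ω) (hQ : ContDiffOn ℝ 1 Q Ω)
    (hmom : ∀ z ∈ Ω, μ * (fderiv ℝ (fderiv ℝ U) z 1 1 +
      fderiv ℝ (fderiv ℝ U) z Complex.I Complex.I) =
        fderiv ℝ Q z 1 + fderiv ℝ Q z Complex.I * Complex.I)
    (hdiv : ∀ z ∈ Ω, (fderiv ℝ U z 1).re + (fderiv ℝ U z Complex.I).im = 0) :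
    ∃ P K : ℂ → ℂ, DifferentiableOn ℂ P Ω ∧ DifferentiableOn ℂ K Ω ∧
      (∀ z ∈ Ω, HasFDerivAt U (wirtinger (P z - (starRingEnd ℂ) (P z))
        ((starRingEnd ℂ) (K z) - z * (starRingEnd ℂ) (deriv P z))) z) ∧
      ∀ z ∈ Ω, Q z = -4 * μ * (P z).re := by
  have hμ' : (μ : ℂ) ≠ 0 := by exact_mod_cast hμ
  set D := fderiv ℝ U with hD
  have hUd : ∀ z ∈ Ω, HasFDerivAt U (D z) z := fun z hz =>
    ((hU.differentiableOn (by norm_num)).differentiableAt (hΩ.mem_nhds hz)).hasFDerivAt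
  have hD1 : ContDiffOn ℝ 1 D Ω := hU.fderiv_of_isOpen hΩ (by norm_num)
  have hDd : ∀ z ∈ Ω, HasFDerivAt D (fderiv ℝ D z) z := fun z hz =>
    ((hD1.differentiableOn (by norm_num)).differentiableAt (hΩ.mem_nhds hz)).hasFDerivAt
  have hQd : ∀ z ∈ Ω, HasFDerivAt Q (fderiv ℝ Q z) z := fun z hz =>
    ((hQ.differentiableOn (by norm_num)).differentiableAt (hΩ.mem_nhds hz)).hasFDerivAt
  have happ : ∀ z ∈ Ω, ∀ v : ℂ, HasFDerivAt (fun w => D w v)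
      ((ContinuousLinearMap.apply ℝ ℂ v).comp (fderiv ℝ D z)) z := fun z hz v =>
    (ContinuousLinearMap.apply ℝ ℂ v).hasFDerivAt.comp z (hDd z hz)
  have hsymm : ∀ z ∈ Ω, ∀ v w, fderiv ℝ D z v w = fderiv ℝ D z w v := fun z hz v w =>
    ((hU.contDiffAt (hΩ.mem_nhds hz)).isSymmSndFDerivAt (by simp)).eq v w
  set α : ℂ → ℂ := fun z => (1 / 2 : ℂ) * (D z 1 - Complex.I * D z Complex.I) with hα
  set β : ℂ → ℂ := fun z => (1 / 2 : ℂ) * (D z 1 + Complex.I * D z Complex.I) with hβ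
  have hαd : ∀ z ∈ Ω, HasFDerivAt α ((1 / 2 : ℂ) • ((ContinuousLinearMap.apply ℝ ℂ 1).comp
      (fderiv ℝ D z) - Complex.I • (ContinuousLinearMap.apply ℝ ℂ Complex.I).comp
      (fderiv ℝ D z))) z := fun z hz =>
    ((happ z hz 1).sub ((happ z hz Complex.I).const_mul Complex.I)).const_mul (1 / 2 : ℂ)
  have hβd : ∀ z ∈ Ω, HasFDerivAt β ((1 / 2 : ℂ) • ((ContinuousLinearMap.apply ℝ ℂ 1).comp
      (fderiv ℝ D z) + Complex.I • (ContinuousLinearMap.apply ℝ ℂ Complex.I).comp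
      (fderiv ℝ D z))) z := fun z hz =>
    ((happ z hz 1).add ((happ z hz Complex.I).const_mul Complex.I)).const_mul (1 / 2 : ℂ)
  have hα0 : ∀ z ∈ Ω, (α z).re = 0 := by
    intro z hz
    have := hdiv z hz
    simp only [hα, Complex.mul_re, Complex.sub_re, Complex.I_re, Complex.I_im]
    norm_num
    linarith
  have hα0d : ∀ z ∈ Ω, ∀ v, (((1 / 2 : ℂ) • ((ContinuousLinearMap.apply ℝ ℂ 1).comp
      (fderiv ℝ D z) - Complex.I • (ContinuousLinearMap.apply ℝ ℂ Complex.I).comp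
      (fderiv ℝ D z))) v).re = 0 := by
    intro z hz v
    have h1 := Complex.reCLM.hasFDerivAt.comp z (hαd z hz)
    have h2 : HasFDerivAt (Complex.reCLM ∘ α) (0 : ℂ →L[ℝ] ℝ) z := by
      refine (hasFDerivAt_const (0 : ℝ) z).congr_of_eventuallyEq ?_
      filter_upwards [hΩ.mem_nhds hz] with w hw
      exact hα0 w hw
    exact DFunLike.congr_fun (h1.unique h2) v
  -- Incompressibility makes α = ∂U/∂z purely imaginary, so α = P - conj P, while the real part of P
  -- encodes the pressure. The Cauchy-Riemann equation for P is the momentum equation. Only P and K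
  -- are needed, not their primitives, so the connectivity of the domain is irrelevant.
  set P : ℂ → ℂ := fun z => (1 / 2 : ℂ) * α z - (Q z : ℂ) / (4 * μ) with hPdef
  have hPd : ∀ z ∈ Ω, HasFDerivAt P ((1 / 2 : ℂ) • ((1 / 2 : ℂ) •
      ((ContinuousLinearMap.apply ℝ ℂ 1).comp (fderiv ℝ D z) -
        Complex.I • (ContinuousLinearMap.apply ℝ ℂ Complex.I).comp (fderiv ℝ D z))) -
      (4 * μ : ℂ)⁻¹ • Complex.ofRealCLM.comp (fderiv ℝ Q z)) z := by
    intro z hz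
    have h1 := ((hαd z hz).const_mul (1 / 2 : ℂ)).sub
      ((Complex.ofRealCLM.hasFDerivAt.comp z (hQd z hz)).const_mul (4 * μ : ℂ)⁻¹)
    refine h1.congr_of_eventuallyEq (Eventually.of_forall fun w => ?_)
    simp only [hPdef, Function.comp, Complex.ofRealCLM_apply, Pi.sub_apply]
    ring
  have hPh : DifferentiableOn ℂ P Ω := by
    intro z hz
    refine DifferentiableAt.differentiableWithinAt ?_
    rw [differentiableAt_complex_iff_differentiableAt_real]
    refine ⟨(hPd z hz).differentiableAt, ?_⟩
    have h1 := hmom z hz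
    have h2 := hsymm z hz 1 Complex.I
    rw [(hPd z hz).fderiv]
    simp only [sub_apply, smul_apply, ContinuousLinearMap.comp_apply,
      ContinuousLinearMap.apply_apply, smul_eq_mul, Complex.ofRealCLM_apply]
    rw [h2]
    have h3 : fderiv ℝ D z 1 1 + fderiv ℝ D z Complex.I Complex.I =
        (fderiv ℝ Q z 1 + fderiv ℝ Q z Complex.I * Complex.I) / μ := by
      rw [← h1]; field_simp
    have h4 : (fderiv ℝ D z Complex.I) Complex.I =
        (fderiv ℝ Q z 1 + fderiv ℝ Q z Complex.I * Complex.I) / μ - fderiv ℝ D z 1 1 := by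
      rw [← h3]; ring
    rw [h4]
    field_simp
    linear_combination (4 * (-fderiv ℝ Q z Complex.I + μ * fderiv ℝ D z Complex.I 1) : ℂ) *
      Complex.I_sq
  have hP' : ∀ z ∈ Ω, deriv P z = (1 / 4 : ℂ) * (fderiv ℝ D z 1 1 -
      Complex.I * fderiv ℝ D z 1 Complex.I) - (fderiv ℝ Q z 1 : ℂ) / (4 * μ) := by
    intro z hz
    have h1 := (hPh.differentiableAt (hΩ.mem_nhds hz)).hasDerivAt.complexToReal_fderiv
    have h2 := DFunLike.congr_fun (h1.unique (hPd z hz)) 1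
    rw [show (deriv P z • (1 : ℂ →L[ℝ] ℂ)) 1 = deriv P z by simp] at h2
    simp only [sub_apply, smul_apply, ContinuousLinearMap.comp_apply,
      ContinuousLinearMap.apply_apply, smul_eq_mul, Complex.ofRealCLM_apply] at h2
    rw [h2]
    ring
  have hP'h : DifferentiableOn ℂ (deriv P) Ω := hPh.deriv hΩ
  -- With β = ∂U/∂(conj z), the derivative of K in conj z is conj(ΔU)/4 + P', which vanishes because
  -- ΔU = -4 conj P' (`hkey` below).
  set K : ℂ → ℂ := fun z => (starRingEnd ℂ) (β z) + (starRingEnd ℂ) z * deriv P z with hKdef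
  refine ⟨P, K, hPh, ?_, ?_, ?_⟩
  · intro z hz
    refine DifferentiableAt.differentiableWithinAt ?_
    rw [differentiableAt_complex_iff_differentiableAt_real]
    have hc : HasFDerivAt (fun w : ℂ => (starRingEnd ℂ) w) (Complex.conjCLE : ℂ →L[ℝ] ℂ) z :=
      (Complex.conjCLE : ℂ →L[ℝ] ℂ).hasFDerivAt
    have h1 := (Complex.conjCLE : ℂ →L[ℝ] ℂ).hasFDerivAt.comp z (hβd z hz)
    have h2 := (hP'h.differentiableAt (hΩ.mem_nhds hz)).hasDerivAt.complexToReal_fderiv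
    have h3 : HasFDerivAt K _ z := h1.add (hc.mul h2)
    refine ⟨h3.differentiableAt, ?_⟩
    rw [h3.fderiv]
    have hs := hsymm z hz 1 Complex.I
    have hconj : ∀ w : ℂ, ((1 / 2 : ℂ) * w).re = 0 → (starRingEnd ℂ) w = -w := by
      intro w hw
      have hw' : w.re = 0 := by simpa using hw
      apply Complex.ext <;> simp [hw']
    have hw1 : (starRingEnd ℂ) (fderiv ℝ D z 1 1 - Complex.I * fderiv ℝ D z 1 Complex.I) =
        -(fderiv ℝ D z 1 1 - Complex.I * fderiv ℝ D z 1 Complex.I) := hconj _ (hα0d z hz 1)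
    have hw2 : (starRingEnd ℂ) (fderiv ℝ D z Complex.I 1 -
        Complex.I * fderiv ℝ D z Complex.I Complex.I) = -(fderiv ℝ D z Complex.I 1 -
        Complex.I * fderiv ℝ D z Complex.I Complex.I) := hconj _ (hα0d z hz Complex.I)
    have hm := hmom z hz
    have hmc := congrArg (starRingEnd ℂ) hm
    have hp := congrArg (starRingEnd ℂ) (hP' z hz)
    rw [hs] at hw1 hp
    simp only [map_sub, map_mul, map_add, Complex.conj_ofReal, Complex.conj_I, map_div₀,
      map_ofNat, map_one] at hw1 hw2 hmc hp
    have hkey : fderiv ℝ D z 1 1 + fderiv ℝ D z Complex.I Complex.I =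
        -4 * (starRingEnd ℂ) (deriv P z) := by
      rw [hp]
      field_simp
      linear_combination (1 / 2 : ℂ) * hm + (1 / 2 : ℂ) * hmc + (μ / 2 : ℂ) * hw1 +
        (μ / 2 : ℂ) * Complex.I * hw2 + (μ / 2 : ℂ) * (fderiv ℝ D z Complex.I Complex.I -
        (starRingEnd ℂ) (fderiv ℝ D z Complex.I Complex.I)) * Complex.I_sq
    have hkey' := congrArg (starRingEnd ℂ) hkey
    simp only [map_add, map_mul, map_neg, map_ofNat, Complex.conj_conj] at hkey'
    simp only [add_apply, smul_apply, ContinuousLinearMap.comp_apply,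
      ContinuousLinearMap.apply_apply, smul_eq_mul, ContinuousLinearEquiv.coe_coe,
      Complex.conjCLE_apply, map_add, map_mul, Complex.conj_I, hs]
    rw [show (1 : ℂ →L[ℝ] ℂ) Complex.I = Complex.I from rfl, show (1 : ℂ →L[ℝ] ℂ) 1 = 1 from rfl]
    simp only [map_div₀, map_one, map_ofNat]
    linear_combination (-(1 / 2 : ℂ) * Complex.I) * hkey' +
      (1 / 2 : ℂ) * (starRingEnd ℂ) (fderiv ℝ D z Complex.I 1) * Complex.I_sq
  · intro z hz
    refine (hUd z hz).congr_fderiv ?_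
    have h1 : P z - (starRingEnd ℂ) (P z) = α z := by
      have h2 : (starRingEnd ℂ) (α z) = -α z := by
        apply Complex.ext <;> simp [hα0 z hz]
      simp only [hPdef, map_sub, map_mul, map_div₀, Complex.conj_ofReal, map_ofNat, map_one, h2]
      ring
    have h2 : (starRingEnd ℂ) (K z) - z * (starRingEnd ℂ) (deriv P z) = β z := by
      simp only [hKdef, map_add, map_mul, Complex.conj_conj]
      ring
    rw [h1, h2]
    have h3 : ∀ v : ℂ, D z v = v.re * D z 1 + v.im * D z Complex.I := by
      intro v
      conv_lhs => rw [show v = v.re • (1 : ℂ) + v.im • Complex.I by simp]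
      rw [map_add, map_smul, map_smul]
      simp
    ext v
    have hv1 := Complex.re_add_im v
    have hv2 : (starRingEnd ℂ) v = v.re - v.im * Complex.I := by
      apply Complex.ext <;> simp
    rw [wirtinger_apply, h3 v, hv2]
    simp only [hα, hβ]
    linear_combination ((1 / 2 : ℂ) * (D z 1 - Complex.I * D z Complex.I)) * hv1 -
      (-v.im * D z Complex.I : ℂ) * Complex.I_sq
  · intro z hz
    have h1 : ((Q z : ℂ) / (4 * μ)) = ((Q z / (4 * μ) : ℝ) : ℂ) := by push_cast; rfl
    simp only [hPdef, h1, Complex.sub_re, Complex.ofReal_re]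
    have h2 : ((1 / 2 : ℂ) * α z).re = 0 := by simp [hα0 z hz]
    rw [h2]
    field_simp
    ring

end

/-! ### Uniqueness for the homogeneous difference equations. -/

section
open Filter Topology Real

section

variable {s : ℝ} {E : ℤ → ℝ}

theorem bddAbove_range_of_abs_le {u : ℤ → ℝ} {C : ℝ} (h : ∀ n, |u n| ≤ C) :
    BddAbove (Set.range u) :=
  ⟨C, by rintro _ ⟨n, rfl⟩; exact (le_abs_self _).trans (h n)⟩

/-- Moving the right side over gives Δ²((m + sinh 2s)E) = κ m E. Since m_n ≥ 2s, m is bounded below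
by a fixed fraction of m + sinh 2s, so the maximum principle applies to E and -E. -/
theorem eq_zero_of_secondDiff_antisymm (hs : 0 < s) {C : ℝ} (hb : ∀ n, |gapWeight s n * E n| ≤ C)
    (h : ∀ n, secondDiff (fun k => gapWeight s k * E k) n - gapConst s * (gapWeight s n * E n) =
      -(sinh (2 * s) * secondDiff E n)) (n : ℤ) : E n = 0 := by
  have key : ∀ E : ℤ → ℝ, (∀ n, |gapWeight s n * E n| ≤ C) →
      (∀ n, secondDiff (fun k => gapWeight s k * E k) n - gapConst s * (gapWeight s n * E n) =
        -(sinh (2 * s) * secondDiff E n)) → ∀ n, E n ≤ 0 := by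
    intro E hb h n
    have hS : 0 < sinh (2 * s) := sinh_pos_iff.2 (by positivity)
    have hc := gapConst_pos hs
    have hw : ∀ n, 0 < gapWeight s n + sinh (2 * s) := fun n => add_pos (gapWeight_pos hs n) hS
    have hk : ∀ n, (1 + sinh (2 * s) / (2 * s)) * gapWeight s n ≥ gapWeight s n + sinh (2 * s) := by
      intro n
      have h1 := two_mul_le_gapWeight hs.le n
      have h2 : sinh (2 * s) ≤ sinh (2 * s) / (2 * s) * gapWeight s n := by
        rw [div_mul_eq_mul_div, le_div_iff₀ (by positivity)]
        exact mul_le_mul_of_nonneg_left h1 hS.le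
      linarith
    have hκ : 0 < 1 + sinh (2 * s) / (2 * s) := by positivity
    have h1 := nonpos_of_mul_le_secondDiff (u := fun n => (gapWeight s n + sinh (2 * s)) * E n)
      (k := gapConst s / (1 + sinh (2 * s) / (2 * s))) (by positivity)
      (bddAbove_range_of_abs_le (C := (1 + sinh (2 * s) / (2 * s)) * C) fun n => ?_) (fun n hn => ?_) n
    · exact nonpos_of_mul_nonpos_right h1 (hw n)
    · rw [abs_mul, abs_of_pos (hw n)]
      have h2 := hb n
      rw [abs_mul, abs_of_pos (gapWeight_pos hs n)] at h2
      calc _ ≤ (1 + sinh (2 * s) / (2 * s)) * gapWeight s n * |E n| := by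
            gcongr; exact hk n
        _ = (1 + sinh (2 * s) / (2 * s)) * (gapWeight s n * |E n|) := by ring
        _ ≤ _ := by gcongr
    · have hE : 0 < E n := pos_of_mul_pos_right hn (hw n).le
      have h2 : secondDiff (fun n => (gapWeight s n + sinh (2 * s)) * E n) n =
          gapConst s * (gapWeight s n * E n) := by
        have := h n
        unfold secondDiff at this ⊢
        linear_combination this
      rw [h2, div_mul_eq_mul_div, div_le_iff₀ hκ]
      have h3 := mul_le_mul_of_nonneg_right (hk n) hE.le
      have h4 := mul_le_mul_of_nonneg_left h3 hc.le
      linarith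
  refine le_antisymm (key E hb h n) ?_
  have := key (fun n => -E n) (fun n => by rw [mul_neg, abs_neg]; exact hb n) (fun n => by
    have := h n
    unfold secondDiff at this ⊢
    linear_combination -this) n
  linarith

theorem sinh_lt_mul_cosh {x : ℝ} (hx : 0 < x) : sinh x < x * cosh x := by
  have hm : StrictMonoOn (fun x => x * cosh x - sinh x) (Set.Ici 0) := by
    refine strictMonoOn_of_deriv_pos (convex_Ici 0) (by fun_prop) fun y hy => ?_
    rw [interior_Ici] at hy
    have h := ((hasDerivAt_id y).mul (hasDerivAt_cosh y)).sub (hasDerivAt_sinh y)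
    have h' : HasDerivAt (fun x => x * cosh x - sinh x) (y * sinh y) y :=
      h.congr_deriv (by simp only [id]; ring)
    rw [h'.deriv]
    exact mul_pos hy (sinh_pos_iff.2 hy)
  have := hm (Set.self_mem_Ici) hx.le hx
  simp only [zero_mul, sinh_zero, sub_zero] at this
  linarith

/-- Now the weight is m - sinh 2s, negative at n = 0, zero at n = ±1 and positive beyond. As it
vanishes at n = 1, truncating (m - sinh 2s)E to n ≥ 2 keeps the equation at n = 2, and the maximum
principle works on the half-line. -/
theorem nonpos_of_secondDiff_symm (hs : 0 < s) {C : ℝ} (hb : ∀ n, |gapWeight s n * E n| ≤ C)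
    (h : ∀ n, secondDiff (fun k => gapWeight s k * E k) n - gapConst s * (gapWeight s n * E n) =
      sinh (2 * s) * secondDiff E n) {n : ℤ} (hn : 2 ≤ n) : E n ≤ 0 := by
  have hS : 0 < sinh (2 * s) := sinh_pos_iff.2 (by positivity)
  have hc := gapConst_pos hs
  set u : ℤ → ℝ := fun n => if 2 ≤ n then (gapWeight s n - sinh (2 * s)) * E n else 0 with hu
  have hw : ∀ n : ℤ, 2 ≤ n → 0 < gapWeight s n - sinh (2 * s) := fun n hn =>
    sub_pos.2 (sinh_lt_gapWeight hs (hn.trans (le_abs_self n)))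
  have h0 := (abs_nonneg _).trans (hb 0)
  have h1 := nonpos_of_mul_le_secondDiff (u := u) hc
    (bddAbove_range_of_abs_le (C := C) fun n => ?_) (fun n hn => ?_) n
  · rw [hu] at h1
    simp only [if_pos hn] at h1
    exact nonpos_of_mul_nonpos_right h1 (hw n hn)
  · rw [hu]
    simp only
    split_ifs with hn
    · refine le_trans ?_ (hb n)
      rw [abs_mul, abs_mul, abs_of_pos (hw n hn), abs_of_pos (gapWeight_pos hs n)]
      gcongr
      linarith
    · rw [abs_zero]; exact h0
  · have hn2 : 2 ≤ n := by
      by_contra hn2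
      simp [hu, hn2] at hn
    have hun : ∀ k : ℤ, 1 ≤ k → u k = (gapWeight s k - sinh (2 * s)) * E k := by
      intro k hk
      rw [hu]
      simp only
      split_ifs with h2
      · rfl
      · rw [show k = 1 by omega, gapWeight_one]; ring
    have h2 : secondDiff u n = gapConst s * (gapWeight s n * E n) := by
      have := h n
      unfold secondDiff at this ⊢
      rw [hun _ (by omega), hun _ (by omega), hun _ (by omega)]
      linear_combination this
    rw [h2]
    rw [hun n (by omega)] at hn ⊢
    have hE : 0 < E n := pos_of_mul_pos_right hn (hw n hn2).le
    have h3 : (gapWeight s n - sinh (2 * s)) * E n ≤ gapWeight s n * E n :=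
      mul_le_mul_of_nonneg_right (by linarith) hE.le
    exact mul_le_mul_of_nonneg_left h3 hc.le

/-- Both half-lines |n| ≥ 2 vanish. At n = 0 the neighbours carry zero weight, so the equation is
2(2s cosh 2s - sinh 2s) E_0 = 0, where x cosh x > sinh x decides; then the equations at ±1 reduce to
κ sinh(2s) E_{±1} = 0. -/
theorem eq_zero_of_secondDiff_symm (hs : 0 < s) {C : ℝ} (hb : ∀ n, |gapWeight s n * E n| ≤ C)
    (h : ∀ n, secondDiff (fun k => gapWeight s k * E k) n - gapConst s * (gapWeight s n * E n) =
      sinh (2 * s) * secondDiff E n) (n : ℤ) : E n = 0 := by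
  have hS : 0 < sinh (2 * s) := sinh_pos_iff.2 (by positivity)
  have hc := gapConst_pos hs
  have half : ∀ E : ℤ → ℝ, (∀ n, |gapWeight s n * E n| ≤ C) →
      (∀ n, secondDiff (fun k => gapWeight s k * E k) n - gapConst s * (gapWeight s n * E n) =
        sinh (2 * s) * secondDiff E n) → ∀ n : ℤ, 2 ≤ n → E n = 0 := by
    intro E hb h n hn
    refine le_antisymm (nonpos_of_secondDiff_symm hs hb h hn) ?_
    have := nonpos_of_secondDiff_symm (E := fun n => -E n) hs
      (fun n => by rw [mul_neg, abs_neg]; exact hb n) (fun n => by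
      have := h n
      unfold secondDiff at this ⊢
      linear_combination -this) hn
    linarith
  have hpos := half E hb h
  have hneg : ∀ n : ℤ, n ≤ -2 → E n = 0 := by
    intro n hn
    have := half (fun n => E (-n)) (fun n => by rw [← gapWeight_neg]; exact hb (-n)) (fun n => by
      have := h (-n)
      unfold secondDiff at this ⊢
      simp only [neg_add, neg_sub] at this ⊢
      rw [show -n + -1 = -(n + 1) by ring, show -n - 1 = -(n + 1) by ring,
        show 1 - n = -(n - 1) by ring] at *
      rw [show -n + 1 = -(n - 1) by ring] at this
      simp only [gapWeight_neg] at this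
      linear_combination this) (-n) (by omega)
    simpa using this
  have e0 := h 0
  have e1 := h 1
  have e2 := h (-1)
  unfold secondDiff at e0 e1 e2
  norm_num at e0 e1 e2
  rw [hpos 2 le_rfl] at e1
  rw [hneg (-2) le_rfl] at e2
  have g1 : gapWeight s (-1) = sinh (2 * s) := by rw [gapWeight_neg, gapWeight_one]
  rw [g1, gapWeight_one, gapWeight_zero] at e0
  rw [gapWeight_one, gapWeight_zero] at e1
  rw [g1, gapWeight_zero] at e2
  have hE0 : E 0 = 0 := by
    have h1 := sinh_lt_mul_cosh (by positivity : 0 < 2 * s)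
    have h2 : (2 * (2 * s * cosh (2 * s) - sinh (2 * s))) * E 0 = 0 := by
      unfold gapConst at e0
      linear_combination -e0
    rcases mul_eq_zero.1 h2 with h3 | h3
    · linarith
    · exact h3
  rw [hE0] at e1 e2
  have hcS : gapConst s * sinh (2 * s) ≠ 0 := (mul_pos hc hS).ne'
  have hE1 : E 1 = 0 := by
    have h2 : gapConst s * sinh (2 * s) * E 1 = 0 := by linear_combination -e1
    exact (mul_eq_zero.1 h2).resolve_left hcS
  have hE2 : E (-1) = 0 := by
    have h2 : gapConst s * sinh (2 * s) * E (-1) = 0 := by linear_combination -e2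
    exact (mul_eq_zero.1 h2).resolve_left hcS
  rcases lt_trichotomy n 0 with hn | rfl | hn
  · rcases eq_or_ne n (-1) with rfl | hn'
    · exact hE2
    · exact hneg n (by omega)
  · exact hE0
  · rcases eq_or_ne n 1 with rfl | hn'
    · exact hE1
    · exact hpos n (by omega)

theorem secondDiff_reflect {A : Type*} [Ring A] (u : ℤ → A) (n : ℤ) :
    secondDiff (fun k => u (-k)) n = secondDiff u (-n) := by
  unfold secondDiff
  simp only
  rw [show -(n + 1) = -n - 1 by ring, show -(n - 1) = -n + 1 by ring]
  abel

/-- A sequence related to its reflection by the boundary recurrence vanishes. -/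
theorem eq_zero_of_secondDiff_reflect (hs : 0 < s) {C ε : ℝ} (hε : ε = 1 ∨ ε = -1)
    (hb : ∀ n, |gapWeight s n * E n| ≤ C)
    (h : ∀ n, secondDiff (fun k => gapWeight s k * E k) n - gapConst s * (gapWeight s n * E n) =
      ε * (sinh (2 * s) * secondDiff (fun k => E (-k)) n)) (n : ℤ) : E n = 0 := by
  have hr : ∀ n, secondDiff (fun k => gapWeight s k * E (-k)) n -
      gapConst s * (gapWeight s n * E (-n)) = ε * (sinh (2 * s) * secondDiff E n) := by
    intro n
    have h1 := h (-n)
    rw [secondDiff_reflect, neg_neg, ← secondDiff_reflect, gapWeight_neg] at h1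
    simpa only [gapWeight_neg] using h1
  have hbr : ∀ n, |gapWeight s n * E (-n)| ≤ C := fun n => by rw [← gapWeight_neg]; exact hb (-n)
  have hsum : ∀ n, |gapWeight s n * (E n + E (-n))| ≤ 2 * C := fun n => by
    rw [mul_add]; linarith [abs_add_le (gapWeight s n * E n) (gapWeight s n * E (-n)), hb n, hbr n]
  have hdif : ∀ n, |gapWeight s n * (E n - E (-n))| ≤ 2 * C := fun n => by
    rw [mul_sub]; linarith [abs_sub (gapWeight s n * E n) (gapWeight s n * E (-n)), hb n, hbr n]
  -- The even part satisfies the unreflected equation with sign ε, the odd part with sign -ε.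
  have key : (∀ n, E n + E (-n) = 0) ∧ ∀ n, E n - E (-n) = 0 := by
    rcases hε with rfl | rfl
    · refine ⟨eq_zero_of_secondDiff_symm hs hsum fun n => ?_,
        eq_zero_of_secondDiff_antisymm hs hdif fun n => ?_⟩
      · have h1 := h n
        have h2 := hr n
        unfold secondDiff at h1 h2 ⊢
        linear_combination h1 + h2
      · have h1 := h n
        have h2 := hr n
        unfold secondDiff at h1 h2 ⊢
        linear_combination h1 - h2
    · refine ⟨eq_zero_of_secondDiff_antisymm hs hsum fun n => ?_,
        eq_zero_of_secondDiff_symm hs hdif fun n => ?_⟩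
      · have h1 := h n
        have h2 := hr n
        unfold secondDiff at h1 h2 ⊢
        linear_combination h1 + h2
      · have h1 := h n
        have h2 := hr n
        unfold secondDiff at h1 h2 ⊢
        linear_combination h1 - h2
  linarith [key.1 n, key.2 n]

end

/-- The recurrence factors with roots Q and 1/Q. First D_n = V_{n+1} - Q V_n is bounded by forward
iteration with ratio 1/Q; then V_n = (V_{n+1} - D_n)/Q is iterated backwards from infinity, where
growth o(Qⁿ) removes the growing mode. -/
theorem bounded_of_recurrence_nat {V : ℕ → ℂ} {Q M : ℝ} (hQ : 1 < Q)
    (h : ∀ n, ‖V (n + 2) - (Q + (Q : ℂ)⁻¹) * V (n + 1) + V n‖ ≤ M)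
    (ht : Tendsto (fun n => ‖V n‖ / Q ^ n) atTop (𝓝 0)) : ∃ C, ∀ n, ‖V n‖ ≤ C := by
  have hQ0 : 0 < Q := one_pos.trans hQ
  have hQc : (Q : ℂ) ≠ 0 := by exact_mod_cast hQ0.ne'
  set q := Q⁻¹ with hq
  have hq0 : 0 < q := inv_pos.2 hQ0
  have hq1 : q < 1 := inv_lt_one_of_one_lt₀ hQ
  have hM : 0 ≤ M := (norm_nonneg _).trans (h 0)
  have hqn : ‖(Q : ℂ)⁻¹‖ = q := by rw [norm_inv, Complex.norm_real, norm_eq_abs, abs_of_pos hQ0]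
  set D : ℕ → ℂ := fun n => V (n + 1) - Q * V n with hD
  set B := ‖D 0‖ + M / (1 - q) with hB
  have hB0 : 0 ≤ M / (1 - q) := div_nonneg hM (by linarith)
  have hDb : ∀ n, ‖D n‖ ≤ B := by
    intro n
    induction n with
    | zero => linarith
    | succ n ih =>
      have e : D (n + 1) = (Q : ℂ)⁻¹ * D n +
          (V (n + 2) - (Q + (Q : ℂ)⁻¹) * V (n + 1) + V n) := by
        simp only [hD]
        field_simp
        ring
      have h1 : ‖D (n + 1)‖ ≤ q * B + M := by
        rw [e]
        refine (norm_add_le _ _).trans (add_le_add ?_ (h n))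
        rw [norm_mul, hqn]
        gcongr
      have h2 : (1 - q) * (M / (1 - q)) = M := mul_div_cancel₀ _ (by linarith)
      have h3 : 0 ≤ (1 - q) * ‖D 0‖ := mul_nonneg (by linarith) (norm_nonneg _)
      have h4 : (1 - q) * B = (1 - q) * ‖D 0‖ + M := by rw [hB, mul_add, h2]
      linarith
  set B' := q * B / (1 - q) with hB'
  have hB'e : q * B + q * B' = B' := by
    have : 1 - q ≠ 0 := by linarith
    rw [hB']
    field_simp
    ring
  have hstep : ∀ n, ‖V n‖ - B' ≤ q * (‖V (n + 1)‖ - B') := by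
    intro n
    have e : V n = (Q : ℂ)⁻¹ * (V (n + 1) - D n) := by
      simp only [hD]; field_simp; ring
    have h1 : ‖V n‖ ≤ q * (‖V (n + 1)‖ + B) := by
      rw [e, norm_mul, hqn]
      gcongr
      exact (norm_sub_le _ _).trans (by linarith [hDb n])
    linarith
  have hiter : ∀ n j, ‖V n‖ - B' ≤ q ^ j * (‖V (n + j)‖ - B') := by
    intro n j
    induction j with
    | zero => simp
    | succ j ih =>
      refine ih.trans ?_
      rw [pow_succ, mul_assoc]
      exact mul_le_mul_of_nonneg_left (hstep (n + j)) (by positivity)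
  have hB'0 : 0 ≤ B' := div_nonneg (mul_nonneg hq0.le (add_nonneg (norm_nonneg _) hB0)) (by linarith)
  refine ⟨B', fun n => ?_⟩
  have hlim : Tendsto (fun j => Q ^ n * (‖V (j + n)‖ / Q ^ (j + n))) atTop (𝓝 0) := by
    simpa using ((tendsto_add_atTop_iff_nat n).2 ht).const_mul (Q ^ n)
  have h1 : ‖V n‖ - B' ≤ 0 := by
    refine ge_of_tendsto hlim (Eventually.of_forall fun j => (hiter n j).trans ?_)
    have e : Q ^ n * (‖V (j + n)‖ / Q ^ (j + n)) = q ^ j * ‖V (n + j)‖ := by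
      rw [hq, add_comm n j, pow_add, inv_pow]
      field_simp
    rw [e]
    gcongr
    linarith
  linarith

theorem bounded_of_recurrence {V : ℤ → ℂ} {Q M : ℝ} (hQ : 1 < Q)
    (h : ∀ n, ‖V (n + 1) - (Q + (Q : ℂ)⁻¹) * V n + V (n - 1)‖ ≤ M)
    (h1 : Tendsto (fun n : ℕ => ‖V n‖ / Q ^ n) atTop (𝓝 0))
    (h2 : Tendsto (fun n : ℕ => ‖V (-n)‖ / Q ^ n) atTop (𝓝 0)) : ∃ C, ∀ n, ‖V n‖ ≤ C := by
  obtain ⟨A, hA⟩ := bounded_of_recurrence_nat (V := fun n => V n) hQ (fun n => by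
    have := h (n + 1)
    rw [add_sub_cancel_right, add_assoc] at this
    exact_mod_cast this) h1
  obtain ⟨B, hB⟩ := bounded_of_recurrence_nat (V := fun n => V (-n)) hQ (fun n => by
    have := h (-(n + 1))
    rw [show -((n : ℤ) + 1) + 1 = -n by ring, show -((n : ℤ) + 1) - 1 = -(n + 2) by ring] at this
    refine le_trans (le_of_eq ?_) this
    congr 1
    push_cast
    ring) h2
  refine ⟨max A B, fun n => ?_⟩
  obtain ⟨k, rfl | rfl⟩ := n.eq_nat_or_neg
  · exact (hA k).trans (le_max_left _ _)
  · exact (hB k).trans (le_max_right _ _)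

end

/-! ### Fourier coefficients on circles. -/

section
open Filter Topology Real

/-- The coefficient of `t ^ n` of a function on the circle of radius `ρ`. -/
def circleCoeff (h : ℂ → ℂ) (ρ : ℝ) (n : ℤ) : ℂ :=
  (2 * π : ℂ)⁻¹ * ∫ θ in (0 : ℝ)..2 * π, h (circleMap 0 ρ θ) * (circleMap 0 ρ θ) ^ (-n)

section

variable {ρ : ℝ} {g h k : ℂ → ℂ}

theorem two_pi_ne_zero_complex : (2 * π : ℂ) ≠ 0 := by simp [pi_ne_zero]

theorem circleMap_zero_ne_zero (hρ : 0 < ρ) (θ : ℝ) : circleMap 0 ρ θ ≠ 0 :=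
  circleMap_ne_center hρ.ne'

theorem norm_circleMap_zero' (hρ : 0 < ρ) (θ : ℝ) : ‖circleMap 0 ρ θ‖ = ρ := by
  rw [norm_circleMap_zero, abs_of_pos hρ]

theorem continuous_circleMap_zpow (hρ : 0 < ρ) (n : ℤ) :
    Continuous fun θ => (circleMap 0 ρ θ) ^ n :=
  (continuous_circleMap 0 ρ).zpow₀ n fun θ => Or.inl (circleMap_zero_ne_zero hρ θ)

theorem intervalIntegrable_circleCoeff (hρ : 0 < ρ) (hh : Continuous fun θ => h (circleMap 0 ρ θ))
    (n : ℤ) : IntervalIntegrable (fun θ => h (circleMap 0 ρ θ) * (circleMap 0 ρ θ) ^ (-n))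
      MeasureTheory.volume 0 (2 * π) :=
  (hh.mul (continuous_circleMap_zpow hρ (-n))).intervalIntegrable _ _

theorem circleCoeff_congr {n : ℤ} (e : ∀ θ, g (circleMap 0 ρ θ) = h (circleMap 0 ρ θ)) :
    circleCoeff g ρ n = circleCoeff h ρ n := by
  unfold circleCoeff
  simp only [e]

theorem circleCoeff_add (hρ : 0 < ρ) (hg : Continuous fun θ => g (circleMap 0 ρ θ))
    (hh : Continuous fun θ => h (circleMap 0 ρ θ)) (n : ℤ) :
    circleCoeff (fun t => g t + h t) ρ n = circleCoeff g ρ n + circleCoeff h ρ n := by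
  unfold circleCoeff
  rw [← mul_add, ← intervalIntegral.integral_add (intervalIntegrable_circleCoeff hρ hg n)
    (intervalIntegrable_circleCoeff hρ hh n)]
  simp only [add_mul]

theorem circleCoeff_const_mul (c : ℂ) (n : ℤ) :
    circleCoeff (fun t => c * h t) ρ n = c * circleCoeff h ρ n := by
  unfold circleCoeff
  simp only [mul_assoc, intervalIntegral.integral_const_mul]
  ring

theorem circleCoeff_sub (hρ : 0 < ρ) (hg : Continuous fun θ => g (circleMap 0 ρ θ))
    (hh : Continuous fun θ => h (circleMap 0 ρ θ)) (n : ℤ) :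
    circleCoeff (fun t => g t - h t) ρ n = circleCoeff g ρ n - circleCoeff h ρ n := by
  have := circleCoeff_add (h := fun t => -1 * h t) hρ hg (continuous_const.mul hh) n
  rw [circleCoeff_const_mul] at this
  rw [sub_eq_add_neg, ← neg_one_mul, ← this]
  exact circleCoeff_congr fun θ => by ring

theorem circleCoeff_id_mul (hρ : 0 < ρ) (n : ℤ) :
    circleCoeff (fun t => t * h t) ρ n = circleCoeff h ρ (n - 1) := by
  unfold circleCoeff
  congr 2
  ext θ
  have h0 := circleMap_zero_ne_zero hρ θ
  rw [show -(n - 1) = 1 + -n by ring, zpow_add₀ h0, zpow_one]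
  ring

theorem circleCoeff_inv_mul (hρ : 0 < ρ) (n : ℤ) :
    circleCoeff (fun t => t⁻¹ * h t) ρ n = circleCoeff h ρ (n + 1) := by
  unfold circleCoeff
  congr 2
  ext θ
  have h0 := circleMap_zero_ne_zero hρ θ
  rw [show -(n + 1) = -1 + -n by ring, zpow_add₀ h0, zpow_neg_one]
  ring

theorem circleCoeff_conj (hρ : 0 < ρ) (n : ℤ) :
    circleCoeff (fun t => (starRingEnd ℂ) (h t)) ρ n =
      (ρ : ℂ) ^ (-2 * n) * (starRingEnd ℂ) (circleCoeff h ρ (-n)) := by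
  have hρ' : (ρ : ℂ) ≠ 0 := by exact_mod_cast hρ.ne'
  unfold circleCoeff
  rw [map_mul, map_inv₀, map_mul, map_ofNat, Complex.conj_ofReal,
    intervalIntegral.integral_of_le two_pi_pos.le, intervalIntegral.integral_of_le two_pi_pos.le,
    ← integral_conj, mul_left_comm ((ρ : ℂ) ^ _), ← MeasureTheory.integral_const_mul ((ρ : ℂ) ^ _)]
  congr 1
  refine MeasureTheory.integral_congr_ae (Eventually.of_forall fun θ => ?_)
  simp only
  have h0 := circleMap_zero_ne_zero hρ θ
  have h1 : (starRingEnd ℂ) (circleMap 0 ρ θ) = (ρ : ℂ) ^ (2 : ℤ) * (circleMap 0 ρ θ)⁻¹ := by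
    rw [eq_mul_inv_iff_mul_eq₀ h0, Complex.conj_mul', norm_circleMap_zero' hρ]
    norm_cast
  rw [map_mul, map_zpow₀, h1, neg_neg, mul_zpow, ← zpow_mul, inv_zpow', mul_left_comm, ← mul_assoc
    ((ρ : ℂ) ^ (-2 * n)), ← zpow_add₀ hρ']
  simp

theorem norm_circleCoeff_le (hρ : 0 < ρ) {ε : ℝ} (hh : ∀ θ, ‖h (circleMap 0 ρ θ)‖ ≤ ε) (n : ℤ) :
    ‖circleCoeff h ρ n‖ ≤ ε * ρ ^ (-n) := by
  unfold circleCoeff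
  have h1 : ‖∫ θ in (0 : ℝ)..2 * π, h (circleMap 0 ρ θ) * (circleMap 0 ρ θ) ^ (-n)‖ ≤
      ε * ρ ^ (-n) * |2 * π - 0| := by
    refine intervalIntegral.norm_integral_le_of_norm_le_const fun θ _ => ?_
    rw [norm_mul, norm_zpow, norm_circleMap_zero' hρ]
    gcongr
    exact hh θ
  have h2 : ‖(2 * π : ℂ)⁻¹‖ = (2 * π)⁻¹ := by
    rw [norm_inv, norm_mul, Complex.norm_real, norm_eq_abs, abs_of_pos pi_pos]
    simp
  rw [norm_mul, h2]
  rw [sub_zero, abs_of_pos two_pi_pos] at h1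
  calc _ ≤ (2 * π)⁻¹ * (ε * ρ ^ (-n) * (2 * π)) := by gcongr
    _ = _ := by field_simp

theorem circleCoeff_eq_circleIntegral (hρ : 0 < ρ) (n : ℤ) :
    circleCoeff h ρ n =
      (2 * π * Complex.I)⁻¹ * ∮ t in C(0, ρ), h t * t ^ (-n - 1) := by
  unfold circleCoeff circleIntegral
  rw [mul_inv (2 * π : ℂ) Complex.I, mul_assoc _ Complex.I⁻¹,
    ← intervalIntegral.integral_const_mul Complex.I⁻¹]
  congr 1
  refine intervalIntegral.integral_congr (E := ℂ) fun θ _ => ?_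
  have h0 := circleMap_zero_ne_zero hρ θ
  have := Complex.I_ne_zero
  simp only
  rw [deriv_circleMap, smul_eq_mul, zpow_sub_one₀ h0]
  field_simp

/-- Cauchy's theorem: for holomorphic functions the normalised coefficient does not depend on the
radius. -/
theorem circleCoeff_eq_of_differentiableOn {r R : ℝ} (hr : 0 < r) (hrR : r ≤ R)
    (hd : DifferentiableOn ℂ h {t | r ≤ ‖t‖ ∧ ‖t‖ ≤ R})
    (n : ℤ) : circleCoeff h R n = circleCoeff h r n := by
  rw [circleCoeff_eq_circleIntegral hr, circleCoeff_eq_circleIntegral (hr.trans_le hrR)]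
  have hne : ∀ t : ℂ, r ≤ ‖t‖ → t ≠ 0 := fun t ht => norm_pos_iff.1 (hr.trans_le ht)
  have hd' : DifferentiableOn ℂ (fun t => h t * t ^ (-n - 1)) {t | r ≤ ‖t‖ ∧ ‖t‖ ≤ R} :=
    hd.mul fun t ht => (differentiableAt_zpow.2 (Or.inl (hne t ht.1))).differentiableWithinAt
  congr 1
  refine Complex.circleIntegral_eq_of_differentiable_on_annulus_off_countable hr hrR
    Set.countable_empty (hd'.continuousOn.mono fun t ht => ?_) fun t ht => ?_
  · simpa [and_comm] using ht
  · have ht' : r < ‖t‖ ∧ ‖t‖ < R := by simpa [and_comm] using ht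
    refine hd'.differentiableAt ?_
    filter_upwards [continuous_norm.continuousAt.eventually (lt_mem_nhds ht'.1),
      continuous_norm.continuousAt.eventually (gt_mem_nhds ht'.2)] with w h1 h2
    exact ⟨h1.le, h2.le⟩

theorem circleCoeff_eq_of_mem_openAnnulus {s x y : ℝ} (hd : DifferentiableOn ℂ h (openAnnulus s))
    (hx : |x| < s) (hy : |y| < s) (n : ℤ) :
    circleCoeff h (exp x) n = circleCoeff h (exp y) n := by
  wlog hxy : y ≤ x generalizing x y
  · exact (this hy hx (le_of_not_ge hxy)).symm
  refine circleCoeff_eq_of_differentiableOn (exp_pos _) (exp_le_exp.2 hxy) (hd.mono fun t ht => ?_) n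
  exact ⟨(exp_lt_exp.2 (abs_lt.1 hy).1).trans_le ht.1, ht.2.trans_lt (exp_lt_exp.2 (abs_lt.1 hx).2)⟩

/-- Integration by parts in the angle. For n = 0 it only says that the mean of g vanishes; the mean
of h needs `circleCoeff_zero_sub`. -/
theorem mul_circleCoeff (hρ : 0 < ρ) (hg : Continuous fun θ => g (circleMap 0 ρ θ))
    (hd : ∀ θ, HasDerivAt (fun θ => h (circleMap 0 ρ θ)) (Complex.I * g (circleMap 0 ρ θ)) θ)
    (n : ℤ) : n * circleCoeff h ρ n = circleCoeff g ρ n := by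
  have hh : Continuous fun θ => h (circleMap 0 ρ θ) :=
    continuous_iff_continuousAt.2 fun θ => (hd θ).continuousAt
  have i1 := (intervalIntegrable_circleCoeff hρ hg n).const_mul Complex.I
  have i2 := (intervalIntegrable_circleCoeff hρ hh n).const_mul (Complex.I * n)
  have h1 : ∀ θ, HasDerivAt (fun θ => h (circleMap 0 ρ θ) * (circleMap 0 ρ θ) ^ (-n))
      (Complex.I * (g (circleMap 0 ρ θ) * (circleMap 0 ρ θ) ^ (-n)) -
        Complex.I * n * (h (circleMap 0 ρ θ) * (circleMap 0 ρ θ) ^ (-n))) θ := by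
    intro θ
    have h0 := circleMap_zero_ne_zero hρ θ
    have h2 := (hasDerivAt_zpow (-n) (circleMap 0 ρ θ) (Or.inl h0)).comp θ
      (hasDerivAt_circleMap 0 ρ θ)
    refine ((hd θ).mul h2).congr_deriv ?_
    rw [zpow_sub_one₀ h0]
    push_cast
    simp only [Function.comp]
    field_simp
    ring
  have h3 := intervalIntegral.integral_eq_sub_of_hasDerivAt (a := 0) (b := 2 * π)
    (fun θ _ => h1 θ) (i1.sub i2)
  have h4 : circleMap 0 ρ (2 * π) = circleMap 0 ρ 0 := by
    have := periodic_circleMap 0 ρ 0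
    rwa [zero_add] at this
  rw [h4, sub_self, intervalIntegral.integral_sub i1 i2,
    intervalIntegral.integral_const_mul, intervalIntegral.integral_const_mul] at h3
  unfold circleCoeff
  have h5 := mul_left_cancel₀ Complex.I_ne_zero
    (show Complex.I * (∫ θ in (0 : ℝ)..2 * π, g (circleMap 0 ρ θ) * (circleMap 0 ρ θ) ^ (-n)) =
      Complex.I * (n * ∫ θ in (0 : ℝ)..2 * π, h (circleMap 0 ρ θ) * (circleMap 0 ρ θ) ^ (-n)) by
        linear_combination h3)
  rw [h5]
  ring

/-- A continuous function on a circle all of whose coefficients vanish is zero. -/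
theorem eq_zero_of_circleCoeff_eq_zero (hρ : 0 < ρ)
    (hc : ContinuousOn h (Metric.sphere 0 ρ)) (h0 : ∀ n, circleCoeff h ρ n = 0) {t : ℂ}
    (ht : ‖t‖ = ρ) : h t = 0 := by
  have : Fact (0 < 2 * π) := ⟨two_pi_pos⟩
  have hmem : ∀ x : AddCircle (2 * π), (ρ * AddCircle.toCircle x : ℂ) ∈ Metric.sphere (0 : ℂ) ρ := by
    intro x
    rw [mem_sphere_zero_iff_norm, norm_mul, Circle.norm_coe, Complex.norm_real, norm_eq_abs,
      abs_of_pos hρ, mul_one]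
  have hcont : Continuous fun x : AddCircle (2 * π) => h (ρ * AddCircle.toCircle x) := by
    refine hc.comp_continuous ?_ hmem
    exact continuous_const.mul (continuous_subtype_val.comp AddCircle.continuous_toCircle)
  set f : C(AddCircle (2 * π), ℂ) := ⟨_, hcont⟩ with hf
  have hmap : ∀ θ : ℝ, (ρ * AddCircle.toCircle (θ : AddCircle (2 * π)) : ℂ) = circleMap 0 ρ θ := by
    intro θ
    rw [AddCircle.toCircle_apply_mk, circleMap, zero_add, Circle.coe_exp]
    congr 2
    have := two_pi_pos.ne'
    field_simp
  have hcoef : ∀ n, fourierCoeff f n = 0 := by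
    intro n
    rw [fourierCoeff_eq_intervalIntegral f n 0]
    have h1 := h0 n
    unfold circleCoeff at h1
    have h2 := (mul_eq_zero.1 h1).resolve_left (inv_ne_zero two_pi_ne_zero_complex)
    have h3 : ∀ θ : ℝ, @fourier (2 * π) (-n) (θ : AddCircle (2 * π)) • f θ =
        (ρ : ℂ) ^ n * (h (circleMap 0 ρ θ) * (circleMap 0 ρ θ) ^ (-n)) := by
      intro θ
      have h4 : f θ = h (circleMap 0 ρ θ) := congrArg h (hmap θ)
      have hρ' : (ρ : ℂ) ≠ 0 := by exact_mod_cast hρ.ne'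
      rw [h4, ← hmap θ, mul_zpow, fourier_apply, AddCircle.toCircle_zsmul, smul_eq_mul]
      rw [show ∀ a b c d : ℂ, a * (b * (c * d)) = (a * c) * (b * d) by intros; ring,
        ← zpow_add₀ hρ']
      simp [mul_comm]
    simp only [h3]
    rw [zero_add, intervalIntegral.integral_const_mul, h2, mul_zero, smul_zero]
  have hs : Summable (fourierCoeff f) := by
    rw [show fourierCoeff f = fun _ => 0 from funext hcoef]; exact summable_zero
  have hval := has_pointwise_sum_fourier_series_of_summable hs (Complex.arg t : AddCircle (2 * π))
  simp only [hcoef, zero_smul] at hval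
  have h5 := hval.unique hasSum_zero
  have h6 : f (Complex.arg t : AddCircle (2 * π)) = h (circleMap 0 ρ (Complex.arg t)) :=
    congrArg h (hmap _)
  rw [h6] at h5
  have h7 : circleMap 0 ρ (Complex.arg t) = t := by
    rw [circleMap, zero_add, ← ht, Complex.norm_mul_exp_arg_mul_I]
  rwa [h7] at h5

theorem circleMap_exp_mem {s x : ℝ} (hx : |x| < s) (θ : ℝ) :
    circleMap 0 (exp x) θ ∈ openAnnulus s := by
  unfold openAnnulus
  rw [Set.mem_ofPred_eq, norm_circleMap_zero' (exp_pos x), exp_lt_exp, exp_lt_exp]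
  exact abs_lt.1 hx

theorem continuous_comp_circleMap_exp {s x : ℝ} (hh : ContinuousOn h (openAnnulus s))
    (hx : |x| < s) : Continuous fun θ => h (circleMap 0 (exp x) θ) :=
  hh.comp_continuous (continuous_circleMap 0 _) fun θ => circleMap_exp_mem hx θ

theorem circleMap_exp_ne_one {x : ℝ} (hx : x ≠ 0) (θ : ℝ) : circleMap 0 (exp x) θ ≠ 1 := by
  intro h
  have := norm_circleMap_zero' (exp_pos x) θ
  rw [h, norm_one] at this
  exact hx (exp_eq_one_iff x |>.1 this.symm)

theorem circleMap_ne_one {ρ θ : ℝ} (hρ : 0 < ρ) (h1 : 0 < θ) (h2 : θ < 2 * π) :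
    circleMap 0 ρ θ ≠ 1 := by
  intro h
  have h3 := norm_circleMap_zero' hρ θ
  rw [h, norm_one] at h3
  rw [← h3, circleMap, zero_add, Complex.ofReal_one, one_mul, Complex.exp_eq_one_iff] at h
  obtain ⟨n, hn⟩ := h
  have h4 : (θ : ℂ) = n * (2 * π) := mul_right_cancel₀ Complex.I_ne_zero (by rw [hn]; ring)
  have h5 : θ = n * (2 * π) := by exact_mod_cast h4
  have hp := two_pi_pos
  have h6 : 0 < n := by
    by_contra! hn
    have : (n : ℝ) ≤ 0 := by exact_mod_cast hn
    nlinarith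
  have h7 : n < 1 := by
    by_contra! hn
    have : (1 : ℝ) ≤ n := by exact_mod_cast hn
    nlinarith
  omega

/-- The mean over circles of a function on the annulus, differentiable outside the point `1`, in
terms of the means of its two Wirtinger derivatives. -/
theorem circleCoeff_zero_sub {U : ℂ → ℂ} {s x y : ℝ} {c d : ℂ} (hg : ContinuousOn g (openAnnulus s))
    (hk : ContinuousOn k (openAnnulus s))
    (hd : ∀ t ∈ openAnnulus s, t ≠ 1 →
      HasFDerivAt U (wirtinger (g t / t) ((starRingEnd ℂ) (k t / t))) t)
    (hx : |x| < s) (hy : |y| < s) (hx0 : x ≠ 0) (hy0 : y ≠ 0) (hxy : x ≤ y)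
    (hc : ∀ r, |r| < s → circleCoeff g (exp r) 0 = c)
    (hc' : ∀ r, |r| < s → circleCoeff k (exp r) 0 = d) :
    circleCoeff U (exp y) 0 - circleCoeff U (exp x) 0 = (y - x) * (c + (starRingEnd ℂ) d) := by
  have hI : ∀ r ∈ Set.Icc x y, |r| < s := fun r hr =>
    abs_lt.2 ⟨(abs_lt.1 hx).1.trans_le hr.1, hr.2.trans_lt (abs_lt.1 hy).2⟩
  set F : ℝ → ℝ → ℂ := fun r θ =>
    g (circleMap 0 (exp r) θ) + (starRingEnd ℂ) (k (circleMap 0 (exp r) θ)) with hF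
  have hmap : Continuous fun p : ℝ × ℝ => circleMap 0 (exp p.1) p.2 := by
    unfold circleMap; fun_prop
  have hFc : ContinuousOn (Function.uncurry F) (Set.Icc x y ×ˢ Set.Icc 0 (2 * π)) := by
    have hm : Set.MapsTo (fun p : ℝ × ℝ => circleMap 0 (exp p.1) p.2)
        (Set.Icc x y ×ˢ Set.Icc 0 (2 * π)) (openAnnulus s) :=
      fun p hp => circleMap_exp_mem (hI _ hp.1) _
    exact (hg.comp hmap.continuousOn hm).add
      (Complex.continuous_conj.comp_continuousOn (hk.comp hmap.continuousOn hm))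
  have hcurve : ∀ θ r : ℝ, HasDerivAt (fun r => circleMap 0 (exp r) θ) (circleMap 0 (exp r) θ) r := by
    intro θ r
    have h1 := ((Real.hasDerivAt_exp r).ofReal_comp).mul_const (Complex.exp (θ * Complex.I))
    refine (h1.congr_of_eventuallyEq (Eventually.of_forall fun w => ?_)).congr_deriv ?_ <;>
    simp [circleMap]
  -- Only the ray of angle 0 meets the exceptional point 1, so the radial fundamental theorem of
  -- calculus holds for almost every angle.
  have hFTC : ∀ θ, 0 < θ → θ < 2 * π → ∫ r in x..y, F r θ =
      U (circleMap 0 (exp y) θ) - U (circleMap 0 (exp x) θ) := by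
    intro θ h1 h2
    refine intervalIntegral.integral_eq_sub_of_hasDerivAt
      (f := fun r => U (circleMap 0 (exp r) θ)) (fun r hr => ?_) ?_
    · rw [Set.uIcc_of_le hxy] at hr
      have h0 := circleMap_zero_ne_zero (exp_pos r) θ
      have h3 := (hd _ (circleMap_exp_mem (hI r hr) θ)
        (circleMap_ne_one (exp_pos r) h1 h2)).comp_hasDerivAt r (hcurve θ r)
      refine h3.congr_deriv ?_
      rw [wirtinger_apply, div_mul_cancel₀ _ h0, ← map_mul, div_mul_cancel₀ _ h0]
    · have hm : ContinuousOn (fun r : ℝ => (r, θ)) (Set.Icc x y) := by fun_prop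
      exact (hFc.comp hm fun r hr => ⟨hr, h1.le, h2.le⟩).intervalIntegrable_of_Icc hxy
  have hswap : ∫ r in x..y, ∫ θ in (0 : ℝ)..2 * π, F r θ =
      ∫ θ in (0 : ℝ)..2 * π, ∫ r in x..y, F r θ := by
    refine MeasureTheory.intervalIntegral_intervalIntegral_swap ?_
    rw [Set.uIoc_of_le hxy, Set.uIoc_of_le two_pi_pos.le]
    exact (hFc.integrableOn_compact (isCompact_Icc.prod isCompact_Icc)).mono_set
      (Set.prod_mono Set.Ioc_subset_Icc_self Set.Ioc_subset_Icc_self)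
  have hUc : ∀ r, |r| < s → r ≠ 0 → Continuous fun θ => U (circleMap 0 (exp r) θ) := by
    intro r hr hr0
    refine continuous_iff_continuousAt.2 fun θ => ?_
    exact ContinuousAt.comp (f := circleMap 0 (exp r))
      (hd _ (circleMap_exp_mem hr θ) (circleMap_exp_ne_one hr0 θ)).continuousAt
      (continuous_circleMap 0 _).continuousAt
  have h0 : ∀ (h : ℂ → ℂ) r, circleCoeff h (exp r) 0 =
      (2 * π : ℂ)⁻¹ * ∫ θ in (0 : ℝ)..2 * π, h (circleMap 0 (exp r) θ) := by
    intro h r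
    simp [circleCoeff]
  have hmean : ∀ r ∈ Set.uIcc x y, ∫ θ in (0 : ℝ)..2 * π, F r θ =
      2 * π * (c + (starRingEnd ℂ) d) := by
    intro r hr
    rw [Set.uIcc_of_le hxy] at hr
    have hgr := continuous_comp_circleMap_exp hg (hI r hr)
    have hkr := continuous_comp_circleMap_exp hk (hI r hr)
    have h1 := circleCoeff_add (exp_pos r) hgr (h := fun t => (starRingEnd ℂ) (k t))
      (Complex.continuous_conj.comp hkr) 0
    rw [circleCoeff_conj (exp_pos r), hc r (hI r hr), neg_zero, hc' r (hI r hr), mul_zero, zpow_zero,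
      one_mul, h0] at h1
    rw [← h1, mul_inv_cancel_left₀ two_pi_ne_zero_complex]
  rw [intervalIntegral.integral_congr hmean, intervalIntegral.integral_const] at hswap
  have hlast : ∫ θ in (0 : ℝ)..2 * π, ∫ r in x..y, F r θ =
      ∫ θ in (0 : ℝ)..2 * π, (U (circleMap 0 (exp y) θ) - U (circleMap 0 (exp x) θ)) := by
    rw [intervalIntegral.integral_of_le two_pi_pos.le, intervalIntegral.integral_of_le two_pi_pos.le,
      MeasureTheory.integral_Ioc_eq_integral_Ioo, MeasureTheory.integral_Ioc_eq_integral_Ioo]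
    exact MeasureTheory.setIntegral_congr_fun measurableSet_Ioo fun θ hθ => hFTC θ hθ.1 hθ.2
  rw [hlast, intervalIntegral.integral_sub ((hUc y hy hy0).intervalIntegrable _ _)
    ((hUc x hx hx0).intervalIntegrable _ _)] at hswap
  rw [h0, h0, ← mul_sub, ← hswap, Complex.real_smul]
  have := two_pi_ne_zero_complex
  push_cast
  field_simp

end

end

/-! ### The boundary system for the coefficients has only the zero solution. -/

section
open Filter Topology Real

theorem ofReal_exp_zpow (s : ℝ) (n : ℤ) :
    ((exp (2 * s) : ℝ) : ℂ) ^ n = ((exp (2 * n * s) : ℝ) : ℂ) := by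
  rw [← Complex.ofReal_zpow, ← rpow_intCast, ← exp_mul]
  congr 2
  ring

theorem bounded_of_tendsto_zero {G : ℤ → ℂ} (h1 : Tendsto (fun n : ℕ => G n) atTop (𝓝 0))
    (h2 : Tendsto (fun n : ℕ => G (-n)) atTop (𝓝 0)) : ∃ C, ∀ n, ‖G n‖ ≤ C := by
  obtain ⟨A, hA⟩ := h1.norm.bddAbove_range
  obtain ⟨B, hB⟩ := h2.norm.bddAbove_range
  refine ⟨max A B, fun n => ?_⟩
  obtain ⟨k, rfl | rfl⟩ := n.eq_nat_or_neg
  · exact (hA ⟨k, rfl⟩).trans (le_max_left _ _)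
  · exact (hB ⟨k, rfl⟩).trans (le_max_right _ _)

/-- A sequence satisfying the boundary recurrence of the homogeneous problem vanishes. -/
theorem eq_zero_of_boundary_recurrence {s : ℝ} (hs : 0 < s) {G : ℤ → ℂ}
    (h1 : Tendsto (fun n : ℕ => G n) atTop (𝓝 0)) (h2 : Tendsto (fun n : ℕ => G (-n)) atTop (𝓝 0))
    (h : ∀ n, secondDiff (fun k => gapWeight s k * G k) n - gapConst s * (gapWeight s n * G n) =
      Complex.sinh (2 * s) * secondDiff (fun k => (starRingEnd ℂ) (G (-k))) n) (n : ℤ) :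
    G n = 0 := by
  set Q := exp (2 * s) with hQ
  have hQ1 : 1 < Q := one_lt_exp_iff.2 (by positivity)
  have hQ0 : 0 < Q := exp_pos _
  obtain ⟨B, hB⟩ := bounded_of_tendsto_zero h1 h2
  have hcosh : (Q : ℂ) + (Q : ℂ)⁻¹ = (gapConst s : ℂ) + 2 := by
    rw [hQ, ← Complex.ofReal_inv, ← exp_neg, gapConst, ← Complex.ofReal_add, cosh_eq]
    push_cast
    ring
  -- With G tending to 0 this makes mG of order o(Qⁿ), excluding the growing mode; so mG is bounded,
  -- as the maximum principle requires.
  have hw : ∀ n : ℕ, gapWeight s (n + 1 : ℕ) ≤ Q ^ (n + 1) := by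
    intro n
    have e := mul_gapWeight s (n + 1 : ℕ)
    have hp := gapWeight_pos hs (n + 1 : ℕ)
    have e2 : Q ^ (n + 1) = exp (2 * ((n + 1 : ℕ) : ℤ) * s) := by
      rw [hQ, ← exp_nat_mul]; congr 1; push_cast; ring
    have h3 : gapWeight s (n + 1 : ℕ) ≤ ((n + 1 : ℕ) : ℤ) * gapWeight s (n + 1 : ℕ) := by
      refine le_mul_of_one_le_left hp.le ?_
      push_cast
      linarith [(Nat.cast_nonneg n : (0 : ℝ) ≤ n)]
    refine h3.trans ?_
    rw [e, e2, sinh_eq]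
    linarith [exp_pos (-(2 * (((n + 1 : ℕ) : ℤ) : ℝ) * s)), exp_pos (2 * (((n + 1 : ℕ) : ℤ) : ℝ) * s)]
  have htend : ∀ F : ℕ → ℂ, Tendsto F atTop (𝓝 0) →
      Tendsto (fun n : ℕ => ‖(gapWeight s n : ℂ) * F n‖ / Q ^ n) atTop (𝓝 0) := by
    intro F hF
    rw [← tendsto_add_atTop_iff_nat 1]
    refine squeeze_zero (fun n => by positivity) (fun n => ?_)
      (by simpa using ((tendsto_add_atTop_iff_nat 1).2 hF).norm)
    rw [norm_mul, Complex.norm_real, norm_eq_abs, abs_of_pos (gapWeight_pos hs _),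
      div_le_iff₀ (by positivity), mul_comm]
    exact mul_le_mul_of_nonneg_left (hw n) (norm_nonneg _)
  obtain ⟨C, hC⟩ := bounded_of_recurrence (V := fun n => (gapWeight s n : ℂ) * G n)
    (M := ‖Complex.sinh (2 * s)‖ * (4 * B)) hQ1 (fun n => by
      have e : (gapWeight s (n + 1) : ℂ) * G (n + 1) - (Q + (Q : ℂ)⁻¹) * (gapWeight s n * G n) +
          gapWeight s (n - 1) * G (n - 1) =
          Complex.sinh (2 * s) * secondDiff (fun k => (starRingEnd ℂ) (G (-k))) n := by
        rw [← h n, hcosh]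
        unfold secondDiff
        ring
      rw [e, norm_mul]
      refine mul_le_mul_of_nonneg_left ?_ (norm_nonneg _)
      unfold secondDiff
      refine (norm_add_le _ _).trans ?_
      have e1 := norm_sub_le ((starRingEnd ℂ) (G (-(n + 1)))) (2 * (starRingEnd ℂ) (G (-n)))
      rw [norm_mul, RCLike.norm_conj, RCLike.norm_conj, Complex.norm_two] at e1
      rw [RCLike.norm_conj]
      linarith [hB (-(n + 1)), hB (-n), hB (-(n - 1))]) (htend _ h1)
      (by simpa only [gapWeight_neg] using htend _ h2)
  -- Conjugation turns the reflected equation into sign +1 for real parts and -1 for imaginary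
  -- parts.
  have hcomp : (∀ n, (G n).re = 0) ∧ ∀ n, (G n).im = 0 := by
    have hsc : Complex.sinh (2 * s) = ((sinh (2 * s) : ℝ) : ℂ) := by push_cast; rfl
    constructor
    · refine eq_zero_of_secondDiff_reflect hs (C := C) (ε := 1) (Or.inl rfl) (fun n => ?_) fun n => ?_
      · have := (Complex.abs_re_le_norm _).trans (hC n)
        rwa [Complex.re_ofReal_mul] at this
      · have := congrArg Complex.re (h n)
        unfold secondDiff at this ⊢
        rw [hsc] at this
        simp only [Complex.sub_re, Complex.add_re, Complex.conj_re, Complex.mul_re,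
          Complex.ofReal_re, Complex.ofReal_im, Complex.re_ofNat, Complex.im_ofNat, zero_mul, sub_zero] at this
        linear_combination this
    · refine eq_zero_of_secondDiff_reflect hs (C := C) (ε := -1) (Or.inr rfl) (fun n => ?_) fun n => ?_
      · have := (Complex.abs_im_le_norm _).trans (hC n)
        rwa [Complex.im_ofReal_mul] at this
      · have := congrArg Complex.im (h n)
        unfold secondDiff at this ⊢
        rw [hsc] at this
        simp only [Complex.sub_im, Complex.add_im, Complex.conj_im, Complex.mul_im,
          Complex.ofReal_re, Complex.ofReal_im, Complex.re_ofNat, Complex.im_ofNat, zero_mul, add_zero] at this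
        linear_combination this
  exact Complex.ext (hcomp.1 n) (hcomp.2 n)

/-- The boundary system for the Laurent coefficients of the two Goursat functions has only the
trivial solution. -/
theorem eq_zero_of_boundary_system {s : ℝ} (hs : 0 < s) {G K cp cm : ℤ → ℂ}
    (h1 : Tendsto (fun n : ℕ => G n) atTop (𝓝 0)) (h2 : Tendsto (fun n : ℕ => G (-n)) atTop (𝓝 0))
    (hp : ∀ n : ℤ, n * cp n = G n - (exp (2 * s) : ℂ) ^ (-n) * (starRingEnd ℂ) (K (-n)))
    (hm : ∀ n : ℤ, n * cm n = G n - (exp (2 * s) : ℂ) ^ n * (starRingEnd ℂ) (K (-n)))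
    (h0 : cp 0 - cm 0 = 4 * s * G 0)
    (hbp : ∀ n : ℤ, cp (n - 1) - cp n = -(1 / 2) * ((exp (2 * s) : ℂ) ^ (-(n - 1)) *
      secondDiff (fun k => (starRingEnd ℂ) (G (-k))) (n - 1) + (exp (2 * s) : ℂ) ^ (-n) *
      secondDiff (fun k => (starRingEnd ℂ) (G (-k))) n))
    (hbm : ∀ n : ℤ, cm (n - 1) - cm n = -(1 / 2) * ((exp (2 * s) : ℂ) ^ (n - 1) *
      secondDiff (fun k => (starRingEnd ℂ) (G (-k))) (n - 1) + (exp (2 * s) : ℂ) ^ n *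
      secondDiff (fun k => (starRingEnd ℂ) (G (-k))) n)) (n : ℤ) : G n = 0 ∧ K n = 0 := by
  set Q : ℂ := ((exp (2 * s) : ℝ) : ℂ) with hQ
  set D := secondDiff (fun k => (starRingEnd ℂ) (G (-k))) with hD
  have hQ0 : Q ≠ 0 := by rw [hQ]; exact_mod_cast (exp_pos _).ne'
  have hQ1 : Q ^ 2 - 1 ≠ 0 := by
    have : 1 < exp (2 * s) ^ 2 := one_lt_pow₀ (one_lt_exp_iff.2 (by positivity)) two_ne_zero
    rw [hQ]
    exact_mod_cast (sub_pos.2 this).ne'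
  -- With these normalisations K drops out of the difference: X_n - Y_n = 2 m_n G_n, where the case
  -- n = 0 is the hypothesis on the means.
  set X : ℤ → ℂ := fun n => Q ^ n * cp n with hX
  set Y : ℤ → ℂ := fun n => Q ^ (-n) * cm n with hY
  have hV : ∀ n, X n - Y n = 2 * (gapWeight s n * G n) := by
    intro n
    rcases eq_or_ne n 0 with rfl | hn
    · simp only [hX, hY, neg_zero, zpow_zero, one_mul, h0, gapWeight_zero]
      push_cast
      ring
    · have hn' : (n : ℂ) ≠ 0 := by exact_mod_cast hn
      apply mul_left_cancel₀ hn'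
      have e1 : (n : ℂ) * (gapWeight s n : ℂ) = (Q ^ n - Q ^ (-n)) / 2 := by
        have := congrArg (fun x : ℝ => (x : ℂ)) (mul_gapWeight s n)
        simp only [sinh_eq] at this
        rw [hQ, ofReal_exp_zpow, ofReal_exp_zpow]
        push_cast at this ⊢
        rw [this]
        congr 3
        ring_nf
      have e2 : Q ^ n * Q ^ (-n) = 1 := by rw [← zpow_add₀ hQ0]; simp
      simp only [hX, hY]
      linear_combination Q ^ n * hp n - Q ^ (-n) * hm n - 2 * G n * e1
  have hbX : ∀ n, Q * X (n - 1) - X n = -(1 / 2) * (Q * D (n - 1) + D n) := by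
    intro n
    have e2 : Q ^ n * Q ^ (-n) = 1 := by rw [← zpow_add₀ hQ0]; simp
    have e3 : Q * Q ^ (n - 1) = Q ^ n := by rw [mul_comm, ← zpow_add_one₀ hQ0]; simp
    have e4 : Q ^ n * Q ^ (-(n - 1)) = Q := by rw [← zpow_add₀ hQ0]; simp
    simp only [hX]
    linear_combination Q ^ n * hbp n + cp (n - 1) * e3 - D (n - 1) / 2 * e4 - D n / 2 * e2
  have hbY : ∀ n, Y (n - 1) - Q * Y n = -(1 / 2) * (D (n - 1) + Q * D n) := by
    intro n
    have e2 : Q ^ (-n) * Q ^ n = 1 := by rw [← zpow_add₀ hQ0]; simp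
    have e3 : Q * Q ^ (-n) = Q ^ (-(n - 1)) := by
      rw [mul_comm, ← zpow_add_one₀ hQ0]; congr 1; ring
    have e4 : Q ^ (-(n - 1)) * Q ^ (n - 1) = 1 := by rw [← zpow_add₀ hQ0]; simp
    have e5 : Q * Q ^ (-n) * Q ^ (n - 1) = 1 := by rw [e3, e4]
    simp only [hY]
    linear_combination Q * Q ^ (-n) * hbm n - cm (n - 1) * e3 - D (n - 1) / 2 * e5 -
      Q * D n / 2 * e2
  -- Eliminating X leaves Y in terms of mG and D; substituting this back into the inner boundary
  -- relation gives the recurrence for G alone.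
  have key : ∀ n, (Q ^ 2 - 1) * (Y n - D n / 2) =
      2 * (gapWeight s n * G n) - Q * (2 * (gapWeight s (n - 1) * G (n - 1))) := by
    intro n
    linear_combination hV n - Q * hV (n - 1) - Q * hbY n + hbX n
  have hG : ∀ n, G n = 0 := by
    refine eq_zero_of_boundary_recurrence hs h1 h2 fun n => ?_
    have k0 := key n
    have k1 := key (n + 1)
    have k2 := hbY (n + 1)
    rw [add_sub_cancel_right] at k1 k2
    have e1 : 2 * Q * Complex.sinh (2 * s) = Q ^ 2 - 1 := by
      have : Q * Complex.exp (-(2 * s)) = 1 := by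
        rw [hQ, Complex.ofReal_exp, ← Complex.exp_add]; simp
      rw [Complex.sinh]
      have e : Complex.exp (2 * s) = Q := by rw [hQ]; simp
      rw [e]
      linear_combination -this
    have e2 : Q * (gapConst s : ℂ) = Q ^ 2 + 1 - 2 * Q := by
      have : Q * Complex.exp (-(2 * s)) = 1 := by
        rw [hQ, Complex.ofReal_exp, ← Complex.exp_add]; simp
      have e : Complex.exp (2 * s) = Q := by rw [hQ]; simp
      rw [gapConst]
      push_cast
      rw [Complex.cosh, e]
      linear_combination this
    apply mul_left_cancel₀ (mul_ne_zero two_ne_zero hQ0)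
    change 2 * Q * (secondDiff (fun k => gapWeight s k * G k) n -
      gapConst s * (gapWeight s n * G n)) = 2 * Q * (Complex.sinh (2 * s) * D n)
    unfold secondDiff
    linear_combination (-2 * (gapWeight s n * G n)) * e2 - D n * e1 + k0 - Q * k1 -
      (Q ^ 2 - 1) * k2
  refine ⟨hG n, ?_⟩
  have hD0 : ∀ n, D n = 0 := fun n => by rw [hD]; unfold secondDiff; simp [hG]
  have hY0 : Y (-n) = 0 := by
    have := key (-n)
    rw [hG, hG, hD0] at this
    simpa [hQ1] using this
  have hcm : cm (-n) = 0 := by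
    have := (mul_eq_zero.1 hY0).resolve_left (zpow_ne_zero _ hQ0)
    exact this
  have := hm (-n)
  rw [hcm, hG, mul_zero, zero_sub, zero_eq_neg, neg_neg] at this
  have h3 := (mul_eq_zero.1 this).resolve_left (zpow_ne_zero _ hQ0)
  simpa using h3

end

/-! ### The homogeneous boundary value problem on the annulus. -/

section
open Filter Topology Real

theorem tendsto_circleCoeff_zero {h : ℂ → ℂ} {l : Filter ℝ} {x₀ : ℝ} (hl : l ≤ 𝓝 x₀)
    (hb : ∀ ε > 0, ∀ᶠ x in l, ∀ θ, ‖h (circleMap 0 (exp x) θ)‖ ≤ ε) (n : ℤ) :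
    Tendsto (fun x => circleCoeff h (exp x) n) l (𝓝 0) := by
  have hc : Tendsto (fun x => exp x ^ (-n)) l (𝓝 (exp x₀ ^ (-n))) :=
    ((continuous_exp.continuousAt (x := x₀)).zpow₀ (-n) (Or.inl (exp_pos _).ne')).tendsto.mono_left hl
  set M := exp x₀ ^ (-n) + 1 with hM
  have hM0 : 0 < M := by positivity
  rw [Metric.tendsto_nhds]
  intro ε hε
  filter_upwards [hb (ε / (2 * M)) (by positivity), hc.eventually (gt_mem_nhds (lt_add_one _))]
    with x h1 h2
  rw [dist_zero_right]
  have h3 := norm_circleCoeff_le (exp_pos x) h1 n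
  calc _ ≤ ε / (2 * M) * exp x ^ (-n) := h3
    _ ≤ ε / (2 * M) * M := by gcongr
    _ = ε / 2 := by field_simp
    _ < ε := by linarith

/-- Coefficients are independent of the radius; estimating them on radius exp(s/2) for positive
indices and exp(-s/2) for negative ones gives geometric decay. -/
theorem tendsto_circleCoeff_atTop {g : ℂ → ℂ} {s : ℝ} (hs : 0 < s)
    (hg : DifferentiableOn ℂ g (openAnnulus s)) :
    Tendsto (fun n : ℕ => circleCoeff g 1 n) atTop (𝓝 0) ∧
      Tendsto (fun n : ℕ => circleCoeff g 1 (-n)) atTop (𝓝 0) := by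
  have h0 : |(0 : ℝ)| < s := by simpa using hs
  have hx : |s / 2| < s := by rw [abs_of_pos (by positivity)]; linarith
  have hx' : |-(s / 2)| < s := by rwa [abs_neg]
  have hM : ∀ x : ℝ, |x| < s → ∃ M, ∀ n, ‖circleCoeff g 1 n‖ ≤ M * exp x ^ (-n) := by
    intro x hx
    have hc := hg.continuousOn.mono (show Metric.sphere (0 : ℂ) (exp x) ⊆ openAnnulus s from
      fun t ht => by
        rw [mem_sphere_zero_iff_norm] at ht
        unfold openAnnulus
        rw [Set.mem_ofPred_eq, ht, exp_lt_exp, exp_lt_exp]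
        exact abs_lt.1 hx)
    obtain ⟨M, hM⟩ := (isCompact_sphere (0 : ℂ) (exp x)).exists_bound_of_continuousOn hc
    refine ⟨M, fun n => ?_⟩
    have := circleCoeff_eq_of_mem_openAnnulus hg h0 hx n
    rw [exp_zero] at this
    rw [this]
    exact norm_circleCoeff_le (exp_pos x) (fun θ => hM _ (circleMap_mem_sphere 0 (exp_pos x).le θ)) n
  have hgeo : Tendsto (fun n : ℕ => exp (-(s / 2)) ^ n) atTop (𝓝 0) :=
    tendsto_pow_atTop_nhds_zero_of_lt_one (exp_pos _).le (exp_lt_one_iff.2 (by linarith))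
  obtain ⟨M, hM1⟩ := hM _ hx
  obtain ⟨N, hM2⟩ := hM _ hx'
  constructor
  · refine squeeze_zero_norm (fun n => (hM1 n).trans_eq ?_) (by simpa using hgeo.const_mul M)
    rw [zpow_neg, zpow_natCast, exp_neg, inv_pow]
  · refine squeeze_zero_norm (fun n => (hM2 (-n)).trans_eq ?_) (by simpa using hgeo.const_mul N)
    rw [neg_neg, zpow_natCast]

theorem ofReal_exp_zpow_two_mul (x : ℝ) (n : ℤ) :
    ((exp x : ℝ) : ℂ) ^ (-2 * n) = ((exp (2 * x) : ℝ) : ℂ) ^ (-n) := by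
  have : exp (2 * x) = exp x ^ (2 : ℤ) := by
    rw [two_mul, exp_add, zpow_two]
  rw [this, Complex.ofReal_zpow, ← zpow_mul]
  congr 1
  ring

/-- The homogeneous problem on the annulus has only the trivial solution. -/
theorem eq_zero_of_homogeneous {s a : ℝ} (hs : 0 < s) (ha : a ≠ 0) {w g k : ℂ → ℂ}
    (hg : DifferentiableOn ℂ g (openAnnulus s)) (hk : DifferentiableOn ℂ k (openAnnulus s))
    (hd : ∀ t ∈ openAnnulus s, t ≠ 1 → HasFDerivAt
      (fun t => w t + a * position t * (starRingEnd ℂ) (-(t - 1) ^ 2 / (2 * a * t) * g t))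
      (wirtinger (g t / t) ((starRingEnd ℂ) (k t / t))) t)
    (hb : ∀ ε > 0, ∀ᶠ x in 𝓝[<] s, ∀ θ, ‖w (circleMap 0 (exp x) θ)‖ ≤ ε)
    (hb' : ∀ ε > 0, ∀ᶠ x in 𝓝[>] (-s), ∀ θ, ‖w (circleMap 0 (exp x) θ)‖ ≤ ε) :
    ∀ t ∈ openAnnulus s, g t = 0 ∧ k t = 0 := by
  have ha' : (a : ℂ) ≠ 0 := by exact_mod_cast ha
  set P : ℂ → ℂ := fun t => -(t - 1) ^ 2 / (2 * a * t) * g t with hP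
  set U : ℂ → ℂ := fun t => w t + a * position t * (starRingEnd ℂ) (P t) with hU
  set G : ℤ → ℂ := circleCoeff g 1 with hG
  set K : ℤ → ℂ := circleCoeff k 1 with hK
  set D := secondDiff (fun k => (starRingEnd ℂ) (G (-k))) with hD
  have h0s : |(0 : ℝ)| < s := by simpa using hs
  have hGx : ∀ x, |x| < s → ∀ n, circleCoeff g (exp x) n = G n := fun x hx n => by
    rw [circleCoeff_eq_of_mem_openAnnulus hg hx h0s, exp_zero]
  have hKx : ∀ x, |x| < s → ∀ n, circleCoeff k (exp x) n = K n := fun x hx n => by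
    rw [circleCoeff_eq_of_mem_openAnnulus hk hx h0s, exp_zero]
  have hgc : ∀ x, |x| < s → Continuous fun θ => g (circleMap 0 (exp x) θ) := fun x hx =>
    continuous_comp_circleMap_exp hg.continuousOn hx
  have hkc : ∀ x, |x| < s → Continuous fun θ => k (circleMap 0 (exp x) θ) := fun x hx =>
    continuous_comp_circleMap_exp hk.continuousOn hx
  have hUc : ∀ x, |x| < s → x ≠ 0 → Continuous fun θ => U (circleMap 0 (exp x) θ) := by
    intro x hx hx0
    refine continuous_iff_continuousAt.2 fun θ => ?_
    exact ContinuousAt.comp (f := circleMap 0 (exp x))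
      (hd _ (circleMap_exp_mem hx θ) (circleMap_exp_ne_one hx0 θ)).continuousAt
      (continuous_circleMap 0 _).continuousAt
  have hcm : ∀ x, Continuous fun θ => circleMap 0 (exp x) θ := fun x => continuous_circleMap 0 _
  have hPc : ∀ x, |x| < s → Continuous fun θ => P (circleMap 0 (exp x) θ) := by
    intro x hx
    refine Continuous.mul (Continuous.div ?_ ?_ fun θ => ?_) (hgc x hx)
    · exact (((hcm x).sub continuous_const).pow 2).neg
    · exact continuous_const.mul (hcm x)
    · exact mul_ne_zero (mul_ne_zero two_ne_zero ha') (circleMap_zero_ne_zero (exp_pos x) θ)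
  have hcP : ∀ x, |x| < s → ∀ n, circleCoeff (fun t => (starRingEnd ℂ) (P t)) (exp x) n =
      -(1 / (2 * a)) * ((exp (2 * x) : ℂ) ^ (-n) * D n) := by
    intro x hx n
    have e1 : circleCoeff P (exp x) (-n) =
        -(1 / (2 * a)) * (G (-n - 1) - 2 * G (-n) + G (-n + 1)) := by
      have e2 : circleCoeff P (exp x) (-n) = circleCoeff
          (fun t => -(1 / (2 * a)) * ((t * g t - 2 * g t) + t⁻¹ * g t)) (exp x) (-n) := by
        refine circleCoeff_congr fun θ => ?_
        have := circleMap_zero_ne_zero (exp_pos x) θ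
        simp only [hP]
        field_simp
        ring
      have c1 : Continuous fun θ => circleMap 0 (exp x) θ * g (circleMap 0 (exp x) θ) :=
        (hcm x).mul (hgc x hx)
      have c2 : Continuous fun θ => (circleMap 0 (exp x) θ)⁻¹ * g (circleMap 0 (exp x) θ) :=
        ((hcm x).inv₀ fun θ => circleMap_zero_ne_zero (exp_pos x) θ).mul (hgc x hx)
      have c3 : Continuous fun θ => 2 * g (circleMap 0 (exp x) θ) := continuous_const.mul (hgc x hx)
      rw [e2, circleCoeff_const_mul, circleCoeff_add (g := fun t => t * g t - 2 * g t)
        (h := fun t => t⁻¹ * g t) (exp_pos x) (c1.sub c3) c2, circleCoeff_sub (g := fun t => t * g t)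
        (h := fun t => 2 * g t) (exp_pos x) c1 c3, circleCoeff_const_mul,
        circleCoeff_id_mul (exp_pos x), circleCoeff_inv_mul (exp_pos x), hGx x hx, hGx x hx,
        hGx x hx]
    rw [circleCoeff_conj (exp_pos x), e1, ofReal_exp_zpow_two_mul, hD]
    unfold secondDiff
    simp only [map_mul, map_neg, map_add, map_sub, map_div₀, map_one, map_ofNat,
      Complex.conj_ofReal]
    rw [show -(n + 1) = -n - 1 by ring, show -(n - 1) = -n + 1 by ring]
    ring
  have hcU : ∀ x, |x| < s → x ≠ 0 → ∀ n : ℤ, n * circleCoeff U (exp x) n =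
      G n - (exp (2 * x) : ℂ) ^ (-n) * (starRingEnd ℂ) (K (-n)) := by
    intro x hx hx0 n
    have c1 : Continuous fun θ => (starRingEnd ℂ) (k (circleMap 0 (exp x) θ)) :=
      Complex.continuous_conj.comp (hkc x hx)
    have e1 := mul_circleCoeff (h := U) (g := fun t => g t - (starRingEnd ℂ) (k t)) (exp_pos x)
      ((hgc x hx).sub c1) (fun θ => by
        have h0 := circleMap_zero_ne_zero (exp_pos x) θ
        have h1 := (hd _ (circleMap_exp_mem hx θ) (circleMap_exp_ne_one hx0 θ)).comp_hasDerivAt θ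
          (hasDerivAt_circleMap 0 (exp x) θ)
        refine h1.congr_deriv ?_
        rw [wirtinger_apply, ← map_mul, ← mul_assoc, div_mul_cancel₀ _ h0, ← mul_assoc (k _ / _),
          div_mul_cancel₀ _ h0, map_mul, Complex.conj_I]
        ring) n
    rw [e1, circleCoeff_sub (exp_pos x) (hgc x hx) c1, circleCoeff_conj (exp_pos x), hGx x hx,
      hKx x hx, ofReal_exp_zpow_two_mul]
  -- Single-valuedness of U: its angular derivative has mean zero.
  have hK0 : (starRingEnd ℂ) (K 0) = G 0 := by
    have hx : |s / 2| < s := by rw [abs_of_pos (by positivity)]; linarith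
    have := hcU (s / 2) hx (by positivity) 0
    simp only [Int.cast_zero, zero_mul, neg_zero, zpow_zero, one_mul] at this
    exact (sub_eq_zero.1 this.symm).symm
  -- The mean of U is affine in log|t|, and by `circleCoeff_zero_sub` the same constant serves on
  -- both sides of the circle through the exceptional point 1.
  obtain ⟨c₀, hc₀⟩ : ∃ c₀, ∀ x, |x| < s → x ≠ 0 → circleCoeff U (exp x) 0 = c₀ + 2 * x * G 0 := by
    have hx : |s / 2| < s := by rw [abs_of_pos (by positivity)]; linarith
    have hsub : ∀ x y, |x| < s → |y| < s → x ≠ 0 → y ≠ 0 → x ≤ y →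
        circleCoeff U (exp y) 0 - circleCoeff U (exp x) 0 = (y - x) * (G 0 + G 0) := by
      intro x y hx hy hx0 hy0 hxy
      have := circleCoeff_zero_sub hg.continuousOn hk.continuousOn hd hx hy hx0 hy0 hxy
        (fun r hr => hGx r hr 0) (fun r hr => hKx r hr 0)
      rwa [hK0] at this
    refine ⟨circleCoeff U (exp (s / 2)) 0 - s * G 0, fun x hxs hx0 => ?_⟩
    rcases le_total x (s / 2) with h | h
    · have := hsub x (s / 2) hxs hx hx0 (by positivity) h
      push_cast at this ⊢
      linear_combination -this
    · have := hsub (s / 2) x hx hxs (by positivity) hx0 h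
      push_cast at this ⊢
      linear_combination this
  set C : ℝ → ℤ → ℂ := fun x n => if n = 0 then c₀ + 2 * x * G 0 else
    (G n - (exp (2 * x) : ℂ) ^ (-n) * (starRingEnd ℂ) (K (-n))) / n with hC
  have hCmul : ∀ x (n : ℤ), n * C x n =
      G n - (exp (2 * x) : ℂ) ^ (-n) * (starRingEnd ℂ) (K (-n)) := by
    intro x n
    rcases eq_or_ne n 0 with rfl | hn
    · simp [hK0]
    · have : (n : ℂ) ≠ 0 := by exact_mod_cast hn
      simp only [hC, if_neg hn]
      field_simp
  have hCU : ∀ x, |x| < s → x ≠ 0 → ∀ n, circleCoeff U (exp x) n = C x n := by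
    intro x hx hx0 n
    rcases eq_or_ne n 0 with rfl | hn
    · simp only [hC, if_true]
      exact hc₀ x hx hx0
    · have : (n : ℂ) ≠ 0 := by exact_mod_cast hn
      exact mul_left_cancel₀ this ((hcU x hx hx0 n).trans (hCmul x n).symm)
  have hexp : ∀ n : ℤ, Continuous fun x : ℝ => ((exp (2 * x) : ℝ) : ℂ) ^ n := fun n =>
    Continuous.zpow₀ (by fun_prop) n fun x => Or.inl (by exact_mod_cast (exp_pos _).ne')
  have hCc : ∀ n, Continuous fun x => C x n := by
    intro n
    simp only [hC]
    split_ifs with hn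
    · fun_prop
    · exact (continuous_const.sub ((hexp _).mul continuous_const)).div_const _
  set H : ℤ → ℝ → ℂ := fun n x => C x (n - 1) - C x n + 1 / 2 *
    ((exp (2 * x) : ℂ) ^ (-(n - 1)) * D (n - 1) + (exp (2 * x) : ℂ) ^ (-n) * D n) with hH
  have hHc : ∀ n, Continuous (H n) := fun n =>
    ((hCc _).sub (hCc _)).add (continuous_const.mul
      (((hexp _).mul continuous_const).add ((hexp _).mul continuous_const)))
  -- Multiplying by t - 1 clears the pole of `position`: (t - 1)w = (t - 1)U - a(t + 1) conj P. In
  -- coefficients this is an index shift, and H is the result.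
  have hHw : ∀ n x, |x| < s → x ≠ 0 →
      circleCoeff w (exp x) (n - 1) - circleCoeff w (exp x) n = H n x := by
    intro n x hx hx0
    have c1 : Continuous fun θ => (starRingEnd ℂ) (P (circleMap 0 (exp x) θ)) :=
      Complex.continuous_conj.comp (hPc x hx)
    have hne : ∀ θ, circleMap 0 (exp x) θ - 1 ≠ 0 := fun θ =>
      sub_ne_zero.2 (circleMap_exp_ne_one hx0 θ)
    have c2 : Continuous fun θ => w (circleMap 0 (exp x) θ) := by
      have : Continuous fun θ => U (circleMap 0 (exp x) θ) - a * ((circleMap 0 (exp x) θ + 1) /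
          (circleMap 0 (exp x) θ - 1)) * (starRingEnd ℂ) (P (circleMap 0 (exp x) θ)) :=
        (hUc x hx hx0).sub ((continuous_const.mul (((hcm x).add continuous_const).div
          ((hcm x).sub continuous_const) hne)).mul c1)
      refine this.congr fun θ => ?_
      simp only [hU, position]
      ring
    have cU := hUc x hx hx0
    have e1 : circleCoeff (fun t => t * w t - w t) (exp x) n = circleCoeff (fun t => (t * U t - U t) -
        a * (t * (starRingEnd ℂ) (P t) + (starRingEnd ℂ) (P t))) (exp x) n := by
      refine circleCoeff_congr fun θ => ?_
      have := hne θ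
      simp only [hU, position]
      field_simp
      ring
    have c3 : Continuous fun θ => circleMap 0 (exp x) θ * w (circleMap 0 (exp x) θ) :=
      (hcm x).mul c2
    have c4 : Continuous fun θ => circleMap 0 (exp x) θ * U (circleMap 0 (exp x) θ) :=
      (hcm x).mul cU
    have c5 : Continuous fun θ => circleMap 0 (exp x) θ *
      (starRingEnd ℂ) (P (circleMap 0 (exp x) θ)) := (hcm x).mul c1
    rw [circleCoeff_sub (g := fun t => t * w t) (exp_pos x) c3 c2, circleCoeff_id_mul (exp_pos x),
      circleCoeff_sub (g := fun t => t * U t - U t)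
        (h := fun t => a * (t * (starRingEnd ℂ) (P t) + (starRingEnd ℂ) (P t))) (exp_pos x)
        (c4.sub cU) (continuous_const.mul (c5.add c1)),
      circleCoeff_sub (g := fun t => t * U t) (exp_pos x) c4 cU, circleCoeff_id_mul (exp_pos x),
      circleCoeff_const_mul, circleCoeff_add (g := fun t => t * (starRingEnd ℂ) (P t))
        (h := fun t => (starRingEnd ℂ) (P t)) (exp_pos x) c5 c1, circleCoeff_id_mul (exp_pos x),
      hCU x hx hx0, hCU x hx hx0, hcP x hx, hcP x hx] at e1
    rw [e1]
    simp only [hH]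
    field_simp
    ring
  -- H is continuous up to x = ±s even though w is only known inside, so the boundary condition
  -- passes to the limit coefficient by coefficient.
  have hHs : ∀ n, H n s = 0 := by
    intro n
    have t1 := ((tendsto_circleCoeff_zero nhdsWithin_le_nhds hb (n - 1)).sub
      (tendsto_circleCoeff_zero nhdsWithin_le_nhds hb n))
    have t2 : Tendsto (H n) (𝓝[<] s) (𝓝 (H n s)) := (hHc n).continuousAt.continuousWithinAt
    rw [sub_zero] at t1
    refine tendsto_nhds_unique (t2.congr' ?_) t1
    filter_upwards [Ioo_mem_nhdsLT hs] with x hx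
    exact (hHw n x (by rw [abs_of_pos hx.1]; exact hx.2) hx.1.ne').symm
  have hHs' : ∀ n, H n (-s) = 0 := by
    intro n
    have t1 := ((tendsto_circleCoeff_zero nhdsWithin_le_nhds hb' (n - 1)).sub
      (tendsto_circleCoeff_zero nhdsWithin_le_nhds hb' n))
    have t2 : Tendsto (H n) (𝓝[>] (-s)) (𝓝 (H n (-s))) := (hHc n).continuousAt.continuousWithinAt
    rw [sub_zero] at t1
    refine tendsto_nhds_unique (t2.congr' ?_) t1
    filter_upwards [Ioo_mem_nhdsGT (neg_lt_zero.2 hs)] with x hx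
    exact (hHw n x (by rw [abs_of_neg hx.2]; linarith [hx.1]) hx.2.ne).symm
  have hinv : ∀ n : ℤ, ((exp (2 * -s) : ℝ) : ℂ) ^ (-n) = ((exp (2 * s) : ℝ) : ℂ) ^ n := by
    intro n
    rw [mul_neg, exp_neg, Complex.ofReal_inv, inv_zpow', neg_neg]
  have hlim := tendsto_circleCoeff_atTop hs hg
  have hzero := eq_zero_of_boundary_system hs (G := G) (K := K) (cp := C s) (cm := C (-s))
    hlim.1 hlim.2 (hCmul s) (fun n => by rw [hCmul, hinv])
    (by simp only [hC, if_true]; push_cast; ring)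
    (fun n => by
      have := hHs n
      simp only [hH] at this
      linear_combination this)
    (fun n => by
      have := hHs' n
      simp only [hH, hinv] at this
      linear_combination this)
  intro t ht
  have ht0 := ne_zero_of_mem_openAnnulus ht
  have hpos := norm_pos_iff.2 ht0
  have hlog : |log ‖t‖| < s :=
    abs_lt.2 ⟨(lt_log_iff_exp_lt hpos).2 ht.1, (log_lt_iff_lt_exp hpos).2 ht.2⟩
  have hsub : Metric.sphere (0 : ℂ) ‖t‖ ⊆ openAnnulus s := fun w hw => by
    rw [mem_sphere_zero_iff_norm] at hw
    exact ⟨hw ▸ ht.1, hw ▸ ht.2⟩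
  refine ⟨eq_zero_of_circleCoeff_eq_zero hpos (hg.continuousOn.mono hsub) (fun n => ?_) rfl,
    eq_zero_of_circleCoeff_eq_zero hpos (hk.continuousOn.mono hsub) (fun n => ?_) rfl⟩
  · rw [← exp_log hpos, hGx _ hlog, (hzero n).1]
  · rw [← exp_log hpos, hKx _ hlog, (hzero n).2]

end

/-! ### Behaviour at infinity: extension across t = 1 and Cauchy estimates. -/

section
open Filter Topology Real Asymptotics

theorem wirtinger_sub (a b c d : ℂ) :
    wirtinger a b - wirtinger c d = wirtinger (a - c) (b - d) := by
  ext h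
  simp only [sub_apply, wirtinger_apply]
  ring

theorem norm_fst_le_wirtinger (a b : ℂ) : ‖a‖ ≤ ‖wirtinger a b‖ := by
  have e : (2 : ℂ) * a = wirtinger a b 1 - Complex.I * wirtinger a b Complex.I := by
    simp only [wirtinger_apply, map_one, Complex.conj_I]
    linear_combination (a - b) * Complex.I_sq
  have h1 := (wirtinger a b).le_opNorm 1
  have h2 := (wirtinger a b).le_opNorm Complex.I
  have h3 := norm_sub_le (wirtinger a b 1) (Complex.I * wirtinger a b Complex.I)
  rw [← e, norm_mul, norm_mul, Complex.norm_two, Complex.norm_I] at h3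
  rw [norm_one] at h1
  rw [Complex.norm_I] at h2
  linarith

theorem norm_snd_le_wirtinger (a b : ℂ) : ‖b‖ ≤ ‖wirtinger a b‖ := by
  have e : (2 : ℂ) * b = wirtinger a b 1 + Complex.I * wirtinger a b Complex.I := by
    simp only [wirtinger_apply, map_one, Complex.conj_I]
    linear_combination (a - b) * Complex.I_sq * (-1)
  have h1 := (wirtinger a b).le_opNorm 1
  have h2 := (wirtinger a b).le_opNorm Complex.I
  have h3 := norm_add_le (wirtinger a b 1) (Complex.I * wirtinger a b Complex.I)
  rw [← e, norm_mul, norm_mul, Complex.norm_two, Complex.norm_I] at h3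
  rw [norm_one] at h1
  rw [Complex.norm_I] at h2
  linarith

theorem tendsto_sub_one_punctured : Tendsto (fun t : ℂ => t - 1) (𝓝[≠] 1) (𝓝[≠] 0) := by
  refine tendsto_nhdsWithin_iff.2 ⟨?_, ?_⟩
  · have h : Continuous fun t : ℂ => t - 1 := by fun_prop
    simpa using (h.tendsto 1).mono_left nhdsWithin_le_nhds
  · filter_upwards [self_mem_nhdsWithin] with t ht
    exact sub_ne_zero.2 ht

theorem tendsto_mul_position_cobounded {a : ℝ} (ha : a ≠ 0) :
    Tendsto (fun t => (a : ℂ) * position t) (𝓝[≠] 1) (Bornology.cobounded ℂ) := by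
  have ha' : (2 * a : ℂ) ≠ 0 := mul_ne_zero two_ne_zero (by exact_mod_cast ha)
  have h2 := (tendsto_mul_left_cobounded ha').comp (tendsto_inv₀_nhdsNE_zero.comp tendsto_sub_one_punctured)
  have h3 := (tendsto_add_const_cobounded (a : ℂ)).comp h2
  refine h3.congr' ?_
  filter_upwards [self_mem_nhdsWithin] with t ht
  have := sub_ne_zero.2 ht
  simp only [Function.comp, position]
  field_simp
  ring

theorem hasDerivAt_mul_position (a : ℝ) {t : ℂ} (ht : t ≠ 1) :
    HasDerivAt (fun t => (a : ℂ) * position t) (a * (-2 / (t - 1) ^ 2)) t :=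
  (hasDerivAt_position ht).const_mul _

/-- A holomorphic function with quadratic decay, multiplied by the derivative of the position,
extends holomorphically to the whole annulus. -/
theorem exists_extension_of_isBigO {a s : ℝ} (ha : a ≠ 0) (hs : 0 < s) {F : ℂ → ℂ}
    (hF : DifferentiableOn ℂ F (annulusPreimage a s))
    (hO : F =O[Bornology.cobounded ℂ] fun z => (‖z‖ ^ 2)⁻¹) :
    ∃ g, DifferentiableOn ℂ g (openAnnulus s) ∧ ∀ t, t ≠ 1 →
      g t = t * (a * (-2 / (t - 1) ^ 2)) * F (a * position t) := by
  have ha' : (a : ℂ) ≠ 0 := by exact_mod_cast ha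
  set f : ℂ → ℂ := fun t => t * (a * (-2 / (t - 1) ^ 2)) * F (a * position t) with hf
  have hd : DifferentiableOn ℂ f (openAnnulus s \ {1}) := by
    intro t ht
    have h1 : t - 1 ≠ 0 := sub_ne_zero.2 ht.2
    have hz := mul_position_mem_annulusPreimage ha ht.2 ht.1
    have h2 := (hF.differentiableAt ((isOpen_annulusPreimage ha).mem_nhds hz)).comp t
      (hasDerivAt_mul_position a ht.2).differentiableAt
    have h3 : DifferentiableAt ℂ (fun t : ℂ => t * (a * (-2 / (t - 1) ^ 2))) t := by
      fun_prop (disch := exact pow_ne_zero 2 h1)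
    exact (h3.mul h2).differentiableWithinAt
  -- The position has derivative of order (t - 1)⁻², while quadratic decay makes F of order (t -
  -- 1)²; the product is bounded and the singularity removable.
  have hbd : f =O[𝓝[≠] 1] fun _ => (1 : ℝ) := by
    have h1 := hO.comp_tendsto (tendsto_mul_position_cobounded ha)
    have h2 : ContinuousAt (fun t : ℂ => t * (-2 / (a * (t + 1) ^ 2))) 1 := by
      fun_prop (disch := norm_num [ha])
    have h3 : (fun t : ℂ => t * (-2 / (a * (t + 1) ^ 2))) =O[𝓝[≠] 1] fun _ => (1 : ℝ) :=
      (h2.tendsto.isBigO_one ℝ).mono nhdsWithin_le_nhds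
    have h4 : (fun t : ℂ => (a * position t) ^ 2 * F (a * position t)) =O[𝓝[≠] 1]
        fun _ => (1 : ℝ) := by
      have h5 := (isBigO_refl (fun t : ℂ => ‖(a : ℂ) * position t‖ ^ 2) (𝓝[≠] 1)).mul h1.norm_left
      refine IsBigO.trans (IsBigO.of_bound 1 (Eventually.of_forall fun t => ?_))
        (h5.trans (IsBigO.of_bound 1 (Eventually.of_forall fun t => ?_)))
      · simp
      · simp only [Function.comp]
        rcases eq_or_ne ((a : ℂ) * position t) 0 with h | h
        · simp [h]
        · have := norm_ne_zero_iff.2 h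
          rw [mul_inv_cancel₀ (pow_ne_zero 2 this)]
          simp
    have h6 := h3.mul h4
    simp only [mul_one] at h6
    refine h6.congr' ?_ EventuallyEq.rfl
    have hne : ∀ᶠ t : ℂ in 𝓝[≠] 1, t + 1 ≠ 0 := by
      have h : Continuous fun t : ℂ => t + 1 := by fun_prop
      exact nhdsWithin_le_nhds ((h.tendsto 1).eventually_ne (by norm_num))
    filter_upwards [self_mem_nhdsWithin, hne] with t ht ht'
    have h1 : t - 1 ≠ 0 := sub_ne_zero.2 ht
    simp only [hf, position]
    field_simp
  refine ⟨Function.update f 1 (limUnder (𝓝[≠] 1) f), ?_, fun t ht => Function.update_of_ne ht _ _⟩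
  refine Complex.differentiableOn_update_limUnder_of_isLittleO
    ((isOpen_openAnnulus s).mem_nhds (one_mem_openAnnulus hs)) hd ?_
  have h7 : (fun t => f t - f 1) =O[𝓝[≠] 1] fun _ => (1 : ℝ) :=
    hbd.sub (isBigO_const_const _ one_ne_zero _)
  refine h7.trans_isLittleO ?_
  rw [isLittleO_const_left]
  right
  exact tendsto_norm_cobounded_atTop.comp (tendsto_inv₀_nhdsNE_zero.comp tendsto_sub_one_punctured)

/-- Cauchy's estimate on the disk of radius |z|/2 gains a factor |z|⁻¹, which the factor conj z uses
up. -/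
theorem deriv_isBigO_of_isBigO {P : ℂ → ℂ} {Ω : Set ℂ} (hΩ : Ω ∈ Bornology.cobounded ℂ)
    (hP : DifferentiableOn ℂ P Ω) (hO : P =O[Bornology.cobounded ℂ] fun z => (‖z‖ ^ 2)⁻¹) :
    (fun z => (starRingEnd ℂ) z * deriv P z) =O[Bornology.cobounded ℂ] fun z => (‖z‖ ^ 2)⁻¹ := by
  obtain ⟨C, hC⟩ := hO.bound
  rw [← comap_norm_atTop, mem_comap] at hΩ
  rw [← comap_norm_atTop, eventually_comap, eventually_atTop] at hC
  obtain ⟨S, hS, hS'⟩ := hΩ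
  obtain ⟨r₁, hr₁⟩ := mem_atTop_sets.1 hS
  obtain ⟨r₂, hr₂⟩ := hC
  refine IsBigO.of_bound (8 * C) ?_
  filter_upwards [tendsto_norm_cobounded_atTop.eventually_gt_atTop (2 * |r₁|),
    tendsto_norm_cobounded_atTop.eventually_gt_atTop (2 * |r₂|),
    tendsto_norm_cobounded_atTop.eventually_gt_atTop 0] with z h1 h2 h0
  have hfar : ∀ w ∈ Metric.closedBall z (‖z‖ / 2), ‖z‖ / 2 ≤ ‖w‖ := by
    intro w hw
    rw [mem_closedBall_iff_norm] at hw
    have := norm_sub_norm_le z w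
    rw [norm_sub_rev] at this
    linarith
  have hball : Metric.closedBall z (‖z‖ / 2) ⊆ Ω := fun w hw =>
    hS' (hr₁ _ (by linarith [hfar w hw, le_abs_self r₁]))
  have hb : ∀ w ∈ Metric.sphere z (‖z‖ / 2), ‖P w‖ ≤ C * (4 * (‖z‖ ^ 2)⁻¹) := by
    intro w hw
    have hw' := hfar w (Metric.sphere_subset_closedBall hw)
    have h3 := hr₂ ‖w‖ (by linarith [le_abs_self r₂]) w rfl
    rw [norm_inv, norm_pow, norm_norm] at h3
    have hw0 : 0 < ‖w‖ := by linarith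
    have hC0 : 0 ≤ C := by
      by_contra! hneg
      have := mul_neg_of_neg_of_pos hneg (inv_pos.2 (pow_pos hw0 2))
      linarith [norm_nonneg (P w)]
    refine h3.trans (mul_le_mul_of_nonneg_left ?_ hC0)
    have h4 : (‖z‖ / 2) ^ 2 ≤ ‖w‖ ^ 2 := pow_le_pow_left₀ (by positivity) hw' 2
    calc (‖w‖ ^ 2)⁻¹ ≤ ((‖z‖ / 2) ^ 2)⁻¹ := inv_anti₀ (by positivity) h4
      _ = 4 * (‖z‖ ^ 2)⁻¹ := by field_simp; norm_num
  have hdc : DiffContOnCl ℂ P (Metric.ball z (‖z‖ / 2)) :=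
    (hP.mono ((closure_ball z (by positivity)).subset.trans hball)).diffContOnCl
  have h5 := Complex.norm_deriv_le_of_forall_mem_sphere_norm_le (by positivity) hdc hb
  rw [norm_mul, RCLike.norm_conj, norm_inv, norm_pow, norm_norm]
  calc _ ≤ ‖z‖ * (C * (4 * (‖z‖ ^ 2)⁻¹) / (‖z‖ / 2)) := by gcongr
    _ = _ := by field_simp; ring

end

/-! ### Arbitrary solutions transported to the annulus. -/

section
open Filter Topology Real Asymptotics

theorem mul_position_toAnnulus {a : ℝ} (ha : a ≠ 0) {z : ℂ} (hz : z ≠ a) :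
    (a : ℂ) * position (toAnnulus a z) = z := by
  have ha' : (a : ℂ) ≠ 0 := by exact_mod_cast ha
  rw [position_toAnnulus ha hz]
  field_simp

theorem planarField_sub_shearFlow (U : ℂ → ℂ) :
    (fun x => planarField U x - shearFlow x) =
      planarField (fun z => U z - Complex.I * (starRingEnd ℂ) z) := by
  ext x i
  fin_cases i <;> simp [planarField, shearFlow, toComplex_symm_zero, toComplex_symm_one,
    toComplex_re, toComplex_im]

/-- Uniform continuity on the compact set of radii and angles makes the boundary decay uniform in
the angle. -/
theorem eventually_norm_circleMap_le {w : ℂ → ℂ} {I : Set ℝ} (hI : IsCompact I) {x₀ : ℝ}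
    (hx₀ : x₀ ∈ I) (hc : ContinuousOn w {t | ∃ x ∈ I, ‖t‖ = exp x})
    (h0 : ∀ t, ‖t‖ = exp x₀ → w t = 0) {ε : ℝ} (hε : 0 < ε) :
    ∀ᶠ x in 𝓝[I] x₀, ∀ θ, ‖w (circleMap 0 (exp x) θ)‖ ≤ ε := by
  have hmap : Continuous fun p : ℝ × ℝ => circleMap 0 (exp p.1) p.2 := by
    unfold circleMap; fun_prop
  have hcont : ContinuousOn (fun p : ℝ × ℝ => w (circleMap 0 (exp p.1) p.2))
      (I ×ˢ Set.Icc 0 (2 * π)) :=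
    hc.comp hmap.continuousOn fun p hp => ⟨p.1, hp.1, norm_circleMap_zero' (exp_pos _) _⟩
  have hu := (hI.prod isCompact_Icc).uniformContinuousOn_of_continuous hcont
  obtain ⟨η, hη, hu⟩ := Metric.uniformContinuousOn_iff.1 hu ε hε
  have hball : Metric.ball x₀ η ∈ 𝓝[I] x₀ := nhdsWithin_le_nhds (Metric.ball_mem_nhds x₀ hη)
  filter_upwards [self_mem_nhdsWithin, hball] with x hx hxb θ
  obtain ⟨θ', hθ', e⟩ := (periodic_circleMap 0 (exp x)).exists_mem_Ico₀ two_pi_pos θ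
  rw [e]
  have hθ : θ' ∈ Set.Icc 0 (2 * π) := Set.Ico_subset_Icc_self hθ'
  have h := hu (x, θ') ⟨hx, hθ⟩ (x₀, θ') ⟨hx₀, hθ⟩ (by
    rw [Prod.dist_eq, dist_self]
    exact max_lt hxb hη)
  simp only at h
  rw [h0 _ (norm_circleMap_zero' (exp_pos _) _), dist_zero_right] at h
  exact h.le

section

variable {μ R δ s : ℝ} {v : Plane → Plane} {q : Plane → ℝ}

/-- The complex velocity of a planar vector field. -/
def complexField (v : Plane → Plane) (z : ℂ) : ℂ := toComplex (v (toComplex.symm z))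

theorem preimage_annulusPreimage (hR : 0 < R) (hs : 0 < s) (hc : R * cosh s = R + δ / 2) :
    fluidDomain R δ = toComplex ⁻¹' annulusPreimage (R * sinh s) s := by
  rw [fluidDomain_eq hR, ← hc]
  ext x
  exact mem_exteriorDomain_iff hR hs

theorem IsNoSlipShearSolution.exists_goursat (h : IsNoSlipShearSolution μ R δ v q) (hμ : 0 < μ)
    (hR : 0 < R) (hs : 0 < s) (hc : R * cosh s = R + δ / 2) :
    ∃ P K : ℂ → ℂ, DifferentiableOn ℂ P (annulusPreimage (R * sinh s) s) ∧
      DifferentiableOn ℂ K (annulusPreimage (R * sinh s) s) ∧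
      (∀ z ∈ annulusPreimage (R * sinh s) s, HasFDerivAt (complexField v)
        (wirtinger (P z - (starRingEnd ℂ) (P z))
          ((starRingEnd ℂ) (K z) - z * (starRingEnd ℂ) (deriv P z))) z) ∧
      ∀ z ∈ annulusPreimage (R * sinh s) s, q (toComplex.symm z) = -4 * μ * (P z).re := by
  have ha : R * sinh s ≠ 0 := (mul_pos hR (sinh_pos_iff.2 hs)).ne'
  have hst := h.stokes
  rw [preimage_annulusPreimage hR hs hc, ← planarField_conj v,
    show q = fun x => (q ∘ toComplex.symm) (toComplex x) by ext x; simp] at hst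
  obtain ⟨h1, h2, h3, h4⟩ := isStokesFlow_planarField_iff.1 hst
  exact StokesTwoDisks.exists_goursat hμ.ne' (isOpen_annulusPreimage ha) h1 h2 h3 h4

theorem IsNoSlipShearSolution.decay_complex (h : IsNoSlipShearSolution μ R δ v q) :
    (fderiv ℝ (fun z => complexField v z - Complex.I * (starRingEnd ℂ) z)
      =O[Bornology.cobounded ℂ] fun z => (‖z‖ ^ 2)⁻¹) ∧
    ((fun z => q (toComplex.symm z)) =O[Bornology.cobounded ℂ] fun z => (‖z‖ ^ 2)⁻¹) := by
  have hd := h.decay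
  rw [← planarField_conj v, planarField_sub_shearFlow,
    show q = fun x => (fun z => q (toComplex.symm z)) (toComplex x) by ext x; simp] at hd
  exact ((decayClass_planarField_iff (Q := fun z => q (toComplex.symm z))).1 hd).2

theorem mul_position_mem_closure (hR : 0 < R) (hs : 0 < s) (hc : R * cosh s = R + δ / 2) {t : ℂ}
    (ht : t ∈ closedAnnulus s) (h1 : t ≠ 1) :
    toComplex.symm ((R * sinh s : ℝ) * position t) ∈ closure (fluidDomain R δ) := by
  have ha : R * sinh s ≠ 0 := (mul_pos hR (sinh_pos_iff.2 hs)).ne'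
  have ht0 := ne_zero_of_mem_closedAnnulus ht
  have hpos := norm_pos_iff.2 ht0
  have hlog : |log ‖t‖| ≤ s :=
    abs_le.2 ⟨(le_log_iff_exp_le hpos).2 ht.1, (log_le_iff_le_exp hpos).2 ht.2⟩
  -- This path multiplies log|t| by 1 - l, so it enters the open annulus at once even from a
  -- boundary circle.
  set γ : ℝ → ℂ := fun l => t * exp (-l * log ‖t‖) with hγ
  have hγc : Tendsto γ (𝓝[>] 0) (𝓝 t) := by
    have h : Continuous γ := by fun_prop
    simpa [hγ] using (h.tendsto 0).mono_left nhdsWithin_le_nhds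
  have hpc : Tendsto (fun l => toComplex.symm (((R * sinh s : ℝ) : ℂ) * position (γ l))) (𝓝[>] 0)
      (𝓝 (toComplex.symm ((R * sinh s : ℝ) * position t))) :=
    (toComplex.symm.continuous.tendsto _).comp
      ((hasDerivAt_mul_position _ h1).continuousAt.tendsto.comp hγc)
  refine mem_closure_of_tendsto hpc ?_
  filter_upwards [Ioo_mem_nhdsGT one_pos, hγc.eventually_ne h1] with l hl hne
  rw [preimage_annulusPreimage hR hs hc, Set.mem_preimage, LinearIsometryEquiv.apply_symm_apply]
  refine mul_position_mem_annulusPreimage ha hne ?_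
  have hn : ‖γ l‖ = exp ((1 - l) * log ‖t‖) := by
    rw [hγ, norm_mul, Complex.norm_real, norm_eq_abs, abs_of_pos (exp_pos _)]
    conv_lhs => rw [← exp_log hpos]
    rw [log_exp, ← exp_add]
    congr 1
    ring
  have hlt : |(1 - l) * log ‖t‖| < s := by
    rw [abs_mul, abs_of_pos (by linarith [hl.2])]
    nlinarith [hl.1, hl.2, abs_nonneg (log ‖t‖)]
  unfold openAnnulus
  rw [Set.mem_ofPred_eq, hn, exp_lt_exp, exp_lt_exp]
  exact abs_lt.1 hlt

theorem IsNoSlipShearSolution.continuousOn_annulus (h : IsNoSlipShearSolution μ R δ v q)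
    (hR : 0 < R) (hs : 0 < s) (hc : R * cosh s = R + δ / 2) :
    ContinuousOn (fun t => complexField v ((R * sinh s : ℝ) * position t))
      (closedAnnulus s \ {1}) := by
  have h1 : ContinuousOn (fun t => toComplex.symm (((R * sinh s : ℝ) : ℂ) * position t))
      (closedAnnulus s \ {1}) := fun t ht =>
    (toComplex.symm.continuous.continuousAt.comp
      (hasDerivAt_mul_position _ ht.2).continuousAt).continuousWithinAt
  exact toComplex.continuous.comp_continuousOn
    (h.continuousOn_closure.comp h1 fun t ht => mul_position_mem_closure hR hs hc ht.1 ht.2)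

theorem IsNoSlipShearSolution.eq_zero_annulus (h : IsNoSlipShearSolution μ R δ v q)
    (hR : 0 < R) (hs : 0 < s) (hc : R * cosh s = R + δ / 2) {t : ℂ}
    (ht : ‖t‖ = exp s ∨ ‖t‖ = exp (-s)) :
    complexField v ((R * sinh s : ℝ) * position t) = 0 := by
  have ha : R * sinh s ≠ 0 := (mul_pos hR (sinh_pos_iff.2 hs)).ne'
  have h1 : t ≠ 1 := by
    rintro rfl
    rcases ht with h | h <;>
    · rw [norm_one, eq_comm, exp_eq_one_iff] at h
      linarith
  have hz : ((R * sinh s : ℝ) : ℂ) * position t ≠ (R * sinh s : ℝ) := fun h =>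
    position_ne_one t (mul_left_cancel₀ (by exact_mod_cast ha) (h.trans (mul_one _).symm))
  have hfr : toComplex.symm ((R * sinh s : ℝ) * position t) ∈
      frontier (leftDisk R δ) ∪ frontier (rightDisk R δ) := by
    rw [mem_frontier_disks_iff hR, LinearIsometryEquiv.apply_symm_apply, ← hc,
      ← norm_toAnnulus_eq_iff hR hs hz, ← norm_toAnnulus_eq_neg_iff hR hs hz,
      toAnnulus_mul_position ha h1]
    exact ht
  rw [complexField, h.noSlip _ hfr, map_zero]

end

end

/-! ### Uniqueness of strain and pressure. -/

section
open Filter Topology Real Asymptotics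

/-- A pair of Goursat functions with quadratic decay whose velocity vanishes on the two boundary
circles vanishes identically. -/
theorem goursat_eq_zero {a s : ℝ} (ha : a ≠ 0) (hs : 0 < s) {u P K : ℂ → ℂ}
    (hP : DifferentiableOn ℂ P (annulusPreimage a s))
    (hK : DifferentiableOn ℂ K (annulusPreimage a s))
    (hu : ∀ z ∈ annulusPreimage a s, HasFDerivAt u (wirtinger (P z - (starRingEnd ℂ) (P z))
      ((starRingEnd ℂ) (K z) - z * (starRingEnd ℂ) (deriv P z))) z)
    (hdu : fderiv ℝ u =O[Bornology.cobounded ℂ] fun z => (‖z‖ ^ 2)⁻¹)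
    (hre : (fun z => (P z).re) =O[Bornology.cobounded ℂ] fun z => (‖z‖ ^ 2)⁻¹)
    (hb : ∀ ε > 0, ∀ᶠ x in 𝓝[<] s, ∀ θ, ‖u (a * position (circleMap 0 (exp x) θ))‖ ≤ ε)
    (hb' : ∀ ε > 0, ∀ᶠ x in 𝓝[>] (-s), ∀ θ, ‖u (a * position (circleMap 0 (exp x) θ))‖ ≤ ε) :
    ∀ z ∈ annulusPreimage a s, P z = 0 ∧ K z = 0 := by
  have ha' : (a : ℂ) ≠ 0 := by exact_mod_cast ha
  have hmem := eventually_mem_annulusPreimage a hs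
  -- Decay of the gradient controls the imaginary part of P; the real part is controlled by the
  -- hypothesis on the pressure.
  have hA : (fun z => P z - (starRingEnd ℂ) (P z)) =O[Bornology.cobounded ℂ]
      fun z => (‖z‖ ^ 2)⁻¹ := by
    refine IsBigO.trans (IsBigO.of_bound 1 ?_) hdu
    filter_upwards [hmem] with z hz
    rw [one_mul, (hu z hz).fderiv]
    exact norm_fst_le_wirtinger _ _
  have hB : (fun z => (starRingEnd ℂ) (K z) - z * (starRingEnd ℂ) (deriv P z))
      =O[Bornology.cobounded ℂ] fun z => (‖z‖ ^ 2)⁻¹ := by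
    refine IsBigO.trans (IsBigO.of_bound 1 ?_) hdu
    filter_upwards [hmem] with z hz
    rw [one_mul, (hu z hz).fderiv]
    exact norm_snd_le_wirtinger _ _
  have hre' : (fun z => ((P z).re : ℂ)) =O[Bornology.cobounded ℂ] fun z => (‖z‖ ^ 2)⁻¹ :=
    (IsBigO.of_bound 1 (Eventually.of_forall fun z => by
      rw [Complex.norm_real, one_mul])).trans hre
  have hPO : P =O[Bornology.cobounded ℂ] fun z => (‖z‖ ^ 2)⁻¹ := by
    refine ((hA.const_mul_left (1 / 2)).add hre').congr_left fun z => ?_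
    rw [Complex.re_eq_add_conj]
    ring
  -- The second Wirtinger derivative controls K only together with z conj P', which is handled by
  -- the Cauchy estimate.
  have hKO : K =O[Bornology.cobounded ℂ] fun z => (‖z‖ ^ 2)⁻¹ := by
    have h1 : (fun z => K z - (starRingEnd ℂ) z * deriv P z) =O[Bornology.cobounded ℂ]
        fun z => (‖z‖ ^ 2)⁻¹ := by
      refine IsBigO.trans (IsBigO.of_bound 1 (Eventually.of_forall fun z => ?_)) hB
      rw [one_mul, ← RCLike.norm_conj]
      simp
    refine (h1.add (deriv_isBigO_of_isBigO hmem hP hPO)).congr_left fun z => ?_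
    ring
  obtain ⟨g, hg, hg'⟩ := exists_extension_of_isBigO ha hs hP hPO
  obtain ⟨k, hk, hk'⟩ := exists_extension_of_isBigO ha hs hK hKO
  have hgP : ∀ t ∈ openAnnulus s, t ≠ 1 →
      -(t - 1) ^ 2 / (2 * a * t) * g t = P (a * position t) := by
    intro t ht h1
    have h0 := ne_zero_of_mem_openAnnulus ht
    have h1' := sub_ne_zero.2 h1
    rw [hg' t h1]
    field_simp
  have hd : ∀ t ∈ openAnnulus s, t ≠ 1 → HasFDerivAt (fun t => u (a * position t) +
      a * position t * (starRingEnd ℂ) (-(t - 1) ^ 2 / (2 * a * t) * g t))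
      (wirtinger (g t / t) ((starRingEnd ℂ) (k t / t))) t := by
    intro t ht h1
    have h0 := ne_zero_of_mem_openAnnulus ht
    have hz := mul_position_mem_annulusPreimage ha h1 ht
    have hPd := (hP.differentiableAt ((isOpen_annulusPreimage ha).mem_nhds hz)).hasDerivAt
    have h2 : HasFDerivAt (fun z => u z + z * (starRingEnd ℂ) (P z))
        (wirtinger (P (a * position t)) ((starRingEnd ℂ) (K (a * position t))))
        (a * position t) := by
      refine ((hu _ hz).add ((hasFDerivAt_id (𝕜 := ℝ) _).mul
        (hasFDerivAt_conj_of_hasDerivAt hPd))).congr_fderiv (ContinuousLinearMap.ext fun h => ?_)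
      simp only [add_apply, smul_apply, wirtinger_apply, smul_eq_mul,
        ContinuousLinearMap.id_apply]
      ring
    have h3 := h2.comp t (hasFDerivAt_of_hasDerivAt (hasDerivAt_mul_position a h1))
    refine (h3.congr_fderiv (ContinuousLinearMap.ext fun h => ?_)).congr_of_eventuallyEq ?_
    · simp only [ContinuousLinearMap.comp_apply, wirtinger_apply, hg' t h1, hk' t h1, zero_mul,
        add_zero]
      rw [mul_assoc t, mul_div_cancel_left₀ _ h0, mul_assoc t, mul_div_cancel_left₀ _ h0]
      simp only [map_mul]
      ring
    · filter_upwards [(isOpen_openAnnulus s).mem_nhds ht, isOpen_ne.mem_nhds h1] with τ hτ hτ1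
      rw [hgP τ hτ hτ1]
      rfl
  have hzero := eq_zero_of_homogeneous hs ha hg hk hd hb hb'
  intro z hz
  have h1 := toAnnulus_ne_one ha hz.1
  have h0 := ne_zero_of_mem_openAnnulus hz.2
  have hne : toAnnulus a z * (a * (-2 / (toAnnulus a z - 1) ^ 2)) ≠ 0 :=
    mul_ne_zero h0 (mul_ne_zero ha' (div_ne_zero (by norm_num)
      (pow_ne_zero 2 (sub_ne_zero.2 h1))))
  have e1 := hg' _ h1
  have e2 := hk' _ h1
  rw [(hzero _ hz.2).1, mul_position_toAnnulus ha hz.1] at e1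
  rw [(hzero _ hz.2).2, mul_position_toAnnulus ha hz.1] at e2
  exact ⟨(mul_eq_zero.1 e1.symm).resolve_left hne, (mul_eq_zero.1 e2.symm).resolve_left hne⟩

section

variable {μ R δ s : ℝ} {v v' : Plane → Plane} {q q' : Plane → ℝ}

/-- The range of radii excludes |t| = 1, since that circle passes through the image of infinity. -/
theorem IsNoSlipShearSolution.eventually_norm_sub_le (h : IsNoSlipShearSolution μ R δ v q)
    (h' : IsNoSlipShearSolution μ R δ v' q') (hR : 0 < R) (hs : 0 < s)
    (hc : R * cosh s = R + δ / 2) {l r x₀ : ℝ} (hl : -s ≤ l) (hr : r ≤ s)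
    (hx₀ : x₀ ∈ Set.Icc l r) (h0 : (0 : ℝ) ∉ Set.Icc l r) (hb : x₀ = s ∨ x₀ = -s)
    {ε : ℝ} (hε : 0 < ε) :
    ∀ᶠ x in 𝓝[Set.Icc l r] x₀, ∀ θ,
      ‖complexField v ((R * sinh s : ℝ) * position (circleMap 0 (exp x) θ)) -
        complexField v' ((R * sinh s : ℝ) * position (circleMap 0 (exp x) θ))‖ ≤ ε := by
  refine eventually_norm_circleMap_le (w := fun t =>
    complexField v ((R * sinh s : ℝ) * position t) -
      complexField v' ((R * sinh s : ℝ) * position t)) isCompact_Icc hx₀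
    (((h.continuousOn_annulus hR hs hc).sub (h'.continuousOn_annulus hR hs hc)).mono ?_) ?_ hε
  · rintro t ⟨x, hx, ht⟩
    refine ⟨⟨?_, ?_⟩, ?_⟩
    · rw [ht, exp_le_exp]; exact hl.trans hx.1
    · rw [ht, exp_le_exp]; exact hx.2.trans hr
    · rintro rfl
      rw [norm_one, eq_comm, exp_eq_one_iff] at ht
      exact h0 (ht ▸ hx)
  · intro t ht
    have ht' : ‖t‖ = exp s ∨ ‖t‖ = exp (-s) := by
      rcases hb with rfl | rfl
      · exact Or.inl ht
      · exact Or.inr ht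
    simp only [h.eq_zero_annulus hR hs hc ht', h'.eq_zero_annulus hR hs hc ht', sub_zero]

/-- Two solutions have the same strain and the same pressure. -/
theorem IsNoSlipShearSolution.strain_eq_and_eq (h : IsNoSlipShearSolution μ R δ v q)
    (h' : IsNoSlipShearSolution μ R δ v' q') (hμ : 0 < μ) (hR : 0 < R) (hs : 0 < s)
    (hc : R * cosh s = R + δ / 2) {x : Plane} (hx : x ∈ fluidDomain R δ) :
    strain v x = strain v' x ∧ q x = q' x := by
  have ha : R * sinh s ≠ 0 := (mul_pos hR (sinh_pos_iff.2 hs)).ne'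
  have hopen : IsOpen (annulusPreimage (R * sinh s) s) := isOpen_annulusPreimage ha
  obtain ⟨P, K, hP, hK, hU, hQ⟩ := h.exists_goursat hμ hR hs hc
  obtain ⟨P', K', hP', hK', hU', hQ'⟩ := h'.exists_goursat hμ hR hs hc
  have hmem := eventually_mem_annulusPreimage (R * sinh s) hs
  have hu : ∀ z ∈ annulusPreimage (R * sinh s) s,
      HasFDerivAt (fun z => complexField v z - complexField v' z)
        (wirtinger ((P z - P' z) - (starRingEnd ℂ) (P z - P' z))
          ((starRingEnd ℂ) (K z - K' z) - z * (starRingEnd ℂ) (deriv (fun z => P z - P' z) z)))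
        z := by
    intro z hz
    have hz' := hopen.mem_nhds hz
    refine ((hU z hz).sub (hU' z hz)).congr_fderiv ?_
    rw [wirtinger_sub, deriv_fun_sub (hP.differentiableAt hz') (hP'.differentiableAt hz')]
    simp only [map_sub]
    congr 1 <;> ring
  have hdu : fderiv ℝ (fun z => complexField v z - complexField v' z) =O[Bornology.cobounded ℂ]
      fun z => (‖z‖ ^ 2)⁻¹ := by
    refine (h.decay_complex.1.sub h'.decay_complex.1).congr' ?_ EventuallyEq.rfl
    filter_upwards [hmem] with z hz
    have hI := (hasFDerivAt_conj_of_hasDerivAt (hasDerivAt_id z)).const_mul Complex.I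
    have e1 := ((hU z hz).sub hI).fderiv
    have e2 := ((hU' z hz).sub hI).fderiv
    have e3 := ((hU z hz).sub (hU' z hz)).fderiv
    simp only [id_eq] at e1 e2
    exact (congrArg₂ (· - ·) e1 e2).trans ((sub_sub_sub_cancel_right _ _ _).trans e3.symm)
  have hre : (fun z => (P z - P' z).re) =O[Bornology.cobounded ℂ] fun z => (‖z‖ ^ 2)⁻¹ := by
    refine ((h.decay_complex.2.sub h'.decay_complex.2).const_mul_left (-1 / (4 * μ))).congr' ?_
      EventuallyEq.rfl
    filter_upwards [hmem] with z hz
    rw [hQ z hz, hQ' z hz, Complex.sub_re]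
    field_simp
    ring
  have hzero := goursat_eq_zero ha hs (hP.sub hP') (hK.sub hK') hu hdu hre
    (fun ε hε => by
      refine Eventually.filter_mono ?_ (h.eventually_norm_sub_le h' hR hs hc (l := s / 2) (r := s)
        (x₀ := s) (by linarith) le_rfl ⟨by linarith, le_rfl⟩ (fun h => by linarith [h.1])
        (Or.inl rfl) hε)
      exact (nhdsWithin_Ico_eq_nhdsLT (by linarith : s / 2 < s)).ge.trans
        (nhdsWithin_mono _ Set.Ico_subset_Icc_self))
    (fun ε hε => by
      refine Eventually.filter_mono ?_ (h.eventually_norm_sub_le h' hR hs hc (l := -s)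
        (r := -(s / 2)) (x₀ := -s) le_rfl (by linarith) ⟨le_rfl, by linarith⟩
        (fun h => by linarith [h.2]) (Or.inr rfl) hε)
      exact (nhdsWithin_Ioc_eq_nhdsGT (by linarith : -s < -(s / 2))).ge.trans
        (nhdsWithin_mono _ Set.Ioc_subset_Icc_self))
  have hzx : toComplex x ∈ annulusPreimage (R * sinh s) s := by
    rw [preimage_annulusPreimage hR hs hc] at hx
    exact hx
  have eP : ∀ z ∈ annulusPreimage (R * sinh s) s, P z = P' z := fun z hz =>
    sub_eq_zero.1 (hzero z hz).1
  have eK := sub_eq_zero.1 (hzero _ hzx).2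
  have eD : deriv P (toComplex x) = deriv P' (toComplex x) :=
    EventuallyEq.deriv_eq (eventually_of_mem (hopen.mem_nhds hzx) eP)
  have him : ∀ w : ℂ, (w - (starRingEnd ℂ) w).re = 0 := fun w => by simp
  constructor
  · have e1 := strain_planarField (hU _ hzx).fderiv (him _)
    have e2 := strain_planarField (hU' _ hzx).fderiv (him _)
    rw [show planarField (complexField v) = v from planarField_conj v, eD, eK] at e1
    rw [show planarField (complexField v') = v' from planarField_conj v'] at e2
    rw [e1, e2]
  · have e1 := hQ _ hzx
    have e2 := hQ' _ hzx
    rw [LinearIsometryEquiv.symm_apply_apply] at e1 e2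
    rw [e1, e2, eP _ hzx]

end

end

end StokesTwoDisks

end

/-! ### The theorem: existence by construction, bounds by comparison with the constructed solution.
-/

theorem mainTheorem6 (R μ : ℝ) (hR : 0 < R) (hμ : 0 < μ) :
    (∀ δ : ℝ, 0 < δ →
      ∃ (v : StokesTwoDisks.Plane → StokesTwoDisks.Plane) (q : StokesTwoDisks.Plane → ℝ),
        StokesTwoDisks.IsNoSlipShearSolution μ R δ v q) ∧
    (∀ δ₀ : ℝ, 0 < δ₀ → ∃ C : ℝ, ∀ δ : ℝ, 0 < δ → δ ≤ δ₀ →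
      ∀ (v : StokesTwoDisks.Plane → StokesTwoDisks.Plane) (q : StokesTwoDisks.Plane → ℝ),
        StokesTwoDisks.IsNoSlipShearSolution μ R δ v q →
        ∀ x ∈ StokesTwoDisks.fluidDomain R δ,
          (∀ i j : Fin 2, |StokesTwoDisks.strain v x i j| ≤ C) ∧
          |q x| ≤ C ∧
          (∀ i j : Fin 2, |StokesTwoDisks.stress μ v q x i j| ≤ C)) := by
  refine ⟨fun δ hδ => ?_, fun δ₀ hδ₀ => ?_⟩
  · obtain ⟨s, hs, hc⟩ := StokesTwoDisks.exists_halfWidth hR hδ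
    obtain ⟨G, hG⟩ := StokesTwoDisks.exists_isShearSeq hs
    exact ⟨_, _, StokesTwoDisks.isNoSlipShearSolution_shear hG hR hs hc⟩
  · obtain ⟨s₀, hs₀, hc₀⟩ := StokesTwoDisks.exists_halfWidth hR hδ₀
    set A : ℝ := 120000 * Real.exp (12 * s₀) with hA
    set B : ℝ := 2368 * μ * Real.exp (12 * s₀) with hB
    have hA0 : 0 ≤ A := by positivity
    have hB0 : 0 ≤ B := by positivity
    have hμA : 0 ≤ 2 * μ * A := by positivity
    refine ⟨A + B + 2 * μ * A, fun δ hδ hle v q h x hx => ?_⟩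
    obtain ⟨s, hs, hc⟩ := StokesTwoDisks.exists_halfWidth hR hδ
    obtain ⟨G, hG⟩ := StokesTwoDisks.exists_isShearSeq hs
    -- The half-width increases with the gap, so exp(12 s₀) dominates every constant for δ ≤ δ₀.
    have hss : s ≤ s₀ := by
      have h1 : R * Real.cosh s ≤ R * Real.cosh s₀ := by linarith
      have h2 := Real.cosh_le_cosh.1 (le_of_mul_le_mul_left h1 hR)
      rwa [abs_of_pos hs, abs_of_pos hs₀] at h2
    have hexp : Real.exp (12 * s) ≤ Real.exp (12 * s₀) := Real.exp_le_exp.2 (by linarith)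
    obtain ⟨h1, h2⟩ := StokesTwoDisks.shear_bounds hG hR hs hμ hc hx
    obtain ⟨e1, e2⟩ := h.strain_eq_and_eq
      (StokesTwoDisks.isNoSlipShearSolution_shear hG hR hs hc) hμ hR hs hc hx
    have hE : ∀ i j, |StokesTwoDisks.strain v x i j| ≤ A := fun i j => by
      rw [e1]
      exact (h1 i j).trans (mul_le_mul_of_nonneg_left hexp (by norm_num))
    have hq : |q x| ≤ B := by
      rw [e2]
      exact h2.trans (mul_le_mul_of_nonneg_left hexp (by positivity))
    refine ⟨fun i j => (hE i j).trans (by linarith), hq.trans (by linarith), fun i j => ?_⟩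
    have e : StokesTwoDisks.stress μ v q x i j =
        -(q x) * (1 : Matrix (Fin 2) (Fin 2) ℝ) i j + 2 * μ * StokesTwoDisks.strain v x i j := by
      simp [StokesTwoDisks.stress]
    have h3 : |-(q x) * (1 : Matrix (Fin 2) (Fin 2) ℝ) i j| ≤ |q x| := by
      rw [abs_mul, abs_neg]
      refine mul_le_of_le_one_right (abs_nonneg _) ?_
      rw [Matrix.one_apply]
      split_ifs <;> simp
    have h4 : |2 * μ * StokesTwoDisks.strain v x i j| ≤ 2 * μ * A := by
      rw [abs_mul, abs_of_pos (by positivity : 0 < 2 * μ)]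
      exact mul_le_mul_of_nonneg_left (hE i j) (by positivity)
    rw [e]
    exact (abs_add_le _ _).trans (by linarith)
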